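/- Let $G$ and $H$ be compact groups, let $n\ge 0$, and for $i=1,\dots,n$ let $\mathcal I_i$ and $\mathcal O_i$ be nonzero finite-dimensional Hilbert spaces with fixed (computational) orthonormal bases, carrying continuous unitary representations $\rho_i$ of $G$ on $\mathcal I_i$ and $\sigma_i$ of $H$ on $\mathcal O_i$. A bar denotes entrywise complex conjugation in the computational bases. A quantum comb is a sequence of quantum channels $\Psi_i:\mathrm{End}(\mathcal I_i\otimes\mathcal A_{i-1})\to\mathrm{End}(\mathcal O_i\otimes\mathcal A_i)$, $i=1,\dots,n$, with finite-dimensional memories $\mathcal A_i$ and $\mathcal A_0\simeq\mathcal A_n\simeq\mathbb C$. Composing the channels along the memories gives a channel $\Psi$ from $\mathcal I^n=\bigotimes_i\mathcal I_i$ to $\mathcal O^n=\bigotimes_i\mathcal O_i$, and the Choi matrix of the comb is $C=\sum_{\vec x,\vec y}|\vec x\rangle\langle\vec y|\otimes\Psi(|\vec x\rangle\langle\vec y|)$. For $0\le i\le n$ let $\widehat G^{(i)}$ be the set of (equivalence classes of) irreducible representations occurring in $\rho_1\otimes\cdots\otimes\rho_i$ (for $i=0$: only the trivial one), each $\lambda$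 with a chosen unitary model on $V_\lambda=\mathbb C^{d_\lambda}$; define $\widehat H^{(i)}$ likewise from $\sigma_1,\dots,\sigma_i$. A Clebsch–Gordan (CG) transform for $\rho_i$ consists of unitary intertwiners $$\mathrm{CG}_{\lambda,\rho_i}: V_{\lambda}\otimes\mathcal I_i\to\bigoplus_{\lambda'\in\widehat G^{(i)}}V_{\lambda'}\otimes\mathbb C^{c^{\lambda'}_{\lambda\rho_i}},\qquad \lambda\in\widehat G^{(i-1)}.$$ A dual CG transform for $\sigma_i$ consists of unitary intertwiners, for the conjugate representation $\overline{\sigma_i}$, $$\mathrm{CG}_{\mu',\overline{\sigma_i}}: V_{\mu'}\otimes\overline{\mathcal O_i}\to\Big(\bigoplus_{\mu\in\widehat H^{(i-1)}}V_{\mu}\otimes\mathbb C^{c^{\mu}_{\mu'\overline{\sigma_i}}}\Big)\oplus\mathcal K_{\mu'},\qquad \mu'\in\widehat H^{(i)},$$ where $\overline{\mathcal O_i}$ is $\mathcal O_i$ with the action $\overline{\sigma_i}$ and $\mathcal K_{\mu'}$ collects the irreducible representations outside $\widehat H^{(i-1)}$. Theorem. Such models and transforms exist. Fix any choice of them. Let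 $C$ be the Choi matrix of a quantum comb with $$\Big[C,\ \overline{\textstyle\bigotimes_{i}\rho_i(g)}\otimes\overline{\textstyle\bigotimes_{j}\sigma_j(h)}\Big]=0\qquad\text{for all }(g,h)\in G\times H,$$ equivalently $\Psi\big(\rho(g)X\rho(g)^\dagger\big)=\overline{\sigma}(h)\Psi(X)\overline{\sigma}(h)^\dagger$ for all $X$, $g$, $h$, where $\rho=\bigotimes_i\rho_i$ and $\sigma=\bigotimes_j\sigma_j$. Then there are finite-dimensional spaces $\mathcal M_0=\mathbb C,\mathcal M_1,\dots,\mathcal M_n$ and isometries $$V_i^{\lambda'\mu}:\ \mathcal M_{i-1}\otimes\bigoplus_{\lambda\in\widehat G^{(i-1)}}\mathbb C^{c^{\lambda'}_{\lambda\rho_i}}\ \to\ \Big(\bigoplus_{\mu'\in\widehat H^{(i)}}\mathbb C^{c^{\mu}_{\mu'\overline{\sigma_i}}}\Big)\otimes\mathcal M_i\qquad(1\le i\le n,\ \lambda'\in\widehat G^{(i)},\ \mu\in\widehat H^{(i-1)})$$ such that the following holds. Put $\mathcal A_i=\big(\bigoplus_{\mu\in\widehat H^{(i)}}V_\mu\big)\otimes\mathcal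 M_i\otimes\big(\bigoplus_{\lambda\in\widehat G^{(i)}}V_\lambda\big)$, so that $\mathcal A_0$ is one-dimensional, and let $W_i:\mathcal I_i\otimes\mathcal A_{i-1}\to\mathcal O_i\otimes\mathcal A_i$ be the composition of (1) $\mathrm{CG}_{\lambda,\rho_i}$ on $V_\lambda\otimes\mathcal I_i$, controlled by the label $\lambda$; (2) $V_i^{\lambda'\mu}$ on the memory, the label $\lambda$ and the multiplicity register, controlled by the labels $\lambda'$ and $\mu$; (3) $\mathrm{CG}_{\mu',\overline{\sigma_i}}^\dagger$ from $V_\mu$ and its multiplicity register to $V_{\mu'}\otimes\mathcal O_i$, controlled by the label $\mu'$. Then every $W_i$ is an isometry, and the sequential circuit $W_1,\dots,W_n$, started in the unique state of $\mathcal A_0$ and with $\mathcal A_n$ traced out at the end, has Choi matrix $C$. -/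

import Mathlib

open scoped Kronecker ComplexOrder

namespace SymComb

noncomputable section

/-! ### Quantum channels and quantum combs

A finite-dimensional Hilbert space with a fixed (computational) orthonormal basis is given by the
finite type indexing its basis, and operators on it are complex matrices.  The input systems
`I 0, I 1, …` and output systems `O 0, O 1, …` are sequences of which a comb with `n` steps uses
the first `n`; step `i` takes `I i` together with the memory `A i` to `O i` together with the
memory `A (i + 1)`. -/

/-- `Φ ⊗ id`, where the identity acts on operators of the reference system `r`. -/
def amplify {a b r : Type*} (Φ : Matrix a a ℂ → Matrix b b ℂ)
    (X : Matrix (a × r) (a × r) ℂ) : Matrix (b × r) (b × r) ℂ :=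
  Matrix.of fun p q => Φ (Matrix.of fun i j => X (i, p.2) (j, q.2)) p.1 q.1

/-- A quantum channel: a completely positive and trace preserving linear map. -/
structure IsChannel {a b : Type*} [Fintype a] [Fintype b]
    (Φ : Matrix a a ℂ →ₗ[ℂ] Matrix b b ℂ) : Prop where
  completelyPositive : ∀ (r : ℕ) (X : Matrix (a × Fin r) (a × Fin r) ℂ),
    X.PosSemidef → (amplify Φ X).PosSemidef
  tracePreserving : ∀ X : Matrix a a ℂ, (Φ X).trace = X.trace

/-- The map on operators given by the first `k` steps of a sequence of maps `Ψ i` from operators on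
`I i ⊗ A i` to operators on `O i ⊗ A (i + 1)`, when all the inputs `I 0 ⊗ ⋯ ⊗ I (k - 1)` and the
initial memory `A 0` are supplied: first the `k` first steps (tensored with the identity on the
next input), then step `k` (tensored with the identity on the earlier outputs). -/
def combMap {I O A : ℕ → Type*}
    (Ψ : ∀ i, Matrix (I i × A i) (I i × A i) ℂ →ₗ[ℂ]
      Matrix (O i × A (i + 1)) (O i × A (i + 1)) ℂ) :
    ∀ k : ℕ, Matrix ((∀ j : Fin k, I j) × A 0) ((∀ j : Fin k, I j) × A 0) ℂ →
      Matrix ((∀ j : Fin k, O j) × A k) ((∀ j : Fin k, O j) × A k) ℂ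
  | 0, X => X.submatrix (fun s => (fun j => j.elim0, s.2)) (fun s => (fun j => j.elim0, s.2))
  | k + 1, X =>
    let splitInput : ((∀ j : Fin k, I j) × A 0) × I k → (∀ j : Fin (k + 1), I j) × A 0 :=
      fun s => (Fin.snoc (α := fun j : Fin (k + 1) => I j) s.1.1 s.2, s.1.2)
    let Y : Matrix (((∀ j : Fin k, O j) × A k) × I k) (((∀ j : Fin k, O j) × A k) × I k) ℂ :=
      amplify (combMap Ψ k) (X.submatrix splitInput splitInput)
    let swap : (I k × A k) × (∀ j : Fin k, O j) → ((∀ j : Fin k, O j) × A k) × I k :=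
      fun s => ((s.2, s.1.2), s.1.1)
    let Z : Matrix ((O k × A (k + 1)) × (∀ j : Fin k, O j))
        ((O k × A (k + 1)) × (∀ j : Fin k, O j)) ℂ :=
      amplify (Ψ k) (Y.submatrix swap swap)
    let joinOutput : (∀ j : Fin (k + 1), O j) × A (k + 1) →
        (O k × A (k + 1)) × (∀ j : Fin k, O j) :=
      fun s => ((s.1 (Fin.last k), s.2), Fin.init (α := fun j : Fin (k + 1) => O j) s.1)
    Z.submatrix joinOutput joinOutput

/-- The Choi matrix `∑ |x⟩⟨x'| ⊗ Ψ(|x⟩⟨x'|)` of the `n`-step circuit with steps `Ψ i`, where the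
memory starts in the basis state `a₀` and the final memory `A n` is traced out. -/
def combChoi {I O A : ℕ → Type*} [∀ i, DecidableEq (I i)] [∀ i, Fintype (A i)]
    [∀ i, DecidableEq (A i)]
    (Ψ : ∀ i, Matrix (I i × A i) (I i × A i) ℂ →ₗ[ℂ]
      Matrix (O i × A (i + 1)) (O i × A (i + 1)) ℂ) (a₀ : A 0) (n : ℕ) :
    Matrix ((∀ j : Fin n, I j) × (∀ j : Fin n, O j))
      ((∀ j : Fin n, I j) × (∀ j : Fin n, O j)) ℂ :=
  Matrix.of fun p q =>
    ∑ c : A n, combMap Ψ n (Matrix.single (p.1, a₀) (q.1, a₀) 1) (p.2, c) (q.2, c)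

/-- `C` is the Choi matrix of a quantum comb with `n` steps: a sequence of `n` quantum channels with
finite-dimensional memories `A i = ℂ ^ r i`, the first and last of which are one-dimensional. -/
def IsQuantumComb {I O : ℕ → Type*} [∀ i, Fintype (I i)] [∀ i, DecidableEq (I i)]
    [∀ i, Fintype (O i)] (n : ℕ)
    (C : Matrix ((∀ j : Fin n, I j) × (∀ j : Fin n, O j))
      ((∀ j : Fin n, I j) × (∀ j : Fin n, O j)) ℂ) : Prop :=
  ∃ (r : ℕ → ℕ)
    (Ψ : ∀ i, Matrix (I i × Fin (r i)) (I i × Fin (r i)) ℂ →ₗ[ℂ]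
      Matrix (O i × Fin (r (i + 1))) (O i × Fin (r (i + 1))) ℂ)
    (a₀ : Fin (r 0)),
    r 0 = 1 ∧ r n = 1 ∧ (∀ i < n, IsChannel (Ψ i)) ∧
      C = combChoi (A := fun i => Fin (r i)) Ψ a₀ n

/-- The map `X ↦ W X W†`. -/
def conjMap {a b : Type*} [Fintype a] (W : Matrix b a ℂ) :
    Matrix a a ℂ →ₗ[ℂ] Matrix b b ℂ where
  toFun X := W * X * W.conjTranspose
  map_add' X Y := by rw [Matrix.mul_add, Matrix.add_mul]
  map_smul' c X := by simp

/-- `W` is an isometry, `W† W = 1`. -/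
def IsIsometry {a b : Type*} [Fintype b] [DecidableEq a] (W : Matrix b a ℂ) : Prop :=
  W.conjTranspose * W = 1

/-- `W` is unitary (source and target may be indexed differently). -/
def IsUnitary {a b : Type*} [Fintype a] [Fintype b] [DecidableEq a] [DecidableEq b]
    (W : Matrix b a ℂ) : Prop :=
  W.conjTranspose * W = 1 ∧ W * W.conjTranspose = 1

/-! ### Unitary representations and Clebsch–Gordan transforms -/

/-- The entrywise complex conjugate, in the computational basis. -/
def conjMat {a b : Type*} (M : Matrix a b ℂ) : Matrix a b ℂ := M.map star

/-- The matrices of a unitary representation. -/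
abbrev repMat {G X : Type*} [Group G] [Fintype X] [DecidableEq X]
    (π : G →* Matrix.unitaryGroup X ℂ) : G → Matrix X X ℂ :=
  fun g => (π g : Matrix X X ℂ)

/-- The matrix of `ρ 0 (g) ⊗ ⋯ ⊗ ρ (k - 1) (g)`. -/
def tensorRep {G : Type*} [Group G] {I : ℕ → Type*} [∀ i, Fintype (I i)]
    [∀ i, DecidableEq (I i)] (ρ : ∀ i, G →* Matrix.unitaryGroup (I i) ℂ) (k : ℕ) (g : G) :
    Matrix (∀ j : Fin k, I j) (∀ j : Fin k, I j) ℂ :=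
  Matrix.of fun x y => ∏ j : Fin k, repMat (ρ j) g (x j) (y j)

/-- A unitary matrix representation, as a representation on a complex vector space. -/
def toRepresentation {G X : Type*} [Group G] [Fintype X] [DecidableEq X]
    (π : G →* Matrix.unitaryGroup X ℂ) : Representation ℂ G (X → ℂ) where
  toFun g := Matrix.toLin' (π g : Matrix X X ℂ)
  map_one' := by simp [Module.End.one_eq_id]
  map_mul' g h := by simp [Matrix.toLin'_mul, Module.End.mul_eq_comp]

/-- `T` intertwines the matrix-valued functions `π` and `τ`. -/
def Intertwines {G X Y : Type*} [Fintype X] [Fintype Y] (T : Matrix Y X ℂ)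
    (π : G → Matrix X X ℂ) (τ : G → Matrix Y Y ℂ) : Prop :=
  ∀ g, T * π g = τ g * T

/-- The (irreducible) representation `π` occurs in `τ`: there is a nonzero intertwiner. -/
def OccursIn {G X Y : Type*} [Fintype X] [Fintype Y]
    (π : G → Matrix X X ℂ) (τ : G → Matrix Y Y ℂ) : Prop :=
  ∃ T : Matrix Y X ℂ, T ≠ 0 ∧ Intertwines T π τ

/-- For every level `i`, a choice of one irreducible unitary representation `rep i l` on
`ℂ ^ dim i l` out of each of the (finitely many) equivalence classes of irreducible representations
that occur in `ρ 0 ⊗ ⋯ ⊗ ρ (i - 1)`, the labels being `l : Fin (num i)`.  Level `0` belongs to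
the empty tensor product, i.e. to the trivial representation on `ℂ`. -/
structure Irreps {G : Type*} [Group G] {I : ℕ → Type*} [∀ i, Fintype (I i)]
    [∀ i, DecidableEq (I i)] (ρ : ∀ i, G →* Matrix.unitaryGroup (I i) ℂ) where
  num : ℕ → ℕ
  dim : ∀ i, Fin (num i) → ℕ
  rep : ∀ i (l : Fin (num i)), G →* Matrix.unitaryGroup (Fin (dim i l)) ℂ
  irreducible : ∀ i l, (toRepresentation (rep i l)).IsIrreducible
  inequivalent : ∀ i l l',
    Nonempty ((toRepresentation (rep i l)).Equiv (toRepresentation (rep i l'))) → l = l'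
  occurs : ∀ i l, OccursIn (repMat (rep i l)) (tensorRep ρ i)
  exhaustive : ∀ i (d : ℕ) (π : G →* Matrix.unitaryGroup (Fin d) ℂ),
    (toRepresentation π).IsIrreducible →
    OccursIn (repMat π) (tensorRep ρ i) →
    ∃ l, Nonempty ((toRepresentation π).Equiv (toRepresentation (rep i l)))

/-- Clebsch–Gordan transforms for `ρ`.  For each level `i` and each label `l` of level `i`, a
unitary intertwiner
`V_l ⊗ I i ≅ ⨁_{l'} V_{l'} ⊗ ℂ ^ mult i l l'`, where `l'` runs over the labels of level `i + 1`. -/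
structure CGTransforms {G : Type*} [Group G] {I : ℕ → Type*} [∀ i, Fintype (I i)]
    [∀ i, DecidableEq (I i)] {ρ : ∀ i, G →* Matrix.unitaryGroup (I i) ℂ} (L : Irreps ρ) where
  mult : ∀ i, Fin (L.num i) → Fin (L.num (i + 1)) → ℕ
  mat : ∀ i (l : Fin (L.num i)),
    Matrix (Σ l' : Fin (L.num (i + 1)), Fin (L.dim (i + 1) l') × Fin (mult i l l'))
      (Fin (L.dim i l) × I i) ℂ
  unitary : ∀ i l, IsUnitary (mat i l)
  intertwines : ∀ i l, Intertwines (mat i l)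
    (fun g => repMat (L.rep i l) g ⊗ₖ repMat (ρ i) g)
    (fun g => Matrix.blockDiagonal' fun l' =>
      repMat (L.rep (i + 1) l') g ⊗ₖ (1 : Matrix (Fin (mult i l l')) (Fin (mult i l l')) ℂ))

/-- Dual Clebsch–Gordan transforms for `σ`, i.e. Clebsch–Gordan transforms for the complex conjugate
representations of the `σ i`.  For each level `i` and each label `l'` of level `i + 1`, a unitary
intertwiner `V_{l'} ⊗ conj (O i) ≅ (⨁_l V_l ⊗ ℂ ^ mult i l l') ⊕ ℂ ^ rest i l'`, where `l` runs over
the labels of level `i`, and where the last summand carries a representation that collects all the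
irreducible representations which are not labels of level `i`. -/
structure DualCGTransforms {G : Type*} [Group G] {O : ℕ → Type*} [∀ i, Fintype (O i)]
    [∀ i, DecidableEq (O i)] {σ : ∀ i, G →* Matrix.unitaryGroup (O i) ℂ} (L : Irreps σ) where
  mult : ∀ i, Fin (L.num i) → Fin (L.num (i + 1)) → ℕ
  rest : ∀ i, Fin (L.num (i + 1)) → ℕ
  restRep : ∀ i l', G →* Matrix.unitaryGroup (Fin (rest i l')) ℂ
  rest_disjoint : ∀ i l' l,
    ¬ OccursIn (repMat (L.rep i l)) (repMat (restRep i l'))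
  mat : ∀ i (l' : Fin (L.num (i + 1))),
    Matrix ((Σ l : Fin (L.num i), Fin (L.dim i l) × Fin (mult i l l')) ⊕ Fin (rest i l'))
      (Fin (L.dim (i + 1) l') × O i) ℂ
  unitary : ∀ i l', IsUnitary (mat i l')
  intertwines : ∀ i l', Intertwines (mat i l')
    (fun g => repMat (L.rep (i + 1) l') g ⊗ₖ conjMat (repMat (σ i) g))
    (fun g => Matrix.fromBlocks
      (Matrix.blockDiagonal' fun l =>
        repMat (L.rep i l) g ⊗ₖ (1 : Matrix (Fin (mult i l l')) (Fin (mult i l l')) ℂ))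
      0 0 (repMat (restRep i l') g))

/-! ### The circuit -/

section Circuit

variable {G H : Type*} [Group G] [Group H] {I O : ℕ → Type*}
  [∀ i, Fintype (I i)] [∀ i, DecidableEq (I i)] [∀ i, Fintype (O i)] [∀ i, DecidableEq (O i)]
  {ρ : ∀ i, G →* Matrix.unitaryGroup (I i) ℂ} {σ : ∀ i, H →* Matrix.unitaryGroup (O i) ℂ}

/-- Basis of the memory `A i` between two steps: an irrep label `μ` of `H` with a basis vector
of `V_μ`, a basis vector of the additional memory `ℂ ^ m i`, and an irrep label `λ` of `G` with a
basis vector of `V_λ`. -/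
abbrev Mem (L : Irreps ρ) (K : Irreps σ) (m : ℕ → ℕ) (i : ℕ) : Type :=
  (Σ μ : Fin (K.num i), Fin (K.dim i μ)) × Fin (m i) × (Σ l : Fin (L.num i), Fin (L.dim i l))

/-- Families of operators `V i λ' μ`, for `λ'` a label of `G` at level `i + 1` and `μ` a label of
`H` at level `i`, from the registers
(additional memory `i`, label `λ` of `G` at level `i`, multiplicity of `λ'` in `λ ⊗ ρ i`) to the
registers
(multiplicity of `μ` in `μ' ⊗ conj (σ i)`, label `μ'` of `H` at level `i + 1`, additional memory
`i + 1`). -/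
abbrev MultOps {L : Irreps ρ} {K : Irreps σ} (T : CGTransforms L) (D : DualCGTransforms K)
    (m : ℕ → ℕ) : Type :=
  ∀ (i : ℕ) (l' : Fin (L.num (i + 1))) (μ : Fin (K.num i)),
    Matrix ((Σ μ' : Fin (K.num (i + 1)), Fin (D.mult i μ μ')) × Fin (m (i + 1)))
      (Fin (m i) × (Σ l : Fin (L.num i), Fin (T.mult i l l'))) ℂ

/-- The operator `W i` from `I i ⊗ A i` to `O i ⊗ A (i + 1)`: the Clebsch–Gordan transform for `ρ i`
on `V_λ ⊗ I i`, controlled by the label `λ`; then `V i λ' μ`, controlled by the labels `λ'`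
and `μ`; then the adjoint of the dual Clebsch–Gordan transform for `σ i`, controlled by the label
`μ'`. -/
def stepOp {L : Irreps ρ} {K : Irreps σ} (T : CGTransforms L) (D : DualCGTransforms K)
    {m : ℕ → ℕ} (V : MultOps T D m) (i : ℕ) :
    Matrix (O i × Mem L K m (i + 1)) (I i × Mem L K m i) ℂ :=
  Matrix.of fun
    | (o, ⟨μ', v'⟩, t', ⟨l', k'⟩), (x, ⟨μ, v⟩, t, ⟨l, k⟩) =>
      ∑ a : Fin (T.mult i l l'), ∑ b : Fin (D.mult i μ μ'),
        (D.mat i μ').conjTranspose (v', o) (Sum.inl ⟨μ, v, b⟩) *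
          V i l' μ (⟨μ', b⟩, t') (t, ⟨l, a⟩) *
          T.mat i l ⟨l', k', a⟩ (k, x)

/-- `C` is the Choi matrix of the sequential circuit `W 0, …, W (n - 1)` with the final memory
traced out, for some additional memories and some isometries `V i λ' μ`. -/
def IsRealizable {L : Irreps ρ} {K : Irreps σ} (T : CGTransforms L) (D : DualCGTransforms K)
    (n : ℕ) (C : Matrix ((∀ j : Fin n, I j) × (∀ j : Fin n, O j))
      ((∀ j : Fin n, I j) × (∀ j : Fin n, O j)) ℂ) : Prop :=
  ∃ (m : ℕ → ℕ) (V : MultOps T D m) (a₀ : Mem L K m 0),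
    m 0 = 1 ∧ (∀ a : Mem L K m 0, a = a₀) ∧
    (∀ i < n, ∀ l' μ, IsIsometry (V i l' μ)) ∧
    (∀ i < n, IsIsometry (stepOp T D V i)) ∧
    C = combChoi (A := Mem L K m) (fun i => conjMap (stepOp T D V i)) a₀ n

end Circuit

end

end SymComb

/-! Conjugating the Choi matrices of the first k steps of the comb gives positive matrices M_0 = 1,
..., M_n with Tr_{O_k} M_{k+1} = M_k ⊗ 1. The symmetry is assumed for the last one only, but partial
traces pass it down, so every M_k commutes with the representation of G × H on the first k inputs
and outputs (`IsQuantumComb.exists_equivariant_sequence`). On the circuit side, if R_{k+1} arises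
from R_k by applying W_k to the memory and the next input, then the Choi matrix is the conjugate of
R_n† R_n (`combChoi_conjMap`). So it suffices to find R_k from I^k ⊗ O^k to the memory A_k with R_k†
R_k = M_k, linked by steps W_k of the prescribed form.

The square root of M_k commutes with the group; followed by an equivariant isometry into the memory
it gives an equivariant R_k (`exists_equivariant_purification`). To link R_k with R_{k+1}, compare
two operators on I^k ⊗ O^k ⊗ I_k: R_k ⊗ 1 followed by the CG transform, and R_{k+1} with O_k bent
from its source to its target, followed by the dual CG transform. Bending conjugates σ_k, which is
why the dual transform decomposes the conjugate representation. Both operators are families of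
intertwiners into the irreducible representations V_λ' ⊗ V_μ, and both have Gram matrix M_k ⊗ 1. The
summand K_μ' is never reached, since the first k outputs contain only irreducibles that are labels
of level k (`one_kronecker_dualRest_mul_outputSlice`).

By Schur's lemma two such families differ, for each (λ', μ), by an isometry of the multiplicity
spaces, provided that the second space is at least as large as the first
(`exists_multiplicity_isometries`). These isometries are the V^{λ'μ}, and undoing the dual transform
yields R_{k+1} = W_k R_k (`exists_step`). The dimension condition is met by enlarging the memory,
once each μ is known to have nonzero multiplicity for some μ' (`DualCGTransforms.exists_mult_pos`).

Existence of models and transforms rests on orthonormal bases of intertwiner spaces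
(`exists_orthonormal_intertwiners`, `exists_decomposition`) and on a maximal family of inequivalent
irreducibles (`exists_irreps`). -/

namespace SymComb
open Matrix Module

/-! ### Algebra of intertwining matrices. -/

section Intertwiners

variable {G X Y Z : Type*} [Fintype X] [Fintype Y] [Fintype Z]

/-- The matrices `π g` satisfy `π(g)† = π(g⁻¹)`, as those of a unitary representation do. -/
def IsStarRep [Group G] (π : G → Matrix X X ℂ) : Prop := ∀ g, (π g)ᴴ = π g⁻¹

/-- A multiplicative family of matrices with `p(g)† = p(g⁻¹)`, as a unitary representation. -/
def IsStarRep.toHom [Group G] [DecidableEq X] {p : G → Matrix X X ℂ} (hs : IsStarRep p)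
    (h1 : p 1 = 1) (hm : ∀ g h, p (g * h) = p g * p h) : G →* Matrix.unitaryGroup X ℂ where
  toFun g := ⟨p g, by
    rw [Matrix.mem_unitaryGroup_iff, star_eq_conjTranspose, hs, ← hm, mul_inv_cancel, h1]⟩
  map_one' := Subtype.ext h1
  map_mul' g h := Subtype.ext (hm g h)

theorem isStarRep_repMat [Group G] [DecidableEq X] (π : G →* Matrix.unitaryGroup X ℂ) :
    IsStarRep (repMat π) := by
  intro g
  simp only [repMat, map_inv]
  rfl

theorem repMat_mul [Group G] [DecidableEq X] (π : G →* Matrix.unitaryGroup X ℂ) (g h : G) :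
    repMat π (g * h) = repMat π g * repMat π h := by
  simp [repMat]

theorem repMat_one [Group G] [DecidableEq X] (π : G →* Matrix.unitaryGroup X ℂ) :
    repMat π 1 = 1 := by
  simp [repMat]

theorem repMat_mul_conjTranspose [Group G] [DecidableEq X] (π : G →* Matrix.unitaryGroup X ℂ) (g : G) :
    repMat π g * (repMat π g)ᴴ = 1 := by
  rw [isStarRep_repMat, ← repMat_mul, mul_inv_cancel, repMat_one]

theorem repMat_conjTranspose_mul [Group G] [DecidableEq X] (π : G →* Matrix.unitaryGroup X ℂ) (g : G) :
    (repMat π g)ᴴ * repMat π g = 1 := by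
  rw [isStarRep_repMat, ← repMat_mul, inv_mul_cancel, repMat_one]

variable {π : G → Matrix X X ℂ} {τ : G → Matrix Y Y ℂ} {υ : G → Matrix Z Z ℂ}

theorem Intertwines.conjTranspose [Group G] {T : Matrix Y X ℂ} (h : Intertwines T π τ)
    (hπ : IsStarRep π) (hτ : IsStarRep τ) : Intertwines Tᴴ τ π := by
  intro g
  have := congrArg Matrix.conjTranspose (h g⁻¹)
  rw [conjTranspose_mul, conjTranspose_mul, hπ, hτ, inv_inv] at this
  exact this.symm

theorem Intertwines.mul {S : Matrix Z Y ℂ} {T : Matrix Y X ℂ} (hS : Intertwines S τ υ)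
    (hT : Intertwines T π τ) : Intertwines (S * T) π υ := by
  intro g
  rw [Matrix.mul_assoc, hT g, ← Matrix.mul_assoc, hS g, Matrix.mul_assoc]

theorem Intertwines.smul {T : Matrix Y X ℂ} (hT : Intertwines T π τ) (c : ℂ) :
    Intertwines (c • T) π τ := by
  intro g
  rw [Matrix.smul_mul, Matrix.mul_smul, hT g]

theorem Intertwines.sub {S T : Matrix Y X ℂ} (hS : Intertwines S π τ) (hT : Intertwines T π τ) :
    Intertwines (S - T) π τ := by
  intro g
  rw [Matrix.sub_mul, Matrix.mul_sub, hT g, hS g]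

theorem Intertwines.sum {J : Type*} (s : Finset J) {T : J → Matrix Y X ℂ}
    (hT : ∀ j, Intertwines (T j) π τ) : Intertwines (∑ j ∈ s, T j) π τ := by
  intro g
  rw [Matrix.sum_mul, Matrix.mul_sum]
  exact Finset.sum_congr rfl fun j _ => hT j g

end Intertwiners

/-! ### Invariant subspaces as unitary subrepresentations. -/

section Subrepresentations

variable {G X : Type*} [Group G] [Fintype X]

/-- The columns of S are an orthonormal basis of W for the ℓ² inner product, so S S† is the
orthogonal projection onto W. -/
theorem exists_isometry_onto (W : Submodule ℂ (X → ℂ)) :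
    ∃ S : Matrix X (Fin (finrank ℂ W)) ℂ, Sᴴ * S = 1 ∧ (∀ v, S *ᵥ v ∈ W) ∧
      ∀ w ∈ W, S *ᵥ (Sᴴ *ᵥ w) = w := by
  set e := (WithLp.linearEquiv 2 ℂ (X → ℂ)).symm
  set W' : Submodule ℂ (EuclideanSpace ℂ X) := W.map e.toLinearMap with hW'
  have hd : finrank ℂ W' = finrank ℂ W := LinearEquiv.finrank_map_eq e W
  let b : OrthonormalBasis (Fin (finrank ℂ W)) ℂ W' :=
    (stdOrthonormalBasis ℂ W').reindex (finCongr hd)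
  have hbW : ∀ j, (fun x => (b j : EuclideanSpace ℂ X) x) ∈ W := by
    intro j
    obtain ⟨w, hw, hwe⟩ := (b j).2
    have : (fun x => (b j : EuclideanSpace ℂ X) x) = w := by
      funext x
      rw [← hwe]
      rfl
    rwa [this]
  refine ⟨Matrix.of fun x j => (b j : EuclideanSpace ℂ X) x, ?_, ?_, ?_⟩
  · ext i j
    have := orthonormal_iff_ite.1 b.orthonormal i j
    rw [Submodule.coe_inner, PiLp.inner_apply] at this
    simp only [RCLike.inner_apply] at this
    rw [Matrix.one_apply, ← this, Matrix.mul_apply]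
    exact Finset.sum_congr rfl fun x _ => by simp [mul_comm]
  · intro v
    have : (Matrix.of fun x j => (b j : EuclideanSpace ℂ X) x) *ᵥ v =
        ∑ j, v j • fun x => (b j : EuclideanSpace ℂ X) x := by
      funext x
      simp [Matrix.mulVec, dotProduct, mul_comm]
    rw [this]
    exact W.sum_mem fun j _ => W.smul_mem _ (hbW j)
  · intro w hw
    have h1 := b.sum_repr' ⟨e w, w, hw, rfl⟩
    have h2 := congrArg (fun z : W' => (z : EuclideanSpace ℂ X)) h1
    funext x
    have h3 := congrArg (fun z : EuclideanSpace ℂ X => z x) h2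
    simp only [Submodule.coe_sum, Submodule.coe_smul, Submodule.coe_inner, PiLp.inner_apply,
      RCLike.inner_apply, WithLp.ofLp_sum, Finset.sum_apply, WithLp.ofLp_smul, Pi.smul_apply,
      smul_eq_mul] at h3
    change _ = w x at h3
    rw [← h3]
    simp only [Matrix.mulVec, dotProduct, Matrix.of_apply, Matrix.conjTranspose_apply]
    refine Finset.sum_congr rfl fun j _ => ?_
    rw [mul_comm]
    congr 1
    refine Finset.sum_congr rfl fun y _ => ?_
    rw [mul_comm]
    rfl

variable [DecidableEq X]

theorem exists_subrep (τ : G →* Matrix.unitaryGroup X ℂ) (W : Submodule ℂ (X → ℂ))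
    (inv : ∀ g, ∀ w ∈ W, repMat τ g *ᵥ w ∈ W) :
    ∃ (π : G →* Matrix.unitaryGroup (Fin (finrank ℂ W)) ℂ)
      (S : Matrix X (Fin (finrank ℂ W)) ℂ), Sᴴ * S = 1 ∧ Intertwines S (repMat π) (repMat τ) ∧
      (∀ v, S *ᵥ v ∈ W) ∧ ∀ w ∈ W, S *ᵥ (Sᴴ *ᵥ w) = w := by
  obtain ⟨S, hS, hSW, hWS⟩ := exists_isometry_onto W
  -- S S† fixes W, and τ(g) maps the range of S into W. This makes the compression S† τ(g) S
  -- multiplicative.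
  have key : ∀ g, S * (Sᴴ * (repMat τ g * S)) = repMat τ g * S := by
    intro g
    apply Matrix.ext_of_mulVec_single
    intro j
    have := hWS _ (inv g _ (hSW (Pi.single j 1)))
    simpa only [Matrix.mulVec_mulVec, Matrix.mul_assoc] using this
  let p : G → Matrix (Fin (finrank ℂ W)) (Fin (finrank ℂ W)) ℂ := fun g => Sᴴ * (repMat τ g * S)
  have p_one : p 1 = 1 := by simp only [p]; rw [repMat_one, Matrix.one_mul, hS]
  have p_mul : ∀ g h, p (g * h) = p g * p h := by
    intro g h
    simp only [p]
    rw [Matrix.mul_assoc Sᴴ, Matrix.mul_assoc (repMat τ g), key, repMat_mul, Matrix.mul_assoc]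
  have p_star : IsStarRep p := by
    intro g
    simp only [p]
    rw [conjTranspose_mul, conjTranspose_mul, conjTranspose_conjTranspose, isStarRep_repMat,
      Matrix.mul_assoc]
  exact ⟨IsStarRep.toHom p_star p_one p_mul, S, hS, fun g => key g, hSW, hWS⟩

theorem nonempty_of_isIrreducible {π : G →* Matrix.unitaryGroup X ℂ}
    (h : (toRepresentation π).IsIrreducible) : Nonempty X := by
  by_contra hX
  rw [not_nonempty_iff] at hX
  have : (⊥ : Subrepresentation (toRepresentation π)) = ⊤ :=
    Subrepresentation.toSubmodule_injective (Subsingleton.elim _ _)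
  exact bot_ne_top this

/-- Every nonzero unitary representation contains an irreducible one. -/
theorem exists_irreducible_subrep [Nonempty X] (τ : G →* Matrix.unitaryGroup X ℂ) :
    ∃ (d : ℕ) (π : G →* Matrix.unitaryGroup (Fin d) ℂ) (S : Matrix X (Fin d) ℂ),
      (toRepresentation π).IsIrreducible ∧ Sᴴ * S = 1 ∧
      Intertwines S (repMat π) (repMat τ) := by
  classical
  -- A nonzero subrepresentation of least dimension is irreducible: a nonzero invariant subspace of
  -- it is again a candidate, hence has full dimension.
  let P : ℕ → Prop := fun d => 0 < d ∧ ∃ (π : G →* Matrix.unitaryGroup (Fin d) ℂ)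
    (S : Matrix X (Fin d) ℂ), Sᴴ * S = 1 ∧ Intertwines S (repMat π) (repMat τ)
  have hP : ∃ d, P d := by
    obtain ⟨π, S, hS, hi, -⟩ := exists_subrep τ ⊤ (by simp)
    exact ⟨_, by rw [finrank_top]; simp [Fintype.card_pos], π, S, hS, hi⟩
  obtain ⟨hpos, π, S, hS, hi⟩ := Nat.find_spec hP
  refine ⟨_, π, S, ?_, hS, hi⟩
  have : Nonempty (Fin (Nat.find hP)) := ⟨⟨0, hpos⟩⟩
  have nt : Nontrivial (Subrepresentation (toRepresentation π)) :=
    ⟨⊥, ⊤, fun h => bot_ne_top (congrArg Subrepresentation.toSubmodule h)⟩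
  refine { eq_bot_or_eq_top := fun W => ?_ }
  by_cases hW : W.toSubmodule = ⊥
  · exact Or.inl (Subrepresentation.toSubmodule_injective hW)
  right
  apply Subrepresentation.toSubmodule_injective
  obtain ⟨π', S', hS', hi', -⟩ := exists_subrep π W.toSubmodule
    (fun g w hw => by simpa [toRepresentation] using W.apply_mem_toSubmodule g hw)
  have hle : Nat.find hP ≤ finrank ℂ W.toSubmodule := by
    refine Nat.find_min' hP ⟨?_, π', S * S', ?_, hi.mul hi'⟩
    · exact Nat.pos_of_ne_zero fun h => hW (Submodule.finrank_eq_zero.1 h)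
    · rw [conjTranspose_mul, Matrix.mul_assoc, ← Matrix.mul_assoc Sᴴ, hS, Matrix.one_mul, hS']
  exact Submodule.eq_top_of_finrank_eq (le_antisymm (Submodule.finrank_le _) (by simpa using hle))

end Subrepresentations

/-! ### Schur's lemma for unitary matrix representations. -/

section Schur

variable {G X Y : Type*} [Group G] [Fintype X] [DecidableEq X] [Fintype Y] [DecidableEq Y]
  {π : G →* Matrix.unitaryGroup X ℂ} {τ : G →* Matrix.unitaryGroup Y ℂ}

/-- An intertwining matrix, as an intertwining map. -/
def Intertwines.toIntertwiningMap {T : Matrix Y X ℂ} (hT : Intertwines T (repMat π) (repMat τ)) :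
    (toRepresentation π).IntertwiningMap (toRepresentation τ) where
  toLinearMap := Matrix.toLin' T
  isIntertwining' g := by
    change Matrix.toLin' T ∘ₗ Matrix.toLin' (repMat π g) = Matrix.toLin' (repMat τ g) ∘ₗ _
    rw [← Matrix.toLin'_mul, ← Matrix.toLin'_mul, hT g]

theorem Intertwines.exists_eq_smul_one (hπ : (toRepresentation π).IsIrreducible) {T : Matrix X X ℂ}
    (hT : Intertwines T (repMat π) (repMat π)) : ∃ c : ℂ, T = c • 1 := by
  obtain ⟨c, hc⟩ :=
    (Representation.IsIrreducible.algebraMap_intertwiningMap_bijective_of_isAlgClosed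
      (ρ := toRepresentation π)).2 hT.toIntertwiningMap
  refine ⟨c, Matrix.toLin'.injective ?_⟩
  have := congrArg (fun f => f.toLinearMap) hc
  change _ = Matrix.toLin' T at this
  rw [← this]
  ext
  simp [Algebra.algebraMap_eq_smul_one]

theorem Intertwines.nonempty_equiv (hπ : (toRepresentation π).IsIrreducible)
    (hτ : (toRepresentation τ).IsIrreducible) {T : Matrix Y X ℂ}
    (hT : Intertwines T (repMat π) (repMat τ)) (h0 : T ≠ 0) :
    Nonempty ((toRepresentation π).Equiv (toRepresentation τ)) := by
  rcases Representation.IsIrreducible.bijective_or_eq_zero hT.toIntertwiningMap with h | h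
  · exact ⟨hT.toIntertwiningMap.ofBijective h⟩
  · refine absurd (Matrix.toLin'.injective ?_) h0
    have := congrArg (fun f => f.toLinearMap) h
    rw [map_zero]
    exact this

theorem exists_intertwiner_of_equiv [Nonempty X]
    (e : (toRepresentation π).Equiv (toRepresentation τ)) :
    ∃ T : Matrix Y X ℂ, Function.Injective T.mulVec ∧ T ≠ 0 ∧
      Intertwines T (repMat π) (repMat τ) := by
  let T := LinearMap.toMatrix' (e.toIntertwiningMap.toLinearMap)
  have hTe : ∀ v, T *ᵥ v = e v := fun v => by simp [T, LinearMap.toMatrix'_mulVec]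
  have hinj : Function.Injective T.mulVec := by
    intro v w h
    rw [hTe, hTe] at h
    exact e.toLinearEquiv.injective h
  refine ⟨T, hinj, ?_, fun g => ?_⟩
  · intro h
    have : (fun _ => 1 : X → ℂ) = 0 := hinj (by rw [h]; simp)
    exact one_ne_zero (congrFun this (Classical.arbitrary X))
  · apply Matrix.toLin'.injective
    rw [Matrix.toLin'_mul, Matrix.toLin'_mul]
    simpa [T, toRepresentation] using e.toIntertwiningMap.isIntertwining' g

end Schur

/-! ### Components of intertwiners into block decompositions. -/

section Slices

variable {G X ι : Type*} [Fintype ι] [DecidableEq ι] {dim mult : ι → ℕ}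

theorem mul_blockDiagonal'_kronecker_one_apply
    (V : Matrix X (Σ l, Fin (dim l) × Fin (mult l)) ℂ)
    (A : ∀ l, Matrix (Fin (dim l)) (Fin (dim l)) ℂ) (x : X) (l : ι) (k : Fin (dim l))
    (j : Fin (mult l)) :
    (V * Matrix.blockDiagonal' fun l => A l ⊗ₖ (1 : Matrix (Fin (mult l)) (Fin (mult l)) ℂ))
      x ⟨l, k, j⟩ = ∑ k', V x ⟨l, k', j⟩ * A l k' k := by
  rw [Matrix.mul_apply, Fintype.sum_sigma, Finset.sum_eq_single l]
  · rw [Fintype.sum_prod_type]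
    refine Finset.sum_congr rfl fun k' _ => ?_
    rw [Finset.sum_eq_single j]
    · simp [Matrix.blockDiagonal'_apply, Matrix.kroneckerMap_apply]
    · intro j' _ hj
      simp [Matrix.blockDiagonal'_apply, Matrix.kroneckerMap_apply, hj]
    · simp
  · intro l' _ hl
    refine Finset.sum_eq_zero fun p _ => ?_
    simp [Matrix.blockDiagonal'_apply, hl]
  · simp

theorem blockDiagonal'_kronecker_one_mul_apply
    (V : Matrix (Σ l, Fin (dim l) × Fin (mult l)) X ℂ)
    (A : ∀ l, Matrix (Fin (dim l)) (Fin (dim l)) ℂ) (x : X) (l : ι) (k : Fin (dim l))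
    (j : Fin (mult l)) :
    ((Matrix.blockDiagonal' fun l => A l ⊗ₖ (1 : Matrix (Fin (mult l)) (Fin (mult l)) ℂ)) * V)
      ⟨l, k, j⟩ x = ∑ k', A l k k' * V ⟨l, k', j⟩ x := by
  rw [Matrix.mul_apply, Fintype.sum_sigma, Finset.sum_eq_single l]
  · rw [Fintype.sum_prod_type]
    refine Finset.sum_congr rfl fun k' _ => ?_
    rw [Finset.sum_eq_single j]
    · simp [Matrix.blockDiagonal'_apply, Matrix.kroneckerMap_apply]
    · intro j' _ hj
      simp [Matrix.blockDiagonal'_apply, Matrix.kroneckerMap_apply, hj.symm]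
    · simp
  · intro l' _ hl
    refine Finset.sum_eq_zero fun p _ => ?_
    simp [Matrix.blockDiagonal'_apply, hl.symm]
  · simp

variable [Fintype X] {τ : G → Matrix X X ℂ} {A : ∀ l, G → Matrix (Fin (dim l)) (Fin (dim l)) ℂ}

/-- The group acts trivially on the multiplicity register, so freezing the label and the
multiplicity index leaves a map into a single copy of the irreducible representation. -/
theorem Intertwines.slice {U : Matrix (Σ l, Fin (dim l) × Fin (mult l)) X ℂ}
    (hU : Intertwines U τ (fun g => Matrix.blockDiagonal' fun l =>
      A l g ⊗ₖ (1 : Matrix (Fin (mult l)) (Fin (mult l)) ℂ))) (l : ι) (j : Fin (mult l)) :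
    Intertwines (Matrix.of fun k x => U ⟨l, k, j⟩ x) τ (A l) := by
  intro g
  ext k x
  have := congrFun (congrFun (hU g) ⟨l, k, j⟩) x
  rw [blockDiagonal'_kronecker_one_mul_apply] at this
  exact this

theorem Intertwines.slice_inl {r : ℕ} {rest : G → Matrix (Fin r) (Fin r) ℂ}
    {U : Matrix ((Σ l, Fin (dim l) × Fin (mult l)) ⊕ Fin r) X ℂ}
    (hU : Intertwines U τ (fun g => Matrix.fromBlocks (Matrix.blockDiagonal' fun l =>
      A l g ⊗ₖ (1 : Matrix (Fin (mult l)) (Fin (mult l)) ℂ)) 0 0 (rest g)))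
    (l : ι) (j : Fin (mult l)) :
    Intertwines (Matrix.of fun k x => U (Sum.inl ⟨l, k, j⟩) x) τ (A l) := by
  refine Intertwines.slice (U := Matrix.of fun p x => U (Sum.inl p) x) (fun g => ?_) l j
  ext p x
  have := congrFun (congrFun (hU g) (Sum.inl p)) x
  simp only [Matrix.mul_apply, Fintype.sum_sum_type, Matrix.fromBlocks_apply₁₁,
    Matrix.fromBlocks_apply₁₂, Matrix.zero_apply, zero_mul, Finset.sum_const_zero, add_zero] at this
  rw [Matrix.mul_apply, Matrix.mul_apply]
  exact this

theorem Intertwines.slice_inr {r : ℕ} {rest : G → Matrix (Fin r) (Fin r) ℂ}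
    {U : Matrix ((Σ l, Fin (dim l) × Fin (mult l)) ⊕ Fin r) X ℂ}
    (hU : Intertwines U τ (fun g => Matrix.fromBlocks (Matrix.blockDiagonal' fun l =>
      A l g ⊗ₖ (1 : Matrix (Fin (mult l)) (Fin (mult l)) ℂ)) 0 0 (rest g))) :
    Intertwines (Matrix.of fun k x => U (Sum.inr k) x) τ rest := by
  intro g
  ext p x
  have := congrFun (congrFun (hU g) (Sum.inr p)) x
  simp only [Matrix.mul_apply, Fintype.sum_sum_type, Matrix.fromBlocks_apply₂₁,
    Matrix.fromBlocks_apply₂₂, Matrix.zero_apply, zero_mul, Finset.sum_const_zero, zero_add] at this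
  rw [Matrix.mul_apply, Matrix.mul_apply]
  exact this

end Slices

/-! ### Isotypic decomposition of unitary representations. -/

section Decomposition

variable {G X : Type*} [Group G] [Fintype X] [DecidableEq X]

/-- The intertwiners from an irreducible representation have a basis of isometries with mutually
orthogonal ranges. -/
theorem exists_orthonormal_intertwiners {d : ℕ} {π : G →* Matrix.unitaryGroup (Fin d) ℂ}
    (hπ : (toRepresentation π).IsIrreducible) (τ : G →* Matrix.unitaryGroup X ℂ) :
    ∃ (N : ℕ) (f : Fin N → Matrix X (Fin d) ℂ),
      (∀ j, Intertwines (f j) (repMat π) (repMat τ)) ∧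
      (∀ i j, (f i)ᴴ * f j = if i = j then 1 else 0) ∧
      ∀ T : Matrix X (Fin d) ℂ, Intertwines T (repMat π) (repMat τ) →
        ∃ c : Fin N → ℂ, T = ∑ j, c j • f j := by
  -- Intertwiners are read as vectors, so that orthonormality in `exists_isometry_onto` is
  -- orthonormality for the Hilbert–Schmidt inner product.
  let W : Submodule ℂ (X × Fin d → ℂ) :=
    { carrier := {w | Intertwines (Matrix.of fun x k => w (x, k)) (repMat π) (repMat τ)}
      add_mem' := by
        intro v w hv hw g
        have := congrArg₂ (· + ·) (hv g) (hw g)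
        simp only [← Matrix.add_mul, ← Matrix.mul_add] at this
        exact this
      zero_mem' := fun g => by
        have : (Matrix.of fun x k => (0 : X × Fin d → ℂ) (x, k)) = (0 : Matrix X (Fin d) ℂ) := rfl
        rw [this, Matrix.zero_mul, Matrix.mul_zero]
      smul_mem' := fun c w hw => Intertwines.smul hw c }
  obtain ⟨S, hS, hSW, hWS⟩ := exists_isometry_onto W
  have hd : (d : ℂ) ≠ 0 := by
    obtain ⟨k⟩ := nonempty_of_isIrreducible hπ
    exact Nat.cast_ne_zero.2 (Nat.ne_of_gt (Nat.lt_of_le_of_lt (Nat.zero_le _) k.2))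
  have hsq : ((Real.sqrt d : ℝ) : ℂ) * (Real.sqrt d : ℝ) = d := by
    rw [← Complex.ofReal_mul, Real.mul_self_sqrt (Nat.cast_nonneg d), Complex.ofReal_natCast]
  have hs0 : ((Real.sqrt d : ℝ) : ℂ) ≠ 0 := fun h => hd (by rw [← hsq, h, zero_mul])
  -- By Schur's lemma f_i† f_j is scalar, and its trace is d times that scalar; the factor √d turns
  -- trace-orthonormality into f_i† f_j = δ_ij.
  let f : Fin (finrank ℂ W) → Matrix X (Fin d) ℂ := fun j =>
    ((Real.sqrt d : ℝ) : ℂ) • Matrix.of fun x k => S (x, k) j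
  have hf : ∀ j, Intertwines (f j) (repMat π) (repMat τ) := by
    intro j
    refine Intertwines.smul ?_ _
    have := hSW (Pi.single j 1)
    rw [Matrix.mulVec_single_one] at this
    exact this
  refine ⟨_, f, hf, fun i j => ?_, fun T hT => ?_⟩
  · obtain ⟨c, hc⟩ := (((hf i).conjTranspose (isStarRep_repMat π) (isStarRep_repMat τ)).mul
      (hf j)).exists_eq_smul_one hπ
    have ht := congrArg Matrix.trace hc
    have hij := congrFun (congrFun hS i) j
    have hl : ((f i)ᴴ * f j).trace = d * (Sᴴ * S) i j := by
      simp only [f, conjTranspose_smul, Matrix.smul_mul, Matrix.mul_smul, Matrix.trace_smul,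
        smul_eq_mul, RCLike.star_def, Complex.conj_ofReal]
      rw [← mul_assoc, hsq, Matrix.trace, Matrix.mul_apply, Fintype.sum_prod_type,
        Finset.sum_comm]
      rfl
    rw [hl, hij, Matrix.trace_smul, Matrix.trace_one, Fintype.card_fin, smul_eq_mul,
      mul_comm] at ht
    have hc' := mul_right_cancel₀ hd ht
    rw [hc, ← hc', Matrix.one_apply]
    split_ifs <;> simp
  · have := hWS (fun p => T p.1 p.2) hT
    refine ⟨fun j => ((Real.sqrt d : ℝ) : ℂ)⁻¹ * (Sᴴ *ᵥ fun p => T p.1 p.2) j, ?_⟩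
    ext x k
    have h2 := congrFun this (x, k)
    rw [← h2, Matrix.sum_apply]
    simp only [Matrix.mulVec, dotProduct, f, Matrix.smul_apply, Matrix.of_apply, smul_eq_mul]
    refine Finset.sum_congr rfl fun j _ => ?_
    field_simp

variable {ι : Type*} [Fintype ι] [DecidableEq ι] {dim : ι → ℕ}

/-- Decomposition of a unitary representation into multiples of given inequivalent irreducible
representations and a representation in which none of these occurs. -/
theorem exists_decomposition (rep : ∀ l : ι, G →* Matrix.unitaryGroup (Fin (dim l)) ℂ)
    (irr : ∀ l, (toRepresentation (rep l)).IsIrreducible)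
    (ineq : ∀ l l', Nonempty ((toRepresentation (rep l)).Equiv (toRepresentation (rep l'))) →
      l = l') (τ : G →* Matrix.unitaryGroup X ℂ) :
    ∃ (mult : ι → ℕ) (r : ℕ) (rest : G →* Matrix.unitaryGroup (Fin r) ℂ)
      (U : Matrix ((Σ l, Fin (dim l) × Fin (mult l)) ⊕ Fin r) X ℂ),
      IsUnitary U ∧
      Intertwines U (repMat τ) (fun g => Matrix.fromBlocks (Matrix.blockDiagonal' fun l =>
        repMat (rep l) g ⊗ₖ (1 : Matrix (Fin (mult l)) (Fin (mult l)) ℂ)) 0 0 (repMat rest g)) ∧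
      ∀ l, ¬ OccursIn (repMat (rep l)) (repMat rest) := by
  choose mult f hf horth hspan using fun l => exists_orthonormal_intertwiners (irr l) τ
  have hf' : ∀ l j, Intertwines (f l j)ᴴ (repMat τ) (repMat (rep l)) := fun l j =>
    (hf l j).conjTranspose (isStarRep_repMat _) (isStarRep_repMat _)
  have hcross : ∀ l l' i j, l ≠ l' → (f l i)ᴴ * f l' j = 0 := by
    intro l l' i j hne
    by_contra h0
    exact hne (ineq l' l (((hf' l i).mul (hf l' j)).nonempty_equiv (irr l') (irr l) h0)).symm
  -- The common kernel of all f†, that is, the orthogonal complement of every copy of the given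
  -- irreducibles. It carries the remaining representation.
  let W : Submodule ℂ (X → ℂ) :=
    { carrier := {w | ∀ l j, (f l j)ᴴ *ᵥ w = 0}
      add_mem' := fun hv hw l j => by rw [Matrix.mulVec_add, hv l j, hw l j, add_zero]
      zero_mem' := fun l j => Matrix.mulVec_zero _
      smul_mem' := fun c w hw l j => by rw [Matrix.mulVec_smul, hw l j, smul_zero] }
  obtain ⟨rest, S, hS, hSi, hSW, hWS⟩ := exists_subrep τ W (fun g w hw l j => by
    rw [Matrix.mulVec_mulVec, hf' l j g, ← Matrix.mulVec_mulVec, hw l j, Matrix.mulVec_zero])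
  have hfS : ∀ l j, (f l j)ᴴ * S = 0 := by
    intro l j
    apply Matrix.ext_of_mulVec_single
    intro k
    rw [← Matrix.mulVec_mulVec, hSW _ l j, Matrix.zero_mulVec]
  have hSf : ∀ l j, Sᴴ * f l j = 0 := by
    intro l j
    have := congrArg Matrix.conjTranspose (hfS l j)
    rwa [conjTranspose_mul, conjTranspose_conjTranspose, conjTranspose_zero] at this
  have hfQ : ∀ l j, (f l j)ᴴ * (∑ l', ∑ i, f l' i * (f l' i)ᴴ) = (f l j)ᴴ := by
    intro l j
    rw [Matrix.mul_sum, Finset.sum_eq_single l, Matrix.mul_sum, Finset.sum_eq_single j]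
    · rw [← Matrix.mul_assoc, horth, if_pos rfl, Matrix.one_mul]
    · intro i _ hi
      rw [← Matrix.mul_assoc, horth, if_neg hi.symm, Matrix.zero_mul]
    · simp
    · intro l' _ hl
      rw [Matrix.mul_sum]
      refine Finset.sum_eq_zero fun i _ => ?_
      rw [← Matrix.mul_assoc, hcross _ _ _ _ hl.symm, Matrix.zero_mul]
    · simp
  have hSS : S * Sᴴ = 1 - ∑ l, ∑ i, f l i * (f l i)ᴴ := by
    have h1 : S * (Sᴴ * (1 - ∑ l, ∑ i, f l i * (f l i)ᴴ)) = 1 - ∑ l, ∑ i, f l i * (f l i)ᴴ := by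
      apply Matrix.ext_of_mulVec_single
      intro x
      rw [← Matrix.mulVec_mulVec, ← Matrix.mulVec_mulVec]
      refine hWS _ fun l j => ?_
      rw [Matrix.mulVec_mulVec, Matrix.mul_sub, Matrix.mul_one, hfQ, sub_self, Matrix.zero_mulVec]
    have h2 : Sᴴ * (∑ l, ∑ i, f l i * (f l i)ᴴ) = 0 := by
      rw [Matrix.mul_sum]
      refine Finset.sum_eq_zero fun l _ => ?_
      rw [Matrix.mul_sum]
      refine Finset.sum_eq_zero fun i _ => ?_
      rw [← Matrix.mul_assoc, hSf, Matrix.zero_mul]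
    rw [← h1, Matrix.mul_sub, h2, sub_zero, Matrix.mul_one]
  let V₁ : Matrix X (Σ l, Fin (dim l) × Fin (mult l)) ℂ := Matrix.of fun x p => f p.1 p.2.2 x p.2.1
  let V : Matrix X ((Σ l, Fin (dim l) × Fin (mult l)) ⊕ Fin (finrank ℂ W)) ℂ :=
    Matrix.fromCols V₁ S
  have hVV : Vᴴ * V = 1 := by
    rw [Matrix.conjTranspose_fromCols_eq_fromRows_conjTranspose, Matrix.fromRows_mul_fromCols,
      ← Matrix.fromBlocks_one]
    congr 1
    · ext ⟨l, k, j⟩ ⟨l', k', j'⟩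
      change ((f l j)ᴴ * f l' j') k k' = _
      by_cases hl : l = l'
      · subst hl
        rw [horth, Matrix.one_apply]
        by_cases hj : j = j' <;> by_cases hk : k = k' <;> simp [hj, hk, Matrix.one_apply]
      · rw [hcross _ _ _ _ hl, Matrix.one_apply_ne (by simp [hl])]
        rfl
    · ext ⟨l, k, j⟩ i
      exact congrFun (congrFun (hfS l j) k) i
    · ext i ⟨l, k, j⟩
      exact congrFun (congrFun (hSf l j) i) k
  have hVV' : V * Vᴴ = 1 := by
    rw [Matrix.conjTranspose_fromCols_eq_fromRows_conjTranspose, Matrix.fromCols_mul_fromRows, hSS]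
    have : V₁ * V₁ᴴ = ∑ l, ∑ i, f l i * (f l i)ᴴ := by
      ext x y
      rw [Matrix.mul_apply, Fintype.sum_sigma, Matrix.sum_apply]
      refine Finset.sum_congr rfl fun l _ => ?_
      rw [Matrix.sum_apply, Fintype.sum_prod_type, Finset.sum_comm]
      rfl
    rw [this]
    abel
  have hV : Intertwines V (fun g => Matrix.fromBlocks (Matrix.blockDiagonal' fun l =>
      repMat (rep l) g ⊗ₖ (1 : Matrix (Fin (mult l)) (Fin (mult l)) ℂ)) 0 0 (repMat rest g))
      (repMat τ) := by
    intro g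
    rw [Matrix.fromCols_mul_fromBlocks, Matrix.mul_fromCols, Matrix.mul_zero, Matrix.mul_zero,
      add_zero, zero_add, hSi g]
    congr 1
    ext x ⟨l, k, j⟩
    rw [mul_blockDiagonal'_kronecker_one_apply]
    exact congrFun (congrFun (hf l j g) x) k
  refine ⟨mult, _, rest, Vᴴ, ⟨by rwa [conjTranspose_conjTranspose],
    by rwa [conjTranspose_conjTranspose]⟩, hV.conjTranspose (fun g => ?_) (isStarRep_repMat _),
    fun l => ?_⟩
  · rw [Matrix.fromBlocks_conjTranspose, Matrix.blockDiagonal'_conjTranspose,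
      conjTranspose_zero, conjTranspose_zero, isStarRep_repMat]
    simp only [conjTranspose_kronecker, conjTranspose_one, isStarRep_repMat (rep _) g]
  -- An intertwiner T into the remainder becomes S T, which lies in the span of the f's. Their
  -- ranges are orthogonal to that of S, so T = S† S T = 0.
  · rintro ⟨T, hT0, hT⟩
    apply hT0
    obtain ⟨c, hc⟩ := hspan l (S * T) (hSi.mul hT)
    rw [← Matrix.one_mul T, ← hS, Matrix.mul_assoc, hc, Matrix.mul_sum]
    refine Finset.sum_eq_zero fun j _ => ?_
    rw [Matrix.mul_smul, hSf, smul_zero]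

/-- Precompose with the inverse equivalence; its matrix is surjective by equality of dimensions, so
the composite stays nonzero. -/
theorem OccursIn.of_equiv {d : ℕ} [Nonempty X] {π : G →* Matrix.unitaryGroup X ℂ}
    {π' : G →* Matrix.unitaryGroup (Fin d) ℂ} {Y : Type*} [Fintype Y]
    {τ : G → Matrix Y Y ℂ} (h : OccursIn (repMat π) τ)
    (e : Nonempty ((toRepresentation π).Equiv (toRepresentation π'))) :
    OccursIn (repMat π') τ := by
  obtain ⟨T, hT0, hT⟩ := h
  obtain ⟨e⟩ := e
  have : Nonempty (Fin d) := by
    by_contra hd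
    rw [not_nonempty_iff] at hd
    have : (fun _ => 1 : X → ℂ) = 0 := e.toLinearEquiv.injective (Subsingleton.elim _ _)
    exact one_ne_zero (congrFun this (Classical.arbitrary X))
  obtain ⟨S, hSinj, -, hS⟩ := exists_intertwiner_of_equiv e.symm
  obtain ⟨R, hRinj, -, hR⟩ := exists_intertwiner_of_equiv e
  refine ⟨T * S, fun h0 => hT0 ?_, hT.mul hS⟩
  have hsurj : Function.Surjective S.mulVec := by
    have hdim := e.toLinearEquiv.finrank_eq
    exact (LinearMap.injective_iff_surjective_of_finrank_eq_finrank
      (f := Matrix.mulVecLin S) hdim.symm).1 hSinj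
  apply Matrix.ext_of_mulVec_single
  intro x
  obtain ⟨v, hv⟩ := hsurj (Pi.single x 1)
  rw [← hv, Matrix.mulVec_mulVec, h0, Matrix.zero_mulVec, Matrix.zero_mulVec]

/-- If the remainder were nonzero it would contain an irreducible subrepresentation. That one occurs
in τ, so it is equivalent to a listed one, which cannot occur in the remainder. -/
theorem exists_full_decomposition (rep : ∀ l : ι, G →* Matrix.unitaryGroup (Fin (dim l)) ℂ)
    (irr : ∀ l, (toRepresentation (rep l)).IsIrreducible)
    (ineq : ∀ l l', Nonempty ((toRepresentation (rep l)).Equiv (toRepresentation (rep l'))) →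
      l = l') (τ : G →* Matrix.unitaryGroup X ℂ)
    (exh : ∀ (d : ℕ) (π : G →* Matrix.unitaryGroup (Fin d) ℂ),
      (toRepresentation π).IsIrreducible → OccursIn (repMat π) (repMat τ) →
      ∃ l, Nonempty ((toRepresentation π).Equiv (toRepresentation (rep l)))) :
    ∃ (mult : ι → ℕ) (U : Matrix (Σ l, Fin (dim l) × Fin (mult l)) X ℂ),
      IsUnitary U ∧
      Intertwines U (repMat τ) (fun g => Matrix.blockDiagonal' fun l =>
        repMat (rep l) g ⊗ₖ (1 : Matrix (Fin (mult l)) (Fin (mult l)) ℂ)) := by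
  obtain ⟨mult, r, rest, U, ⟨hU1, hU2⟩, hU, hrest⟩ := exists_decomposition rep irr ineq τ
  have hr : IsEmpty (Fin r) := by
    by_contra hr
    rw [not_isEmpty_iff] at hr
    obtain ⟨d, π, S, hπ, hS, hSi⟩ := exists_irreducible_subrep rest
    have := nonempty_of_isIrreducible hπ
    have hS0 : S ≠ 0 := by
      rintro rfl
      rw [Matrix.mul_zero] at hS
      exact zero_ne_one hS
    let R : Matrix (Fin r) X ℂ := Matrix.of fun k x => U (Sum.inr k) x
    have hR : Intertwines R (repMat τ) (repMat rest) := hU.slice_inr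
    have hRR : R * Rᴴ = 1 := by
      ext i j
      have := congrFun (congrFun hU2 (Sum.inr i)) (Sum.inr j)
      rw [Matrix.one_apply] at this ⊢
      simp only [Sum.inr.injEq] at this
      exact this
    have hocc : OccursIn (repMat π) (repMat τ) := by
      refine ⟨Rᴴ * S, fun h0 => hS0 ?_,
        (hR.conjTranspose (isStarRep_repMat _) (isStarRep_repMat _)).mul hSi⟩
      rw [← Matrix.one_mul S, ← hRR, Matrix.mul_assoc, h0, Matrix.mul_zero]
    obtain ⟨l, hl⟩ := exh d π hπ hocc
    exact hrest l (OccursIn.of_equiv ⟨S, hS0, hSi⟩ hl)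
  refine ⟨mult, Matrix.of fun p x => U (Sum.inl p) x, ⟨?_, ?_⟩, fun g => ?_⟩
  · ext x y
    have := congrFun (congrFun hU1 x) y
    rw [Matrix.mul_apply, Fintype.sum_sum_type, Finset.univ_eq_empty (α := Fin r),
      Finset.sum_empty, add_zero] at this
    exact this
  · ext p q
    have := congrFun (congrFun hU2 (Sum.inl p)) (Sum.inl q)
    rw [Matrix.one_apply] at this ⊢
    simp only [Sum.inl.injEq] at this
    exact this
  · ext p x
    have := congrFun (congrFun (hU g) (Sum.inl p)) x
    rw [Matrix.mul_apply, Matrix.mul_apply, Fintype.sum_sum_type, Finset.univ_eq_empty (α := Fin r),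
      Finset.sum_empty, add_zero] at this
    exact this

end Decomposition

/-! ### Bending, tensor products, conjugates, and finiteness of the set of labels. -/

section Constructions

variable {G X Y : Type*} [Fintype X] [Fintype Y]

theorem Intertwines.submatrix {X' Y' : Type*} [Fintype X'] [Fintype Y']
    {π : G → Matrix X X ℂ} {τ : G → Matrix Y Y ℂ} {T : Matrix Y X ℂ} (h : Intertwines T π τ)
    (e : Y' ≃ Y) (f : X' ≃ X) :
    Intertwines (T.submatrix e f) (fun g => (π g).submatrix f f)
      (fun g => (τ g).submatrix e e) := by
  intro g
  rw [Matrix.submatrix_mul_equiv, Matrix.submatrix_mul_equiv, h g]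

theorem Intertwines.kronecker {X' Y' : Type*} [Fintype X'] [Fintype Y']
    {π : G → Matrix X X ℂ} {τ : G → Matrix Y Y ℂ} {T : Matrix Y X ℂ}
    {π' : G → Matrix X' X' ℂ} {τ' : G → Matrix Y' Y' ℂ} {T' : Matrix Y' X' ℂ}
    (h : Intertwines T π τ) (h' : Intertwines T' π' τ') :
    Intertwines (T ⊗ₖ T') (fun g => π g ⊗ₖ π' g) (fun g => τ g ⊗ₖ τ' g) := by
  intro g
  rw [← Matrix.mul_kronecker_mul, ← Matrix.mul_kronecker_mul, h g, h' g]

theorem Intertwines.one [DecidableEq X] (π : G → Matrix X X ℂ) :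
    Intertwines (1 : Matrix X X ℂ) π π := by
  intro g
  rw [Matrix.one_mul, Matrix.mul_one]

/-- Turn an input system of an operator into an output system. -/
def bend {a e o : Type*} (M : Matrix a (e × o) ℂ) : Matrix (a × o) e ℂ :=
  Matrix.of fun p x => M p.1 (x, p.2)

/-- Moving S(g) to the other side of the intertwining relation gives S(g)†, and reading the same
index as an output transposes it. Hence the conjugate representation. -/
theorem Intertwines.bend {a e o : Type*} [Fintype a] [Fintype e] [Fintype o] [DecidableEq e]
    [DecidableEq o] {M : Matrix a (e × o) ℂ} {A : G → Matrix e e ℂ} {S : G → Matrix o o ℂ}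
    {B : G → Matrix a a ℂ} (h : Intertwines M (fun g => A g ⊗ₖ S g) B)
    (hS : ∀ g, S g * (S g)ᴴ = 1) :
    Intertwines (bend M) A (fun g => B g ⊗ₖ conjMat (S g)) := by
  intro g
  have h1 : M * (A g ⊗ₖ (1 : Matrix o o ℂ)) =
      B g * M * ((1 : Matrix e e ℂ) ⊗ₖ (S g)ᴴ) := by
    rw [← h g, Matrix.mul_assoc, ← Matrix.mul_kronecker_mul, hS, Matrix.mul_one]
  ext ⟨x, y⟩ z
  have h2 := congrFun (congrFun h1 x) (z, y)
  rw [Matrix.mul_apply, Fintype.sum_prod_type] at h2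
  simp only [Matrix.kroneckerMap_apply, Matrix.one_apply, mul_ite, mul_one, mul_zero,
    Finset.sum_ite_eq', Finset.mem_univ, if_true] at h2
  rw [Matrix.mul_apply]
  change _ = _ at h2
  simp only [SymComb.bend, Matrix.of_apply]
  rw [h2, Matrix.mul_apply, Matrix.mul_apply, Fintype.sum_prod_type, Fintype.sum_prod_type,
    Finset.sum_eq_single z]
  · simp only [Matrix.mul_apply, Matrix.kroneckerMap_apply, Matrix.one_apply, if_true, one_mul,
      Matrix.of_apply, Finset.sum_mul, conjMat, Matrix.map_apply, Matrix.conjTranspose_apply]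
    rw [Finset.sum_comm]
    exact Finset.sum_congr rfl fun _ _ => Finset.sum_congr rfl fun _ _ => by ring
  · intro w _ hw
    exact Finset.sum_eq_zero fun v _ => by simp [Matrix.kroneckerMap_apply, hw]
  · simp

theorem bend_eq_zero {a e o : Type*} {M : Matrix a (e × o) ℂ} (h : bend M = 0) : M = 0 := by
  ext x ⟨y, z⟩
  exact congrFun (congrFun h (x, z)) y

variable [Group G]

/-- T† T commutes with an irreducible representation, so it is scalar, and it vanishes only if T
does. Thus T is an isometry up to scale. -/
theorem Intertwines.exists_conjTranspose_mul_self {d : ℕ}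
    {π : G →* Matrix.unitaryGroup (Fin d) ℂ} {τ : G → Matrix X X ℂ} (hτ : IsStarRep τ)
    (hπ : (toRepresentation π).IsIrreducible) {T : Matrix X (Fin d) ℂ} (hT0 : T ≠ 0)
    (hT : Intertwines T (repMat π) τ) : ∃ c : ℂ, c ≠ 0 ∧ Tᴴ * T = c • 1 := by
  obtain ⟨c, hc⟩ := ((hT.conjTranspose (isStarRep_repMat _) hτ).mul hT).exists_eq_smul_one hπ
  refine ⟨c, fun h0 => hT0 ?_, hc⟩
  rw [h0, zero_smul] at hc
  exact Matrix.conjTranspose_mul_self_eq_zero.1 hc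

/-- Intertwiners from inequivalent irreducibles have orthogonal ranges by Schur's lemma; one nonzero
column from each gives linearly independent vectors. -/
theorem card_le_of_inequivalent {n : ℕ} {dim : Fin n → ℕ}
    {rep : ∀ l, G →* Matrix.unitaryGroup (Fin (dim l)) ℂ}
    (irr : ∀ l, (toRepresentation (rep l)).IsIrreducible)
    (ineq : ∀ l l', Nonempty ((toRepresentation (rep l)).Equiv (toRepresentation (rep l'))) →
      l = l') {τ : G → Matrix X X ℂ} (hτ : IsStarRep τ)
    (occ : ∀ l, OccursIn (repMat (rep l)) τ) : n ≤ Fintype.card X := by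
  choose T hT0 hT using occ
  have hcol : ∀ l, ∃ k, T l *ᵥ Pi.single k 1 ≠ 0 := by
    intro l
    by_contra! h
    exact hT0 l (Matrix.ext_of_mulVec_single fun k => by rw [h k, Matrix.zero_mulVec])
  choose k hk using hcol
  let v : Fin n → EuclideanSpace ℂ X := fun l => WithLp.toLp 2 (T l *ᵥ Pi.single (k l) 1)
  have hv : LinearIndependent ℂ v := by
    apply linearIndependent_of_ne_zero_of_inner_eq_zero
    · intro l h
      exact hk l (congrArg WithLp.ofLp h)
    · intro l l' hne
      have h0 : (T l)ᴴ * T l' = 0 := by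
        by_contra h0
        exact hne (ineq l' l ((((hT l).conjTranspose (isStarRep_repMat _) hτ).mul
          (hT l')).nonempty_equiv (irr l') (irr l) h0)).symm
      rw [EuclideanSpace.inner_eq_star_dotProduct]
      have h1 := congrFun (congrFun h0 (k l)) (k l')
      rw [Matrix.mul_apply] at h1
      simp only [v, Matrix.mulVec_single_one, dotProduct, Pi.star_apply, Matrix.col_apply]
      rw [← h1.trans (Matrix.zero_apply _ _)]
      exact Finset.sum_congr rfl fun x _ => mul_comm _ _
  simpa using hv.fintype_card_le_finrank

variable [DecidableEq X] [DecidableEq Y]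

/-- The tensor product of two unitary representations. -/
def kroneckerHom (π : G →* Matrix.unitaryGroup X ℂ) (τ : G →* Matrix.unitaryGroup Y ℂ) :
    G →* Matrix.unitaryGroup (X × Y) ℂ :=
  IsStarRep.toHom (p := fun g => repMat π g ⊗ₖ repMat τ g)
    (fun g => by rw [Matrix.conjTranspose_kronecker, isStarRep_repMat, isStarRep_repMat])
    (by simp only [repMat_one, Matrix.one_kronecker_one])
    (fun g h => by simp only [repMat_mul, Matrix.mul_kronecker_mul])

/-- The entrywise complex conjugate of a unitary representation. -/
def conjHom (π : G →* Matrix.unitaryGroup X ℂ) : G →* Matrix.unitaryGroup X ℂ :=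
  IsStarRep.toHom (p := fun g => conjMat (repMat π g))
    (fun g => by
      change _ = conjMat (repMat π g⁻¹)
      rw [← isStarRep_repMat]
      rfl)
    (by
      rw [repMat_one]
      ext i j
      by_cases h : i = j <;> simp [conjMat, Matrix.one_apply, h])
    (fun g h => by
      rw [repMat_mul]
      ext i j
      simp [conjMat, Matrix.mul_apply])

variable {I : ℕ → Type*} [∀ i, Fintype (I i)] [∀ i, DecidableEq (I i)]

theorem tensorRep_one (ρ : ∀ i, G →* Matrix.unitaryGroup (I i) ℂ) (k : ℕ) :
    tensorRep ρ k 1 = 1 := by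
  ext x y
  simp only [tensorRep, repMat_one, Matrix.of_apply, Matrix.one_apply]
  rw [Finset.prod_ite_zero]
  simp [funext_iff]

theorem tensorRep_mul (ρ : ∀ i, G →* Matrix.unitaryGroup (I i) ℂ) (k : ℕ) (g h : G) :
    tensorRep ρ k (g * h) = tensorRep ρ k g * tensorRep ρ k h := by
  ext x y
  simp only [tensorRep, repMat_mul, Matrix.of_apply, Matrix.mul_apply]
  rw [Finset.prod_univ_sum, Fintype.piFinset_univ]
  exact Finset.sum_congr rfl fun z _ => Finset.prod_mul_distrib

theorem isStarRep_tensorRep (ρ : ∀ i, G →* Matrix.unitaryGroup (I i) ℂ) (k : ℕ) :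
    IsStarRep (tensorRep ρ k) := by
  intro g
  ext x y
  simp only [tensorRep, Matrix.of_apply, Matrix.conjTranspose_apply, star_prod]
  exact Finset.prod_congr rfl fun j _ =>
    congrFun (congrFun (isStarRep_repMat (ρ j) g) (x j)) (y j)

/-- The representation `ρ 0 ⊗ ⋯ ⊗ ρ (k - 1)`. -/
def tensorHom (ρ : ∀ i, G →* Matrix.unitaryGroup (I i) ℂ) (k : ℕ) :
    G →* Matrix.unitaryGroup (∀ j : Fin k, I j) ℂ :=
  IsStarRep.toHom (isStarRep_tensorRep ρ k) (tensorRep_one ρ k) (tensorRep_mul ρ k)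

/-- Append a last entry to a tuple. -/
def snocEquiv (I : ℕ → Type*) (k : ℕ) : (∀ j : Fin k, I j) × I k ≃ ∀ j : Fin (k + 1), I j where
  toFun p := Fin.snoc (α := fun j : Fin (k + 1) => I j) p.1 p.2
  invFun f := (Fin.init (α := fun j : Fin (k + 1) => I j) f, f (Fin.last k))
  left_inv p := by simp
  right_inv f := by simp

theorem tensorRep_succ (ρ : ∀ i, G →* Matrix.unitaryGroup (I i) ℂ) (k : ℕ) (g : G) :
    (tensorRep ρ (k + 1) g).submatrix (snocEquiv I k) (snocEquiv I k) =
      tensorRep ρ k g ⊗ₖ repMat (ρ k) g := by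
  ext ⟨x, a⟩ ⟨y, b⟩
  simp only [tensorRep, Matrix.submatrix_apply, Matrix.of_apply, Matrix.kroneckerMap_apply,
    snocEquiv, Equiv.coe_fn_mk]
  rw [Fin.prod_univ_castSucc]
  simp

/-- A choice of one representation out of each class of irreducible representations occurring in a
unitary representation. -/
theorem exists_irreps (τ : G →* Matrix.unitaryGroup X ℂ) :
    ∃ (n : ℕ) (F : Fin n → Σ d : ℕ, G →* Matrix.unitaryGroup (Fin d) ℂ),
      (∀ l, (toRepresentation (F l).2).IsIrreducible) ∧
      (∀ l l', Nonempty ((toRepresentation (F l).2).Equiv (toRepresentation (F l').2)) → l = l') ∧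
      (∀ l, OccursIn (repMat (F l).2) (repMat τ)) ∧
      ∀ (d : ℕ) (π : G →* Matrix.unitaryGroup (Fin d) ℂ), (toRepresentation π).IsIrreducible →
        OccursIn (repMat π) (repMat τ) →
        ∃ l, Nonempty ((toRepresentation π).Equiv (toRepresentation (F l).2)) := by
  classical
  -- A largest inequivalent family is exhaustive, since a missing representation could be added to
  -- it. The bound by the dimension makes a largest one exist.
  let P : ℕ → Prop := fun n => ∃ F : Fin n → Σ d : ℕ, G →* Matrix.unitaryGroup (Fin d) ℂ,
      (∀ l, (toRepresentation (F l).2).IsIrreducible) ∧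
      (∀ l l', Nonempty ((toRepresentation (F l).2).Equiv (toRepresentation (F l').2)) → l = l') ∧
      (∀ l, OccursIn (repMat (F l).2) (repMat τ))
  have hb : ∀ n, P n → n ≤ Fintype.card X := fun n ⟨F, h1, h2, h3⟩ =>
    card_le_of_inequivalent h1 h2 (isStarRep_repMat τ) h3
  have h0 : P 0 := ⟨fun l => l.elim0, fun l => l.elim0, fun l => l.elim0, fun l => l.elim0⟩
  obtain ⟨F, h1, h2, h3⟩ := Nat.findGreatest_spec (P := P) (Nat.zero_le (Fintype.card X)) h0
  refine ⟨_, F, h1, h2, h3, fun d π hπ hocc => ?_⟩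
  by_contra! hne
  have hs : P (Nat.findGreatest P (Fintype.card X) + 1) := by
    refine ⟨Fin.cons ⟨d, π⟩ F, Fin.cases hπ h1, ?_, Fin.cases hocc h3⟩
    refine Fin.cases (Fin.cases (fun _ => rfl) fun l' h => ?_)
      (fun l => Fin.cases (fun h => ?_) fun l' h => ?_)
    · exact ((hne l').false h.some).elim
    · exact ((hne l).false h.some.symm).elim
    · exact congrArg Fin.succ (h2 l l' h)
  exact absurd (Nat.le_findGreatest (hb _ hs) hs) (by omega)

end Constructions

/-! ### Existence of labels and transforms, and nonvanishing of dual multiplicities. -/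

section Transforms

variable {G : Type*} [Group G] {I : ℕ → Type*} [∀ i, Fintype (I i)] [∀ i, DecidableEq (I i)]
  {ρ : ∀ i, G →* Matrix.unitaryGroup (I i) ℂ}

theorem nonempty_irreps (ρ : ∀ i, G →* Matrix.unitaryGroup (I i) ℂ) : Nonempty (Irreps ρ) := by
  choose n F h1 h2 h3 h4 using fun i => exists_irreps (tensorHom ρ i)
  exact ⟨⟨n, fun i l => (F i l).1, fun i l => (F i l).2, h1, h2, h3, h4⟩⟩

variable (L : Irreps ρ)

theorem Irreps.exists_full_decomposition (i : ℕ) :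
    ∃ (mult : Fin (L.num i) → ℕ)
      (U : Matrix (Σ l, Fin (L.dim i l) × Fin (mult l)) (∀ j : Fin i, I j) ℂ),
      IsUnitary U ∧ Intertwines U (tensorRep ρ i) (fun g => Matrix.blockDiagonal' fun l =>
        repMat (L.rep i l) g ⊗ₖ (1 : Matrix (Fin (mult l)) (Fin (mult l)) ℂ)) :=
  SymComb.exists_full_decomposition (L.rep i) (L.irreducible i) (L.inequivalent i) (tensorHom ρ i)
    (L.exhaustive i)

theorem Irreps.nonempty_dim (i : ℕ) (l : Fin (L.num i)) : Nonempty (Fin (L.dim i l)) :=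
  nonempty_of_isIrreducible (L.irreducible i l)

/-- For a label `l` of level `i`, an embedding of `V_l ⊗ I i` into `I 0 ⊗ ⋯ ⊗ I i`. -/
theorem Irreps.exists_embedding (i : ℕ) (l : Fin (L.num i)) :
    ∃ (T : Matrix (∀ j : Fin (i + 1), I j) (Fin (L.dim i l) × I i) ℂ) (c : ℂ), c ≠ 0 ∧
      Tᴴ * T = c • 1 ∧ Intertwines T (fun g => repMat (L.rep i l) g ⊗ₖ repMat (ρ i) g)
        (tensorRep ρ (i + 1)) := by
  obtain ⟨T, hT0, hT⟩ := L.occurs i l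
  obtain ⟨c, hc0, hc⟩ :=
    hT.exists_conjTranspose_mul_self (isStarRep_tensorRep ρ i) (L.irreducible i l) hT0
  refine ⟨(T ⊗ₖ (1 : Matrix (I i) (I i) ℂ)).submatrix (snocEquiv I i).symm (Equiv.refl _), c, hc0,
    ?_, ?_⟩
  · rw [Matrix.conjTranspose_submatrix, Matrix.submatrix_mul_equiv, Matrix.conjTranspose_kronecker,
      ← Matrix.mul_kronecker_mul, hc, conjTranspose_one, Matrix.one_mul, Matrix.smul_kronecker,
      Matrix.one_kronecker_one]
    rfl
  · have := (hT.kronecker (Intertwines.one (repMat (ρ i)))).submatrix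
      (snocEquiv I i).symm (Equiv.refl _)
    simp only [← tensorRep_succ, Matrix.submatrix_submatrix, Equiv.self_comp_symm] at this
    exact this

/-- V_l ⊗ I_i embeds equivariantly into the first i + 1 inputs, so each irreducible in it is a label
of level i + 1 and no remainder is left. -/
theorem nonempty_cgTransforms : Nonempty (CGTransforms L) := by
  choose mult U hU hUi using fun i (l : Fin (L.num i)) =>
    SymComb.exists_full_decomposition (L.rep (i + 1)) (L.irreducible (i + 1))
      (L.inequivalent (i + 1)) (kroneckerHom (L.rep i l) (ρ i)) (by
        rintro d π hπ ⟨S, hS0, hS⟩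
        refine L.exhaustive (i + 1) d π hπ ?_
        obtain ⟨T, c, hc0, hc, hT⟩ := L.exists_embedding i l
        refine ⟨T * S, fun h0 => hS0 ?_, hT.mul hS⟩
        have h1 : (Tᴴ * T) * S = 0 := by rw [Matrix.mul_assoc, h0, Matrix.mul_zero]
        rw [hc, Matrix.smul_mul, Matrix.one_mul] at h1
        exact (smul_eq_zero.1 h1).resolve_left hc0)
  exact ⟨⟨mult, U, hU, hUi⟩⟩

/-- Here irreducibles outside the labels of level i may occur, so the decomposition with a remainder
is the right one. -/
theorem nonempty_dualCGTransforms : Nonempty (DualCGTransforms L) := by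
  choose mult r rest U hU hUi hrest using fun i (l' : Fin (L.num (i + 1))) =>
    exists_decomposition (L.rep i) (L.irreducible i) (L.inequivalent i)
      (kroneckerHom (L.rep (i + 1) l') (conjHom (ρ i)))
  exact ⟨⟨fun i l l' => mult i l' l, r, rest, hrest, U, hU, hUi⟩⟩

theorem card_eq_of_isUnitary {a b : Type*} [Fintype a] [Fintype b] [DecidableEq a] [DecidableEq b]
    {U : Matrix b a ℂ} (hU : IsUnitary U) : Fintype.card b = Fintype.card a := by
  have h := Matrix.trace_mul_comm U Uᴴ
  rw [hU.1, hU.2, Matrix.trace_one, Matrix.trace_one] at h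
  exact_mod_cast h

/-- There is only one label at level `0`, and it belongs to a one-dimensional representation. -/
theorem Irreps.exists_unique_level_zero :
    ∃ a : Σ l : Fin (L.num 0), Fin (L.dim 0 l), ∀ b, b = a := by
  obtain ⟨mult, U, hU, hUi⟩ := L.exists_full_decomposition 0
  -- Every label really occurs, so each basis vector of each V_l contributes to the decomposition of
  -- a one-dimensional space; only one such vector can exist.
  have hpos : ∀ l, 0 < mult l := by
    intro l
    by_contra hl
    obtain ⟨T, hT0, hT⟩ := L.occurs 0 l
    apply hT0
    have h0 : U * T = 0 := by
      ext ⟨l', k, j⟩ x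
      by_cases hll : l' = l
      · subst hll
        exact absurd (Nat.lt_of_le_of_lt (Nat.zero_le _) j.2) hl
      · have h1 := (hUi.slice l' j).mul hT
        by_contra hne
        refine hll (L.inequivalent 0 l l' (h1.nonempty_equiv (L.irreducible 0 l)
          (L.irreducible 0 l') fun h => hne ?_)).symm
        exact congrFun (congrFun h k) x
    rw [← Matrix.one_mul T, ← hU.1, Matrix.mul_assoc, h0, Matrix.mul_zero]
  have hcard := card_eq_of_isUnitary hU
  rw [Fintype.card_unique (α := ∀ j : Fin 0, I j), Fintype.card_eq_one_iff] at hcard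
  obtain ⟨⟨l, k, j⟩, hx⟩ := hcard
  refine ⟨⟨l, k⟩, fun ⟨l', k'⟩ => ?_⟩
  have := hx ⟨l', k', ⟨0, hpos l'⟩⟩
  cases this
  rfl

/-- Suppose all these multiplicities vanish. A component V_l ⊗ I_i → V_l' of an embedding into the
first i + 1 factors bends to an intertwiner V_l → V_l' ⊗ conj I_i. Its parts in other labels vanish
by Schur's lemma, its part in the remainder by disjointness, and V_l itself is absent. So the
embedding of a nonzero space is zero. -/
theorem DualCGTransforms.exists_mult_pos {L : Irreps ρ} (D : DualCGTransforms L) (i : ℕ)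
    [Nonempty (I i)] (l : Fin (L.num i)) : ∃ l', 0 < D.mult i l l' := by
  by_contra! hD
  obtain ⟨T, c, hc0, hc, hT⟩ := L.exists_embedding i l
  obtain ⟨mult, U, hU, hUi⟩ := L.exists_full_decomposition (i + 1)
  have := L.nonempty_dim i l
  have hUT : U * T = 0 := by
    ext ⟨l', k, j⟩ x
    suffices h : (Matrix.of fun k x => U ⟨l', k, j⟩ x) * T = 0 from
      congrFun (congrFun h k) x
    have h1 := (hUi.slice l' j).mul hT
    refine bend_eq_zero ?_
    have h2 := h1.bend (repMat_mul_conjTranspose (ρ i))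
    have h3 := (D.intertwines i l').mul h2
    have h4 : D.mat i l' * bend ((Matrix.of fun k x => U ⟨l', k, j⟩ x) * T) = 0 := by
      ext (⟨m, k, j⟩ | k) x
      · by_cases hml : m = l
        · subst hml
          exact absurd (Nat.lt_of_lt_of_le j.2 (hD l')) (Nat.not_lt_zero _)
        · by_contra hne
          refine hml (L.inequivalent i l m ((h3.slice_inl m j).nonempty_equiv (L.irreducible i l)
            (L.irreducible i m) fun h => hne ?_)).symm
          exact congrFun (congrFun h k) x
      · by_contra hne
        refine D.rest_disjoint i l' l ⟨_, fun h => hne ?_, h3.slice_inr⟩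
        exact congrFun (congrFun h k) x
    rw [← Matrix.one_mul (bend _), ← (D.unitary i l').1, Matrix.mul_assoc, h4, Matrix.mul_zero]
  have hT0 : T = 0 := by
    rw [← Matrix.one_mul T, ← hU.1, Matrix.mul_assoc, hUT, Matrix.mul_zero]
  rw [hT0, Matrix.mul_zero] at hc
  have h5 := congrFun (congrFun hc (Classical.arbitrary _)) (Classical.arbitrary _)
  rw [Matrix.smul_apply, Matrix.one_apply_eq, Matrix.zero_apply, smul_eq_mul, mul_one] at h5
  exact hc0 h5.symm

end Transforms

/-! ### Operators with equal Gram matrices. -/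

section IsometryExtension

variable {N N' J : Type*} [Fintype N] [Fintype N'] [Fintype J] [DecidableEq N] [DecidableEq N']

/-- Equal Gram matrices mean ‖Av‖ = ‖Bv‖, so Av ↦ Bv is a well-defined isometry on the range of A,
and it extends to the whole space. -/
theorem exists_unitary_mul_eq {A B : Matrix N J ℂ} (h : Aᴴ * A = Bᴴ * B) :
    ∃ V : Matrix N N ℂ, Vᴴ * V = 1 ∧ V * A = B := by
  classical
  let α := Matrix.toEuclideanLin A
  let β := Matrix.toEuclideanLin B
  have hinner : ∀ (M : Matrix N J ℂ) (v : EuclideanSpace ℂ J),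
      inner ℂ (Matrix.toEuclideanLin M v) (Matrix.toEuclideanLin M v) =
        (Mᴴ * M) *ᵥ v.ofLp ⬝ᵥ star v.ofLp := by
    intro M v
    rw [EuclideanSpace.inner_eq_star_dotProduct, Matrix.toLpLin_apply]
    change M *ᵥ v.ofLp ⬝ᵥ star (M *ᵥ v.ofLp) = _
    rw [Matrix.star_mulVec, dotProduct_comm, ← Matrix.dotProduct_mulVec, Matrix.mulVec_mulVec,
      dotProduct_comm]
  have hnorm : ∀ v, ‖β v‖ = ‖α v‖ := by
    intro v
    have h1 : inner ℂ (β v) (β v) = inner ℂ (α v) (α v) := by rw [hinner, hinner, h]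
    rw [inner_self_eq_norm_sq_to_K, inner_self_eq_norm_sq_to_K] at h1
    have h2 : ‖β v‖ ^ 2 = ‖α v‖ ^ 2 := by exact_mod_cast h1
    exact (sq_eq_sq₀ (norm_nonneg _) (norm_nonneg _)).1 h2
  have hker : LinearMap.ker α ≤ LinearMap.ker β := by
    intro v hv
    rw [LinearMap.mem_ker] at hv ⊢
    rw [← norm_eq_zero, hnorm, hv, norm_zero]
  let L : LinearMap.range α →ₗ[ℂ] EuclideanSpace ℂ N :=
    (LinearMap.ker α).liftQ β hker ∘ₗ α.quotKerEquivRange.symm.toLinearMap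
  have hL : ∀ v, L ⟨α v, v, rfl⟩ = β v := by
    intro v
    have : α.quotKerEquivRange.symm ⟨α v, v, rfl⟩ = (LinearMap.ker α).mkQ v := by
      rw [LinearEquiv.symm_apply_eq]
      rfl
    simp only [L, LinearMap.comp_apply, LinearEquiv.coe_coe, this]
    exact Submodule.liftQ_apply _ _ _
  let Li : LinearMap.range α →ₗᵢ[ℂ] EuclideanSpace ℂ N :=
    { L with
      norm_map' := by
        rintro ⟨_, v, rfl⟩
        change ‖L _‖ = _
        rw [hL, hnorm]
        rfl }
  let E := Li.extend
  have hE : ∀ v, E (α v) = β v := fun v =>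
    (LinearIsometry.extend_apply Li ⟨α v, v, rfl⟩).trans (hL v)
  let V : Matrix N N ℂ := Matrix.toEuclideanLin.symm E.toLinearMap
  have hV : Matrix.toEuclideanLin V = E.toLinearMap := LinearEquiv.apply_symm_apply _ _
  have hVE : ∀ w : N → ℂ, V *ᵥ w = (E (WithLp.toLp 2 w)).ofLp := by
    intro w
    have := congrArg (fun f : EuclideanSpace ℂ N →ₗ[ℂ] EuclideanSpace ℂ N =>
      (f (WithLp.toLp 2 w)).ofLp) hV
    simp only [Matrix.toLpLin_apply] at this
    exact this
  refine ⟨V, ?_, ?_⟩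
  · ext i j
    have h1 := E.inner_map_map (WithLp.toLp 2 (Pi.single i 1)) (WithLp.toLp 2 (Pi.single j 1))
    rw [EuclideanSpace.inner_eq_star_dotProduct, EuclideanSpace.inner_eq_star_dotProduct,
      ← hVE, ← hVE, Matrix.mulVec_single_one, Matrix.mulVec_single_one] at h1
    have h2 : (Pi.single j 1 : N → ℂ) ⬝ᵥ star (Pi.single i 1) = (1 : Matrix N N ℂ) i j := by
      rw [single_one_dotProduct, Pi.star_apply, Matrix.one_apply, Pi.single_apply]
      by_cases hij : i = j <;> simp [hij, eq_comm]
    rw [h2] at h1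
    rw [← h1, dotProduct_comm]
    rfl
  · apply Matrix.ext_of_mulVec_single
    intro j
    rw [← Matrix.mulVec_mulVec, hVE]
    have := hE (WithLp.toLp 2 (Pi.single j 1))
    simp only [α, β, Matrix.toLpLin_apply] at this
    rw [this]

/-- Two operators with the same Gram matrix differ by an isometry. -/
theorem exists_isometry_mul_eq {A : Matrix N J ℂ} {B : Matrix N' J ℂ} (h : Aᴴ * A = Bᴴ * B)
    (hc : Fintype.card N ≤ Fintype.card N') : ∃ V : Matrix N' N ℂ, IsIsometry V ∧ V * A = B := by
  obtain ⟨e⟩ := Function.Embedding.nonempty_of_card_le hc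
  -- Inclusion of coordinates, which reduces the rectangular case to the square one.
  let E : Matrix N' N ℂ := Matrix.of fun i j => if i = e j then 1 else 0
  have hE : Eᴴ * E = 1 := by
    ext i j
    simp [E, Matrix.mul_apply, Matrix.one_apply, apply_ite, e.injective.eq_iff, eq_comm]
  obtain ⟨V, hV, hVA⟩ := exists_unitary_mul_eq (A := E * A) (B := B) (by
    rw [← h, conjTranspose_mul, Matrix.mul_assoc, ← Matrix.mul_assoc Eᴴ, hE, Matrix.one_mul])
  refine ⟨V * E, ?_, by rw [Matrix.mul_assoc, hVA]⟩
  rw [IsIsometry, conjTranspose_mul, Matrix.mul_assoc, ← Matrix.mul_assoc Vᴴ, hV, Matrix.one_mul,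
    hE]

end IsometryExtension

/-! ### Schur's lemma for families of intertwiners with equal Gram matrices. -/

section MultiplicityIsometries

variable {G E α : Type*} [Group G] [Fintype E] [Fintype α]
  {Y N N' : α → Type*} [∀ a, Fintype (Y a)] [∀ a, Fintype (N a)] [∀ a, Fintype (N' a)]
  [∀ a, DecidableEq (Y a)]

theorem Intertwines.eq_apply_smul_one {G X : Type*} [Fintype X] [DecidableEq X]
    {π : G → Matrix X X ℂ} {T : Matrix X X ℂ} (hT : Intertwines T π π)
    (scalar : ∀ T : Matrix X X ℂ, Intertwines T π π → ∃ c : ℂ, T = c • 1) (x : X) :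
    T = T x x • 1 := by
  obtain ⟨c, hc⟩ := scalar _ hT
  rw [hc]
  simp

/-- Sandwiching the total Gram matrix between intertwiners to π_a removes every other isotypic type
and turns each factor R f† into a scalar. The total Gram matrix thus determines the Gram matrix of
these scalars for each type separately. -/
theorem gram_slice {τ : G → Matrix E E ℂ} (hτ : IsStarRep τ)
    {π : ∀ a, G → Matrix (Y a) (Y a) ℂ} (hπ : ∀ a, IsStarRep (π a))
    (scalar : ∀ a (T : Matrix (Y a) (Y a) ℂ), Intertwines T (π a) (π a) → ∃ c : ℂ, T = c • 1)
    (disjoint : ∀ a b, a ≠ b → ∀ T : Matrix (Y b) (Y a) ℂ, Intertwines T (π a) (π b) → T = 0)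
    {R : ∀ a, N a → Matrix (Y a) E ℂ} (hR : ∀ a n, Intertwines (R a n) τ (π a))
    {a : α} (f : Matrix (Y a) E ℂ) {g : Matrix (Y a) E ℂ} (hg : Intertwines g τ (π a))
    (y₀ : Y a) :
    (f * (∑ b, ∑ n, (R b n)ᴴ * R b n) * gᴴ) y₀ y₀ =
      ∑ n, star ((R a n * fᴴ) y₀ y₀) * (R a n * gᴴ) y₀ y₀ := by
  classical
  rw [Matrix.mul_assoc, Matrix.sum_mul, Finset.sum_eq_single a, Matrix.sum_mul, Matrix.mul_sum,
    Matrix.sum_apply]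
  · refine Finset.sum_congr rfl fun n _ => ?_
    rw [Matrix.mul_assoc, ← Matrix.mul_assoc f, ((hR a n).mul
        (hg.conjTranspose hτ (hπ a))).eq_apply_smul_one (scalar a) y₀, Matrix.mul_smul,
      Matrix.mul_one, Matrix.smul_apply, Matrix.smul_apply, Matrix.one_apply_eq, smul_eq_mul,
      smul_eq_mul, mul_one, mul_comm]
    congr 1
    rw [← Matrix.conjTranspose_apply, conjTranspose_mul, conjTranspose_conjTranspose]
  · intro b _ hb
    rw [Matrix.sum_mul]
    refine Finset.sum_eq_zero fun n _ => ?_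
    rw [Matrix.mul_assoc, disjoint a b hb.symm _ ((hR b n).mul (hg.conjTranspose hτ (hπ a))),
      Matrix.mul_zero]
  · simp

variable [∀ a, DecidableEq (N a)] [∀ a, DecidableEq (N' a)] [∀ a, Nonempty (Y a)]

/-- Two equivariant operators from `E` to multiples of the inequivalent irreducible
representations `Y a` which have the same Gram matrix differ by isometries of the multiplicity
spaces. -/
theorem exists_multiplicity_isometries {τ : G → Matrix E E ℂ} (hτ : IsStarRep τ)
    {π : ∀ a, G → Matrix (Y a) (Y a) ℂ} (hπ : ∀ a, IsStarRep (π a))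
    (scalar : ∀ a (T : Matrix (Y a) (Y a) ℂ), Intertwines T (π a) (π a) → ∃ c : ℂ, T = c • 1)
    (disjoint : ∀ a b, a ≠ b → ∀ T : Matrix (Y b) (Y a) ℂ, Intertwines T (π a) (π b) → T = 0)
    {P : ∀ a, N a → Matrix (Y a) E ℂ} {Q : ∀ a, N' a → Matrix (Y a) E ℂ}
    (hP : ∀ a n, Intertwines (P a n) τ (π a)) (hQ : ∀ a n, Intertwines (Q a n) τ (π a))
    (gram : ∑ a, ∑ n, (P a n)ᴴ * P a n = ∑ a, ∑ n, (Q a n)ᴴ * Q a n)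
    (hcard : ∀ a, Fintype.card (N a) ≤ Fintype.card (N' a)) :
    ∃ V : ∀ a, Matrix (N' a) (N a) ℂ, (∀ a, IsIsometry (V a)) ∧
      ∀ a n', Q a n' = ∑ n, V a n' n • P a n := by
  classical
  suffices h : ∀ a, ∃ V : Matrix (N' a) (N a) ℂ, IsIsometry V ∧
      ∀ n', Q a n' = ∑ n, V n' n • P a n by
    choose V h1 h2 using h
    exact ⟨V, h1, h2⟩
  intro a
  let y₀ : Y a := Classical.arbitrary _
  have hscal : ∀ f g : Matrix (Y a) E ℂ, Intertwines f τ (π a) → Intertwines g τ (π a) →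
      f * gᴴ = (f * gᴴ) y₀ y₀ • 1 := fun f g hf hg =>
    (hf.mul (hg.conjTranspose hτ (hπ a))).eq_apply_smul_one (scalar a) y₀
  -- All members of both families serve as test vectors: they span the space in which P and Q must
  -- be compared.
  let f : N a ⊕ N' a → Matrix (Y a) E ℂ := Sum.elim (P a) (Q a)
  have hf : ∀ j, Intertwines (f j) τ (π a) := Sum.rec (hP a) (hQ a)
  obtain ⟨V, hV, hVA⟩ := exists_isometry_mul_eq
    (A := Matrix.of fun n j => (P a n * (f j)ᴴ) y₀ y₀)
    (B := Matrix.of fun n' j => (Q a n' * (f j)ᴴ) y₀ y₀) (by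
      ext i j
      have h1 := gram_slice hτ hπ scalar disjoint hP (f i) (hf j) y₀
      have h2 := gram_slice hτ hπ scalar disjoint hQ (f i) (hf j) y₀
      rw [gram] at h1
      exact h1.symm.trans h2) (hcard a)
  refine ⟨V, hV, fun n' => ?_⟩
  -- The error is orthogonal to every test vector and is itself a combination of them, hence D D† =
  -- 0.
  set D := Q a n' - ∑ n, V n' n • P a n with hD
  have hDi : Intertwines D τ (π a) :=
    (hQ a n').sub (Intertwines.sum _ fun n => (hP a n).smul _)
  have hDf : ∀ j, D * (f j)ᴴ = 0 := by
    intro j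
    have h1 := congrFun (congrFun hVA n') j
    rw [Matrix.mul_apply] at h1
    rw [hscal D (f j) hDi (hf j), hD, Matrix.sub_mul, Matrix.sum_mul, Matrix.sub_apply,
      Matrix.sum_apply]
    simp only [Matrix.of_apply] at h1
    simp only [Matrix.smul_mul, Matrix.smul_apply, smul_eq_mul]
    rw [h1, sub_self, zero_smul]
  have hDD : D * Dᴴ = 0 := by
    conv_lhs => rw [hD, conjTranspose_sub, conjTranspose_sum, ← hD]
    rw [Matrix.mul_sub, Matrix.mul_sum]
    simp only [conjTranspose_smul, Matrix.mul_smul]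
    rw [show D * (Q a n')ᴴ = 0 from hDf (Sum.inr n')]
    simp only [show ∀ n, D * (P a n)ᴴ = 0 from fun n => hDf (Sum.inl n), smul_zero,
      Finset.sum_const_zero, sub_zero]
  exact sub_eq_zero.1 (Matrix.self_mul_conjTranspose_eq_zero.1 hDD)

end MultiplicityIsometries

/-! ### Irreducible representations of the product group. -/

section ExternalTensorProduct

variable {G H X Y X' Y' : Type*} [Group G] [Group H] [Fintype X] [Fintype Y] [DecidableEq X]
  [DecidableEq Y] [Fintype X'] [Fintype Y'] [DecidableEq X'] [DecidableEq Y']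
  {π : G →* Matrix.unitaryGroup X ℂ} {τ : H →* Matrix.unitaryGroup Y ℂ}
  {π' : G →* Matrix.unitaryGroup X' ℂ} {τ' : H →* Matrix.unitaryGroup Y' ℂ}

theorem Intertwines.fst_slice {T : Matrix (X' × Y') (X × Y) ℂ}
    (hT : Intertwines T (fun p : G × H => repMat π p.1 ⊗ₖ repMat τ p.2)
      (fun p => repMat π' p.1 ⊗ₖ repMat τ' p.2)) (y' : Y') (y : Y) :
    Intertwines (Matrix.of fun x' x => T (x', y') (x, y)) (repMat π) (repMat π') := by
  intro g
  ext x' x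
  have := congrFun (congrFun (hT (g, 1)) (x', y')) (x, y)
  simpa [Matrix.mul_apply, Fintype.sum_prod_type, repMat_one, Matrix.one_apply,
    Matrix.kroneckerMap_apply] using this

theorem Intertwines.snd_slice {T : Matrix (X' × Y') (X × Y) ℂ}
    (hT : Intertwines T (fun p : G × H => repMat π p.1 ⊗ₖ repMat τ p.2)
      (fun p => repMat π' p.1 ⊗ₖ repMat τ' p.2)) (x' : X') (x : X) :
    Intertwines (Matrix.of fun y' y => T (x', y') (x, y)) (repMat τ) (repMat τ') := by
  intro h
  ext y' y
  have := congrFun (congrFun (hT (1, h)) (x', y')) (x, y)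
  simpa [Matrix.mul_apply, Fintype.sum_prod_type, repMat_one, Matrix.one_apply,
    Matrix.kroneckerMap_apply, Finset.sum_ite_irrel] using this

/-- Schur's lemma for external tensor products of irreducible representations. -/
theorem Intertwines.exists_eq_smul_one_of_kronecker (hπ : (toRepresentation π).IsIrreducible)
    (hτ : (toRepresentation τ).IsIrreducible) {T : Matrix (X × Y) (X × Y) ℂ}
    (hT : Intertwines T (fun p : G × H => repMat π p.1 ⊗ₖ repMat τ p.2)
      (fun p => repMat π p.1 ⊗ₖ repMat τ p.2)) : ∃ c : ℂ, T = c • 1 := by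
  -- Restricting to G makes every block scalar. The matrix of these scalars is a slice that commutes
  -- with the action of H, so it is scalar as well.
  choose b hb using fun y' y => (hT.fst_slice y' y).exists_eq_smul_one hπ
  obtain ⟨x₀⟩ := nonempty_of_isIrreducible hπ
  obtain ⟨c, hc⟩ := (hT.snd_slice x₀ x₀).exists_eq_smul_one hτ
  refine ⟨c, ?_⟩
  ext ⟨x', y'⟩ ⟨x, y⟩
  have h1 := congrFun (congrFun (hb y' y) x') x
  have h2 := congrFun (congrFun (hb y' y) x₀) x₀
  have h3 := congrFun (congrFun hc y') y
  simp only [Matrix.of_apply, Matrix.smul_apply, Matrix.one_apply_eq, smul_eq_mul, mul_one]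
    at h1 h2 h3
  rw [h1, ← h2, h3, ← Matrix.one_kronecker_one]
  simp only [Matrix.smul_apply, Matrix.kroneckerMap_apply, smul_eq_mul]
  ring

/-- A nonzero entry lies in a nonzero slice for G and in a nonzero slice for H, and these make both
pairs of factors equivalent. -/
theorem Intertwines.eq_zero_of_kronecker {T : Matrix (X' × Y') (X × Y) ℂ}
    (hT : Intertwines T (fun p : G × H => repMat π p.1 ⊗ₖ repMat τ p.2)
      (fun p => repMat π' p.1 ⊗ₖ repMat τ' p.2))
    (hπ : (toRepresentation π).IsIrreducible) (hτ : (toRepresentation τ).IsIrreducible)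
    (hπ' : (toRepresentation π').IsIrreducible) (hτ' : (toRepresentation τ').IsIrreducible)
    (h : ¬ (Nonempty ((toRepresentation π).Equiv (toRepresentation π')) ∧
      Nonempty ((toRepresentation τ).Equiv (toRepresentation τ')))) : T = 0 := by
  ext ⟨x', y'⟩ ⟨x, y⟩
  by_contra hne
  refine h ⟨(hT.fst_slice y' y).nonempty_equiv hπ hπ' fun h0 => hne ?_,
    (hT.snd_slice x' x).nonempty_equiv hτ hτ' fun h0 => hne ?_⟩
  · exact congrFun (congrFun h0 x') x
  · exact congrFun (congrFun h0 y') y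

end ExternalTensorProduct

/-! ### Partial traces and symmetry. -/

section PartialTrace

variable {a b : Type*} [Fintype b]

/-- The partial trace over the second tensor factor. -/
def ptrace (M : Matrix (a × b) (a × b) ℂ) : Matrix a a ℂ :=
  Matrix.of fun i j => ∑ y, M (i, y) (j, y)

theorem ptrace_mul_kronecker_one [Fintype a] [DecidableEq b] (M : Matrix (a × b) (a × b) ℂ)
    (A : Matrix a a ℂ) : ptrace (M * (A ⊗ₖ (1 : Matrix b b ℂ))) = ptrace M * A := by
  ext i j
  simp only [ptrace, Matrix.of_apply, Matrix.mul_apply, Matrix.kroneckerMap_apply,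
    Fintype.sum_prod_type, Matrix.one_apply, mul_ite, mul_one, mul_zero, Finset.sum_ite_eq',
    Finset.mem_univ, if_true, Finset.sum_mul]
  exact Finset.sum_comm

theorem ptrace_kronecker_one_mul [Fintype a] [DecidableEq b] (M : Matrix (a × b) (a × b) ℂ)
    (A : Matrix a a ℂ) : ptrace ((A ⊗ₖ (1 : Matrix b b ℂ)) * M) = A * ptrace M := by
  ext i j
  simp only [ptrace, Matrix.of_apply, Matrix.mul_apply, Matrix.kroneckerMap_apply,
    Fintype.sum_prod_type, Matrix.one_apply, mul_ite, mul_one, mul_zero, Finset.mul_sum, ite_mul,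
    zero_mul, Finset.sum_ite_eq, Finset.mem_univ, if_true]
  exact Finset.sum_comm

theorem ptrace_one_kronecker_mul_comm [Fintype a] [DecidableEq a] (M : Matrix (a × b) (a × b) ℂ)
    (B : Matrix b b ℂ) :
    ptrace (((1 : Matrix a a ℂ) ⊗ₖ B) * M) = ptrace (M * ((1 : Matrix a a ℂ) ⊗ₖ B)) := by
  ext i j
  simp only [ptrace, Matrix.of_apply, Matrix.mul_apply, Matrix.kroneckerMap_apply,
    Fintype.sum_prod_type_right, Matrix.one_apply, ite_mul, one_mul, zero_mul, mul_ite, mul_zero,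
    Finset.sum_ite_eq, Finset.sum_ite_eq', Finset.mem_univ, if_true]
  rw [Finset.sum_comm]
  exact Finset.sum_congr rfl fun _ _ => Finset.sum_congr rfl fun _ _ => mul_comm _ _

/-- The partial trace is cyclic for operators on the traced factor, so B and B† meet and cancel. -/
theorem commute_ptrace [Fintype a] [DecidableEq a] [DecidableEq b]
    {M : Matrix (a × b) (a × b) ℂ} {A : Matrix a a ℂ} {B : Matrix b b ℂ}
    (h : Commute M (A ⊗ₖ B)) (h1 : B * Bᴴ = 1) (h2 : Bᴴ * B = 1) : Commute (ptrace M) A := by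
  have h3 : M * (A ⊗ₖ (1 : Matrix b b ℂ)) = (A ⊗ₖ B) * M * ((1 : Matrix a a ℂ) ⊗ₖ Bᴴ) := by
    rw [← h.eq, Matrix.mul_assoc, ← Matrix.mul_kronecker_mul, h1, Matrix.mul_one]
  change ptrace M * A = A * ptrace M
  rw [← ptrace_mul_kronecker_one, h3, ← ptrace_one_kronecker_mul_comm, ← Matrix.mul_assoc,
    ← Matrix.mul_kronecker_mul, h2, Matrix.one_mul, ptrace_kronecker_one_mul]

theorem ptrace_kronecker_one [DecidableEq b] (M : Matrix a a ℂ) :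
    ptrace (M ⊗ₖ (1 : Matrix b b ℂ)) = (Fintype.card b : ℂ) • M := by
  ext i j
  simp [ptrace, Matrix.kroneckerMap_apply]

end PartialTrace

/-! ### Choi matrices of combs: recursion, normalisation, positivity, Gram form. -/

section Combs

variable {I O A : ℕ → Type*}

/-- The last input and output of a tuple of inputs and outputs. -/
def combEquiv (I O : ℕ → Type*) (k : ℕ) :
    (((∀ j : Fin k, I j) × (∀ j : Fin k, O j)) × I k) × O k ≃
      (∀ j : Fin (k + 1), I j) × (∀ j : Fin (k + 1), O j) where
  toFun p := (snocEquiv I k (p.1.1.1, p.1.2), snocEquiv O k (p.1.1.2, p.2))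
  invFun p := (((((snocEquiv I k).symm p.1).1, ((snocEquiv O k).symm p.2).1),
    ((snocEquiv I k).symm p.1).2), ((snocEquiv O k).symm p.2).2)
  left_inv p := by simp
  right_inv p := by simp

theorem amplify_posSemidef {a b r : Type*} [Fintype r] {Φ : Matrix a a ℂ → Matrix b b ℂ}
    (hΦ : ∀ (r : ℕ) (X : Matrix (a × Fin r) (a × Fin r) ℂ), X.PosSemidef →
      (amplify Φ X).PosSemidef) {X : Matrix (a × r) (a × r) ℂ} (hX : X.PosSemidef) :
    (amplify Φ X).PosSemidef := by
  let e := Fintype.equivFin r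
  have h := (hΦ _ _ (hX.submatrix (Prod.map id e.symm))).submatrix (Prod.map id e)
  convert h using 1
  ext ⟨i, s⟩ ⟨j, t⟩
  simp [amplify]

section Steps

variable (Ψ : ∀ i, Matrix (I i × A i) (I i × A i) ℂ →ₗ[ℂ]
      Matrix (O i × A (i + 1)) (O i × A (i + 1)) ℂ)

theorem combMap_succ_apply (k : ℕ)
    (X : Matrix ((∀ j : Fin (k + 1), I j) × A 0) ((∀ j : Fin (k + 1), I j) × A 0) ℂ)
    (o o' : ∀ j : Fin k, O j) (y y' : O k) (c c' : A (k + 1)) :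
    combMap Ψ (k + 1) X (snocEquiv O k (o, y), c) (snocEquiv O k (o', y'), c') =
      Ψ k (Matrix.of fun p q => combMap Ψ k (Matrix.of fun s t =>
        X (snocEquiv I k (s.1, p.1), s.2) (snocEquiv I k (t.1, q.1), t.2)) (o, p.2) (o', q.2))
        (y, c) (y', c') := by
  have h : ∀ (o : ∀ j : Fin k, O j) (y : O k),
      (snocEquiv O k (o, y) (Fin.last k), Fin.init (α := fun j : Fin (k + 1) => O j)
        (snocEquiv O k (o, y))) = (y, o) := fun o y =>
    congrArg Prod.swap ((snocEquiv O k).symm_apply_apply (o, y))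
  have h1 : ∀ (o : ∀ j : Fin k, O j) (y : O k), snocEquiv O k (o, y) (Fin.last k) = y :=
    fun o y => congrArg Prod.fst (h o y)
  have h2 : ∀ (o : ∀ j : Fin k, O j) (y : O k),
      Fin.init (α := fun j : Fin (k + 1) => O j) (snocEquiv O k (o, y)) = o :=
    fun o y => congrArg Prod.snd (h o y)
  simp only [combMap, Matrix.submatrix_apply, amplify, Matrix.of_apply, h1, h2]
  rfl

/-- Homogeneity is what allows the indicator of the next input's matrix unit to be pulled out of the
earlier steps. -/
theorem combMap_smul (k : ℕ) (z : ℂ)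
    (X : Matrix ((∀ j : Fin k, I j) × A 0) ((∀ j : Fin k, I j) × A 0) ℂ) :
    combMap Ψ k (z • X) = z • combMap Ψ k X := by
  induction k with
  | zero => rfl
  | succ k ih =>
    ext ⟨o, c⟩ ⟨o', c'⟩
    obtain ⟨⟨o, y⟩, rfl⟩ := (snocEquiv O k).surjective o
    obtain ⟨⟨o', y'⟩, rfl⟩ := (snocEquiv O k).surjective o'
    rw [Matrix.smul_apply, combMap_succ_apply, combMap_succ_apply, ← Matrix.smul_apply,
      ← map_smul]
    refine congrFun (congrFun (congrArg (Ψ k) ?_) (y, c)) (y', c')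
    ext p q
    have := congrFun (congrFun (ih (Matrix.of fun s t =>
        X (snocEquiv I k (s.1, p.1), s.2) (snocEquiv I k (t.1, q.1), t.2))) (o, p.2)) (o', q.2)
    exact this

/-- Complete positivity passes to compositions: the next input is part of the reference system for
the earlier steps, and the earlier outputs are part of it for the new step. -/
theorem amplify_combMap_posSemidef [∀ i, Fintype (I i)] [∀ i, Fintype (O i)] [∀ i, Fintype (A i)]
    (k : ℕ) (hΨ : ∀ i < k, IsChannel (Ψ i)) :
    ∀ (r : ℕ) (X : Matrix (((∀ j : Fin k, I j) × A 0) × Fin r)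
      (((∀ j : Fin k, I j) × A 0) × Fin r) ℂ), X.PosSemidef →
      (amplify (combMap Ψ k) X).PosSemidef := by
  induction k with
  | zero =>
    intro r X hX
    exact hX.submatrix fun s : ((∀ j : Fin 0, O j) × A 0) × Fin r => (((fun j => j.elim0, s.1.2) : (∀ j : Fin 0, I j) × A 0), s.2)
  | succ k ih =>
    intro r X hX
    have h1 := amplify_posSemidef (ih fun i hi => hΨ i (by omega)) (hX.submatrix
      fun s : ((∀ j : Fin k, I j) × A 0) × (I k × Fin r) =>
        ((snocEquiv I k (s.1.1, s.2.1), s.1.2), s.2.2))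
    have h2 := amplify_posSemidef (hΨ k (by omega)).completelyPositive (h1.submatrix
      fun s : (I k × A k) × ((∀ j : Fin k, O j) × Fin r) => ((s.2.1, s.1.2), (s.1.1, s.2.2)))
    have h3 := h2.submatrix fun s : ((∀ j : Fin (k + 1), O j) × A (k + 1)) × Fin r =>
      ((s.1.1 (Fin.last k), s.1.2), (Fin.init (α := fun j : Fin (k + 1) => O j) s.1.1, s.2))
    exact h3

variable [∀ i, DecidableEq (I i)] [∀ i, DecidableEq (A i)] (a₀ : A 0)

theorem combMap_single_succ (k : ℕ) (u u' : ∀ j : Fin k, I j) (x x' : I k)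
    (o o' : ∀ j : Fin k, O j) (y y' : O k) (c c' : A (k + 1)) :
    combMap Ψ (k + 1) (Matrix.single (snocEquiv I k (u, x), a₀) (snocEquiv I k (u', x'), a₀) 1)
      (snocEquiv O k (o, y), c) (snocEquiv O k (o', y'), c') =
      Ψ k (Matrix.of fun p q => (if p.1 = x ∧ q.1 = x' then 1 else 0) *
        combMap Ψ k (Matrix.single (u, a₀) (u', a₀) 1) (o, p.2) (o', q.2))
        (y, c) (y', c') := by
  rw [combMap_succ_apply]
  refine congrFun (congrFun (congrArg (Ψ k) ?_) (y, c)) (y', c')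
  ext p q
  simp only [Matrix.of_apply]
  rw [← smul_eq_mul, ← Matrix.smul_apply, ← combMap_smul]
  refine congrFun (congrFun (congrArg (combMap Ψ k) ?_) _) _
  ext ⟨s, b⟩ ⟨t, b'⟩
  simp only [Matrix.of_apply, Matrix.smul_apply, Matrix.single_apply, Prod.mk.injEq,
    EmbeddingLike.apply_eq_iff_eq, smul_eq_mul]
  split_ifs <;> grind

theorem combChoi_zero [∀ i, Fintype (A i)] : combChoi Ψ a₀ 0 = 1 := by
  ext p q
  rw [Subsingleton.elim q p, Matrix.one_apply_eq]
  simp only [combChoi, Matrix.of_apply, combMap, Matrix.submatrix_apply]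
  rw [Finset.sum_eq_single a₀]
  · rw [Matrix.single_apply, if_pos]
    exact ⟨Prod.ext (Subsingleton.elim _ _) rfl, Prod.ext (Subsingleton.elim _ _) rfl⟩
  · intro c _ hc
    rw [Matrix.single_apply, if_neg]
    rintro ⟨h, -⟩
    exact hc (congrArg Prod.snd h).symm
  · simp

variable [∀ i, Fintype (I i)] [∀ i, Fintype (O i)] [∀ i, Fintype (A i)]

/-- The normalisation of the Choi matrices of the first steps of a comb. -/
theorem sum_combChoi_succ (k : ℕ) (hΨ : IsChannel (Ψ k))
    (e e' : (∀ j : Fin k, I j) × (∀ j : Fin k, O j)) (x x' : I k) :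
    ∑ y, combChoi Ψ a₀ (k + 1) (combEquiv I O k ((e, x), y)) (combEquiv I O k ((e', x'), y)) =
      if x = x' then combChoi Ψ a₀ k e e' else 0 := by
  simp only [combChoi, Matrix.of_apply, combEquiv, Equiv.coe_fn_mk, combMap_single_succ]
  -- Summing over the output and the discarded memory together is the full trace of the last
  -- channel's output, to which trace preservation applies.
  rw [← Fintype.sum_prod_type']
  refine (hΨ.tracePreserving _).trans ?_
  simp only [Matrix.trace, Matrix.diag_apply, Matrix.of_apply]
  rw [Fintype.sum_prod_type, Finset.sum_eq_single x]
  · by_cases h : x = x' <;> simp [h]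
  · intro z _ hz
    simp [hz]
  · simp

theorem combChoi_posSemidef (k : ℕ) (hΨ : ∀ i < k, IsChannel (Ψ i)) :
    (combChoi Ψ a₀ k).PosSemidef := by
  -- The unnormalised maximally entangled vector of the inputs and a reference copy, with memory in
  -- state a₀. The Choi matrix is the image of its projector, traced over the final memory.
  let w : ((∀ j : Fin k, I j) × A 0) × (∀ j : Fin k, I j) → ℂ :=
    fun s => if (s.2, a₀) = s.1 then 1 else 0
  have h1 := amplify_posSemidef (amplify_combMap_posSemidef Ψ k hΨ)
    (Matrix.posSemidef_vecMulVec_self_star w)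
  have h2 : combChoi Ψ a₀ k = ∑ c : A k, (amplify (combMap Ψ k) (vecMulVec w (star w))).submatrix
      (fun p : (∀ j : Fin k, I j) × (∀ j : Fin k, O j) => ((p.2, c), p.1))
      (fun p => ((p.2, c), p.1)) := by
    ext p q
    rw [Matrix.sum_apply]
    simp only [combChoi, Matrix.of_apply, Matrix.submatrix_apply, amplify]
    refine Finset.sum_congr rfl fun c _ => ?_
    refine congrFun (congrFun (congrArg (combMap Ψ k) ?_) _) _
    ext s t
    simp only [Matrix.single_apply, Matrix.of_apply, Matrix.vecMulVec_apply, w, Pi.star_apply]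
    split_ifs <;> simp_all
  rw [h2]
  exact Matrix.posSemidef_sum _ fun c _ => h1.submatrix _

end Steps

theorem conjMap_apply {a b : Type*} [Fintype a] (W : Matrix b a ℂ) (X : Matrix a a ℂ) :
    conjMap W X = W * X * Wᴴ := rfl

/-- The Choi matrix of a sequential circuit of operators, as the Gram matrix of the operators
obtained by bending its outputs. -/
theorem combChoi_conjMap [∀ i, Fintype (I i)] [∀ i, DecidableEq (I i)] [∀ i, Fintype (A i)]
    [∀ i, DecidableEq (A i)] (W : ∀ i, Matrix (O i × A (i + 1)) (I i × A i) ℂ) (a₀ : A 0)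
    (R : ∀ k, Matrix (A k) ((∀ j : Fin k, I j) × (∀ j : Fin k, O j)) ℂ)
    (h0 : ∀ c e, R 0 c e = if a₀ = c then 1 else 0) (n : ℕ)
    (hR : ∀ k < n, ∀ e x y c,
      R (k + 1) c (combEquiv I O k ((e, x), y)) = ∑ a, W k (y, c) (x, a) * R k a e) :
    combChoi (fun i => conjMap (W i)) a₀ n = conjMat ((R n)ᴴ * R n) := by
  -- On matrix units the untraced circuit stays of rank one: its output is a product of one entry of
  -- R with the conjugate of another, and each step acts on both sides.
  have key : ∀ k ≤ n, ∀ (u u' : ∀ j : Fin k, I j) (o o' : ∀ j : Fin k, O j) (c c' : A k),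
      combMap (fun i => conjMap (W i)) k (Matrix.single (u, a₀) (u', a₀) 1) (o, c) (o', c') =
        R k c (u, o) * star (R k c' (u', o')) := by
    intro k
    induction k with
    | zero =>
      intro _ u u' o o' c c'
      obtain rfl : u = fun j => j.elim0 := Subsingleton.elim _ _
      obtain rfl : u' = fun j => j.elim0 := Subsingleton.elim _ _
      rw [h0, h0]
      simp only [combMap, Matrix.submatrix_apply, Matrix.single_apply, Prod.mk.injEq, true_and]
      split_ifs <;> simp_all
    | succ k ih =>
      intro hk u u' o o' c c'
      obtain ⟨⟨u, x⟩, rfl⟩ := (snocEquiv I k).surjective u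
      obtain ⟨⟨u', x'⟩, rfl⟩ := (snocEquiv I k).surjective u'
      obtain ⟨⟨o, y⟩, rfl⟩ := (snocEquiv O k).surjective o
      obtain ⟨⟨o', y'⟩, rfl⟩ := (snocEquiv O k).surjective o'
      rw [combMap_single_succ]
      have e1 := hR k (by omega) (u, o) x y c
      have e2 := hR k (by omega) (u', o') x' y' c'
      simp only [combEquiv, Equiv.coe_fn_mk] at e1 e2
      rw [e1, e2]
      simp only [ih (by omega)]
      rw [conjMap_apply]
      have hM : (Matrix.of fun p q : I k × A k => (if p.1 = x ∧ q.1 = x' then (1 : ℂ) else 0) *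
          (R k p.2 (u, o) * star (R k q.2 (u', o')))) =
          vecMulVec (fun p => if p.1 = x then R k p.2 (u, o) else 0)
            (fun q => if q.1 = x' then star (R k q.2 (u', o')) else 0) := by
        ext p q
        rw [Matrix.of_apply, Matrix.vecMulVec_apply]
        by_cases h1 : p.1 = x <;> by_cases h2 : q.1 = x' <;> simp [h1, h2]
      rw [hM, Matrix.mul_vecMulVec, Matrix.vecMulVec_mul, Matrix.vecMulVec_apply, star_sum]
      congr 1
      · rw [Matrix.mulVec, dotProduct, Fintype.sum_prod_type, Finset.sum_eq_single x]
        · simp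
        · intro z _ hz
          simp [hz]
        · simp
      · rw [Matrix.vecMul, dotProduct, Fintype.sum_prod_type, Finset.sum_eq_single x']
        · refine Finset.sum_congr rfl fun a _ => ?_
          simp [mul_comm]
        · intro z _ hz
          simp [hz]
        · simp
  ext p q
  simp only [combChoi, Matrix.of_apply, conjMat, Matrix.map_apply, Matrix.mul_apply, star_sum]
  refine Finset.sum_congr rfl fun c _ => ?_
  rw [key n le_rfl, Matrix.conjTranspose_apply, star_mul', star_star]

end Combs

/-! ### Square roots by functional calculus. -/

section SquareRoot

open scoped MatrixOrder in
/-- A square root of a positive semidefinite matrix which commutes with its commutant. -/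
theorem exists_commuting_sqrt {E : Type*} [Fintype E] [DecidableEq E] {M : Matrix E E ℂ}
    (hM : M.PosSemidef) : ∃ S : Matrix E E ℂ, Sᴴ * S = M ∧ ∀ U, Commute M U → Commute S U := by
  refine ⟨CFC.sqrt M, ?_, fun U hU => ?_⟩
  · rw [(CFC.sqrt_nonneg M).posSemidef.1.eq]
    exact CFC.sqrt_mul_sqrt_self M hM.nonneg
  · exact hU.cfcₙ_nnreal _

end SquareRoot

/-! ### Descent of the symmetry to initial segments of the comb. -/

section CommutingCombs

variable {G H : Type*} [Group G] [Group H] {I O : ℕ → Type*}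
  [∀ i, Fintype (I i)] [∀ i, DecidableEq (I i)] [∀ i, Fintype (O i)] [∀ i, DecidableEq (O i)]
  (ρ : ∀ i, G →* Matrix.unitaryGroup (I i) ℂ) (σ : ∀ i, H →* Matrix.unitaryGroup (O i) ℂ)

/-- The representation of `G × H` on the first `k` inputs and outputs. -/
def combRep (k : ℕ) (p : G × H) :
    Matrix ((∀ j : Fin k, I j) × (∀ j : Fin k, O j)) ((∀ j : Fin k, I j) × (∀ j : Fin k, O j)) ℂ :=
  tensorRep ρ k p.1 ⊗ₖ tensorRep σ k p.2

theorem isStarRep_combRep (k : ℕ) : IsStarRep (combRep ρ σ k) := by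
  intro p
  simp only [combRep, Matrix.conjTranspose_kronecker]
  rw [isStarRep_tensorRep, isStarRep_tensorRep]
  rfl

theorem combRep_succ (k : ℕ) (p : G × H) :
    (combRep ρ σ (k + 1) p).submatrix (combEquiv I O k) (combEquiv I O k) =
      (combRep ρ σ k p ⊗ₖ repMat (ρ k) p.1) ⊗ₖ repMat (σ k) p.2 := by
  ext ⟨⟨⟨u, o⟩, x⟩, y⟩ ⟨⟨⟨u', o'⟩, x'⟩, y'⟩
  have h1 := congrFun (congrFun (tensorRep_succ ρ k p.1) (u, x)) (u', x')
  have h2 := congrFun (congrFun (tensorRep_succ σ k p.2) (o, y)) (o', y')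
  simp only [Matrix.submatrix_apply, Matrix.kroneckerMap_apply] at h1 h2
  simp only [combRep, combEquiv, Equiv.coe_fn_mk, Matrix.submatrix_apply,
    Matrix.kroneckerMap_apply, h1, h2]
  ring

variable {ρ σ}

/-- Trace out the last output, then the last input. The second trace leaves M times the dimension of
I_k, which is nonzero. -/
theorem commute_combRep_of_succ {k : ℕ} [Nonempty (I k)]
    {M' : Matrix ((∀ j : Fin (k + 1), I j) × (∀ j : Fin (k + 1), O j))
      ((∀ j : Fin (k + 1), I j) × (∀ j : Fin (k + 1), O j)) ℂ}
    {M : Matrix ((∀ j : Fin k, I j) × (∀ j : Fin k, O j))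
      ((∀ j : Fin k, I j) × (∀ j : Fin k, O j)) ℂ}
    (hM : ptrace (M'.submatrix (combEquiv I O k) (combEquiv I O k)) = M ⊗ₖ (1 : Matrix (I k) (I k) ℂ))
    {p : G × H} (h : Commute M' (combRep ρ σ (k + 1) p)) : Commute M (combRep ρ σ k p) := by
  have h1 : Commute (M'.submatrix (combEquiv I O k) (combEquiv I O k))
      ((combRep ρ σ k p ⊗ₖ repMat (ρ k) p.1) ⊗ₖ repMat (σ k) p.2) := by
    rw [← combRep_succ, Commute, SemiconjBy, Matrix.submatrix_mul_equiv,
      Matrix.submatrix_mul_equiv, h.eq]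
  have h2 := commute_ptrace h1 (repMat_mul_conjTranspose _ _) (repMat_conjTranspose_mul _ _)
  rw [hM] at h2
  have h3 := commute_ptrace h2 (repMat_mul_conjTranspose _ _) (repMat_conjTranspose_mul _ _)
  rw [ptrace_kronecker_one] at h3
  have h4 := h3.smul_left ((Fintype.card (I k) : ℂ)⁻¹)
  rwa [smul_smul, inv_mul_cancel₀ (Nat.cast_ne_zero.2 Fintype.card_ne_zero), one_smul] at h4

/-- The Choi matrices of the first steps of an equivariant quantum comb. -/
theorem IsQuantumComb.exists_equivariant_sequence [∀ i, Nonempty (I i)] {n : ℕ}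
    {C : Matrix ((∀ j : Fin n, I j) × (∀ j : Fin n, O j))
      ((∀ j : Fin n, I j) × (∀ j : Fin n, O j)) ℂ} (hC : IsQuantumComb n C)
    (hcomm : ∀ (g : G) (h : H), Commute C
      (conjMat (tensorRep ρ n g) ⊗ₖ conjMat (tensorRep σ n h))) :
    ∃ M : ∀ k, Matrix ((∀ j : Fin k, I j) × (∀ j : Fin k, O j))
        ((∀ j : Fin k, I j) × (∀ j : Fin k, O j)) ℂ,
      C = conjMat (M n) ∧ M 0 = 1 ∧ (∀ k ≤ n, (M k).PosSemidef) ∧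
      (∀ k ≤ n, ∀ p, Commute (M k) (combRep ρ σ k p)) ∧
      ∀ k < n, ptrace ((M (k + 1)).submatrix (combEquiv I O k) (combEquiv I O k)) =
        M k ⊗ₖ (1 : Matrix (I k) (I k) ℂ) := by
  obtain ⟨r, Ψ, a₀, -, -, hΨ, rfl⟩ := hC
  set B := combChoi (A := fun i => Fin (r i)) Ψ a₀ with hB
  have htr : ∀ k < n, ptrace ((conjMat (B (k + 1))).submatrix (combEquiv I O k)
      (combEquiv I O k)) = conjMat (B k) ⊗ₖ (1 : Matrix (I k) (I k) ℂ) := by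
    intro k hk
    ext ⟨e, x⟩ ⟨e', x'⟩
    have h := congrArg star
      (sum_combChoi_succ (A := fun i => Fin (r i)) Ψ a₀ k (hΨ k hk) e e' x x')
    rw [star_sum] at h
    simp only [ptrace, Matrix.of_apply, Matrix.submatrix_apply, conjMat, Matrix.map_apply,
      Matrix.kroneckerMap_apply, Matrix.one_apply]
    refine h.trans ?_
    split_ifs <;> simp [hB]
  refine ⟨fun k => conjMat (B k), ?_, ?_, fun k hk => ?_, fun k hk => ?_, htr⟩
  · ext p q
    simp [conjMat]
  · change conjMat (combChoi Ψ a₀ 0) = 1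
    rw [combChoi_zero]
    ext p q
    by_cases h : p = q <;> simp [conjMat, Matrix.one_apply, h]
  -- The entrywise conjugate of a Hermitian matrix is its transpose, and transposition preserves
  -- positivity.
  · have h := combChoi_posSemidef (A := fun i => Fin (r i)) Ψ a₀ k fun i hi => hΨ i (by omega)
    have h' := h.transpose
    rw [← h.1.eq] at h'
    exact h'
  -- The symmetry is known only for k = n, so the induction runs downwards.
  · induction hk using Nat.decreasingInduction with
    | self =>
      intro p
      have h := congrArg conjMat (hcomm p.1 p.2).eq
      change _ = _
      ext x y
      have h' := congrFun (congrFun h x) y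
      simpa [conjMat, Matrix.mul_apply, combRep, Matrix.kroneckerMap_apply] using h'
    | of_succ k hk ih => exact fun p => commute_combRep_of_succ (htr k hk) (ih p)

end CommutingCombs

/-! ### Equivariant purifications with values in the memory. -/

section Purification

variable {G H : Type*} [Group G] [Group H] {I O : ℕ → Type*}
  [∀ i, Fintype (I i)] [∀ i, DecidableEq (I i)] [∀ i, Fintype (O i)] [∀ i, DecidableEq (O i)]
  {ρ : ∀ i, G →* Matrix.unitaryGroup (I i) ℂ} {σ : ∀ i, H →* Matrix.unitaryGroup (O i) ℂ}
  {L : Irreps ρ} {K : Irreps σ} {m : ℕ → ℕ}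

/-- The component of an operator into the memory which belongs to given irrep labels and to a given
state of the additional memory. -/
def memSlice {k : ℕ} {E : Type*} (R : Matrix (Mem L K m k) E ℂ) (μ : Fin (K.num k))
    (t : Fin (m k)) (l : Fin (L.num k)) : Matrix (Fin (L.dim k l) × Fin (K.dim k μ)) E ℂ :=
  Matrix.of fun q e => R (⟨μ, q.2⟩, t, ⟨l, q.1⟩) e

/-- The irreducible representation `V_l ⊗ V_μ` of `G × H`. -/
def pairRep (L : Irreps ρ) (K : Irreps σ) {k i : ℕ} (l : Fin (L.num k)) (μ : Fin (K.num i))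
    (p : G × H) : Matrix (Fin (L.dim k l) × Fin (K.dim i μ)) (Fin (L.dim k l) × Fin (K.dim i μ)) ℂ :=
  repMat (L.rep k l) p.1 ⊗ₖ repMat (K.rep i μ) p.2

/-- `R` is an intertwiner from the first `k` inputs and outputs to the memory. -/
def IsEquivariant {k : ℕ}
    (R : Matrix (Mem L K m k) ((∀ j : Fin k, I j) × (∀ j : Fin k, O j)) ℂ) : Prop :=
  ∀ μ t l, Intertwines (memSlice R μ t l) (combRep ρ σ k) (pairRep L K l μ)

theorem sum_memSlice {k : ℕ} {E : Type*} (R : Matrix (Mem L K m k) E ℂ) :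
    ∑ μ, ∑ t, ∑ l, (memSlice R μ t l)ᴴ * memSlice R μ t l = Rᴴ * R := by
  ext e e'
  simp only [Matrix.sum_apply, Matrix.mul_apply, Matrix.conjTranspose_apply, memSlice,
    Matrix.of_apply, Fintype.sum_prod_type, Fintype.sum_sigma]
  refine Finset.sum_congr rfl fun μ _ => ?_
  conv_rhs => rw [Finset.sum_comm]
  refine Finset.sum_congr rfl fun t _ => ?_
  conv_rhs => rw [Finset.sum_comm]
  exact Finset.sum_congr rfl fun l _ => Finset.sum_comm

/-- Different p occupy different memory states, so no cross terms arise. -/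
theorem sum_indicator_gram {P T X Y : Type*} [Fintype P] [Fintype T] [Fintype X] [DecidableEq T]
    {f : P → T} (hf : Function.Injective f) (A : P → Matrix X Y ℂ) :
    ∑ t, (∑ p, (if t = f p then (1 : ℂ) else 0) • A p)ᴴ *
      (∑ p, (if t = f p then (1 : ℂ) else 0) • A p) = ∑ p, (A p)ᴴ * A p := by
  have h : ∀ p, ∑ p', (if f p = f p' then (1 : ℂ) else 0) • A p' = A p := by
    intro p
    rw [Finset.sum_eq_single p]
    · simp
    · intro p' _ hp
      rw [if_neg (fun h => hp (hf h).symm), zero_smul]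
    · simp
  symm
  refine Fintype.sum_of_injective f hf _ _ (fun t ht => ?_) fun p => by rw [h]
  have : ∑ p, (if t = f p then (1 : ℂ) else 0) • A p = 0 :=
    Finset.sum_eq_zero fun p _ => by rw [if_neg fun h => ht ⟨p, h.symm⟩, zero_smul]
  rw [this, Matrix.mul_zero]

theorem sum_slice_gram {ι X : Type*} [Fintype ι] {dim mult : ι → ℕ}
    (U : Matrix (Σ l, Fin (dim l) × Fin (mult l)) X ℂ) :
    ∑ l, ∑ a, (Matrix.of fun u x => U ⟨l, u, a⟩ x)ᴴ * (Matrix.of fun u x => U ⟨l, u, a⟩ x) =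
      Uᴴ * U := by
  ext x y
  simp only [Matrix.sum_apply, Matrix.mul_apply, Matrix.conjTranspose_apply, Matrix.of_apply,
    Fintype.sum_sigma, Fintype.sum_prod_type]
  exact Finset.sum_congr rfl fun l _ => Finset.sum_comm

/-- Decompose the inputs and the outputs into irreducibles and store the multiplicity indices in the
additional memory. The threshold M comes before m because the memory dimensions are chosen
afterwards, from all the thresholds. -/
theorem exists_equivariant_isometry (L : Irreps ρ) (K : Irreps σ) (k : ℕ) :
    ∃ M : ℕ, ∀ m : ℕ → ℕ, M ≤ m k →
      ∃ F : Matrix (Mem L K m k) ((∀ j : Fin k, I j) × (∀ j : Fin k, O j)) ℂ,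
        Fᴴ * F = 1 ∧ IsEquivariant F := by
  obtain ⟨c, U, hU, hUi⟩ := L.exists_full_decomposition k
  obtain ⟨d, U', hU', hUi'⟩ := K.exists_full_decomposition k
  refine ⟨Fintype.card ((Σ μ, Fin (d μ)) × (Σ l, Fin (c l))), fun m hm => ?_⟩
  -- Each copy of each pair of irreducibles gets its own basis state of the additional memory.
  obtain ⟨e⟩ := Function.Embedding.nonempty_of_card_le (β := Fin (m k))
    (α := (Σ μ, Fin (d μ)) × (Σ l, Fin (c l))) (by rwa [Fintype.card_fin])
  let S : ∀ l, Fin (c l) → Matrix (Fin (L.dim k l)) (∀ j : Fin k, I j) ℂ :=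
    fun l a => Matrix.of fun u x => U ⟨l, u, a⟩ x
  let S' : ∀ μ, Fin (d μ) → Matrix (Fin (K.dim k μ)) (∀ j : Fin k, O j) ℂ :=
    fun μ b => Matrix.of fun v y => U' ⟨μ, v, b⟩ y
  let F : Matrix (Mem L K m k) ((∀ j : Fin k, I j) × (∀ j : Fin k, O j)) ℂ :=
    Matrix.of fun q x => ∑ p : Fin (d q.1.1) × Fin (c q.2.2.1),
      (if q.2.1 = e (⟨q.1.1, p.1⟩, ⟨q.2.2.1, p.2⟩) then (1 : ℂ) else 0) *
        (S q.2.2.1 p.2 ⊗ₖ S' q.1.1 p.1) (q.2.2.2, q.1.2) x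
  have hF : ∀ μ t l, memSlice F μ t l = ∑ p : Fin (d μ) × Fin (c l),
      (if t = e (⟨μ, p.1⟩, ⟨l, p.2⟩) then (1 : ℂ) else 0) • (S l p.2 ⊗ₖ S' μ p.1) := by
    intro μ t l
    ext q x
    simp only [memSlice, F, Matrix.of_apply, Matrix.sum_apply, Matrix.smul_apply, smul_eq_mul]
  refine ⟨F, ?_, fun μ t l => ?_⟩
  · rw [← sum_memSlice]
    have h1 : ∀ μ l, ∑ t, (memSlice F μ t l)ᴴ * memSlice F μ t l =
        ∑ b, ∑ a, ((S l a)ᴴ * S l a) ⊗ₖ ((S' μ b)ᴴ * S' μ b) := by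
      intro μ l
      simp only [hF]
      rw [sum_indicator_gram (f := fun p : Fin (d μ) × Fin (c l) =>
        e (⟨μ, p.1⟩, ⟨l, p.2⟩)), Fintype.sum_prod_type]
      · simp only [Matrix.conjTranspose_kronecker, ← Matrix.mul_kronecker_mul]
      · intro p q h
        have := e.injective h
        simp only [Prod.mk.injEq, Sigma.mk.injEq, heq_eq_eq, true_and] at this
        exact Prod.ext this.1 this.2
    calc _ = ∑ μ, ∑ l, ∑ b, ∑ a, ((S l a)ᴴ * S l a) ⊗ₖ ((S' μ b)ᴴ * S' μ b) := by
          refine Finset.sum_congr rfl fun μ _ => ?_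
          rw [Finset.sum_comm]
          exact Finset.sum_congr rfl fun l _ => h1 μ l
      _ = (∑ l, ∑ a, (S l a)ᴴ * S l a) ⊗ₖ (∑ μ, ∑ b, (S' μ b)ᴴ * S' μ b) := by
          ext x y
          simp only [Matrix.sum_apply, Matrix.kroneckerMap_apply, Finset.sum_mul_sum]
          rw [Finset.sum_comm]
          refine Finset.sum_congr rfl fun l _ => ?_
          refine Finset.sum_congr rfl fun μ _ => ?_
          exact Finset.sum_comm
      _ = 1 := by
          rw [sum_slice_gram U, sum_slice_gram U', hU.1, hU'.1, Matrix.one_kronecker_one]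
  · rw [hF]
    refine Intertwines.sum _ fun q => Intertwines.smul ?_ _
    intro p
    have h1 := hUi.slice l q.2 p.1
    have h2 := hUi'.slice μ q.1 p.2
    simp only [combRep, pairRep, ← Matrix.mul_kronecker_mul]
    rw [← h1, ← h2]

/-- The square root of B commutes with everything that commutes with B, so composing it with an
equivariant isometry keeps both the Gram matrix and the equivariance. -/
theorem exists_equivariant_purification (L : Irreps ρ) (K : Irreps σ) (k : ℕ) :
    ∃ M : ℕ, ∀ m : ℕ → ℕ, M ≤ m k →
      ∀ B : Matrix ((∀ j : Fin k, I j) × (∀ j : Fin k, O j))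
        ((∀ j : Fin k, I j) × (∀ j : Fin k, O j)) ℂ, B.PosSemidef →
        (∀ p, Commute B (combRep ρ σ k p)) →
        ∃ R : Matrix (Mem L K m k) ((∀ j : Fin k, I j) × (∀ j : Fin k, O j)) ℂ,
          Rᴴ * R = B ∧ IsEquivariant R := by
  obtain ⟨M, hM⟩ := exists_equivariant_isometry L K k
  refine ⟨M, fun m hm B hB hcomm => ?_⟩
  obtain ⟨F, hF, hFi⟩ := hM m hm
  obtain ⟨S, hS, hSc⟩ := exists_commuting_sqrt hB
  refine ⟨F * S, ?_, fun μ t l => ?_⟩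
  · rw [conjTranspose_mul, Matrix.mul_assoc, ← Matrix.mul_assoc Fᴴ, hF, Matrix.one_mul, hS]
  · exact (hFi μ t l).mul fun p => (hSc _ (hcomm p)).eq

end Purification

/-! ### A step built from isometries is an isometry. -/

section StepIsometry

theorem sum_star_mul_isometry {P R B₁ B₂ : Type*} [Fintype P] [Fintype B₁] [Fintype B₂]
    [DecidableEq R] {M : Matrix P R ℂ} (hM : Mᴴ * M = 1) (r₁ : B₁ → R) (r₂ : B₂ → R)
    (y₁ : B₁ → ℂ) (y₂ : B₂ → ℂ) :
    ∑ p, star (∑ b, M p (r₁ b) * y₁ b) * (∑ b, M p (r₂ b) * y₂ b) =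
      ∑ b, ∑ b', if r₁ b = r₂ b' then star (y₁ b) * y₂ b' else 0 := by
  have h : ∀ b b', ∑ p, star (M p (r₁ b)) * M p (r₂ b') = if r₁ b = r₂ b' then 1 else 0 :=
    fun b b' => by
      rw [← Matrix.one_apply, ← hM]
      rfl
  calc _ = ∑ b, ∑ b', ∑ p, (star (M p (r₁ b)) * M p (r₂ b')) * (star (y₁ b) * y₂ b') := by
        simp only [star_sum, Finset.sum_mul_sum, star_mul']
        rw [Finset.sum_comm]
        refine Finset.sum_congr rfl fun b _ => ?_
        rw [Finset.sum_comm]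
        exact Finset.sum_congr rfl fun b' _ => Finset.sum_congr rfl fun p _ => by ring
    _ = _ := by
        refine Finset.sum_congr rfl fun b _ => Finset.sum_congr rfl fun b' _ => ?_
        rw [← Finset.sum_mul, h]
        split_ifs <;> simp

theorem sum_prod_sigma_reorder {A B C D : Type*} {F : B → Type*} [Fintype A] [Fintype B]
    [Fintype C] [Fintype D] [∀ b, Fintype (F b)] (f : A × (Σ b, F b) × C × D → ℂ) :
    ∑ p, f p = ∑ d, ∑ b, ∑ c, ∑ r : F b × A, f (r.2, ⟨b, r.1⟩, c, d) := by
  let e : A × (Σ b, F b) × C × D ≃ D × (Σ b, C × F b × A) :=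
    { toFun := fun p => (p.2.2.2, ⟨p.2.1.1, p.2.2.1, p.2.1.2, p.1⟩)
      invFun := fun p => (p.2.2.2.2, ⟨p.2.1, p.2.2.2.1⟩, p.2.2.1, p.1)
      left_inv := fun _ => rfl
      right_inv := fun _ => rfl }
  rw [Fintype.sum_equiv e f (fun p => f (e.symm p)) (fun p => by rw [Equiv.symm_apply_apply]),
    Fintype.sum_prod_type]
  refine Finset.sum_congr rfl fun d _ => ?_
  rw [Fintype.sum_sigma]
  exact Finset.sum_congr rfl fun b _ => Fintype.sum_prod_type _

variable {G H : Type*} [Group G] [Group H] {I O : ℕ → Type*}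
  [∀ i, Fintype (I i)] [∀ i, DecidableEq (I i)] [∀ i, Fintype (O i)] [∀ i, DecidableEq (O i)]
  {ρ : ∀ i, G →* Matrix.unitaryGroup (I i) ℂ} {σ : ∀ i, H →* Matrix.unitaryGroup (O i) ℂ}
  {L : Irreps ρ} {K : Irreps σ} (T : CGTransforms L) (D : DualCGTransforms K) {m : ℕ → ℕ}

/-- The three controlled factors are removed from the outside inwards: D D† = 1 makes the adjoint
dual transform isometric on the labelled summands, then V† V = 1, then unitarity of the CG
transform. The controlling labels are untouched by the factors that they control. -/
theorem isIsometry_stepOp (V : MultOps T D m) (i : ℕ) (hV : ∀ l' μ, IsIsometry (V i l' μ)) :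
    IsIsometry (stepOp T D V i) := by
  let Z : ∀ (μ' : Fin (K.num (i + 1))) (t' : Fin (m (i + 1)))
      (q : Σ l' : Fin (L.num (i + 1)), Fin (L.dim (i + 1) l')) (μ : Fin (K.num i))
      (_ : Fin (D.mult i μ μ')) (_ : Fin (m i)) (p : Σ l : Fin (L.num i), Fin (L.dim i l))
      (_ : I i), ℂ := fun μ' t' q μ b t p x =>
    ∑ a : Fin (T.mult i p.1 q.1), V i q.1 μ (⟨μ', b⟩, t') (t, ⟨p.1, a⟩) *
      T.mat i p.1 ⟨q.1, q.2, a⟩ (p.2, x)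
  have hW : ∀ o μ' v' t' q x μ v t p,
      stepOp T D V i (o, ⟨μ', v'⟩, t', q) (x, ⟨μ, v⟩, t, p) =
        ∑ b, (D.mat i μ')ᴴ (v', o) (Sum.inl ⟨μ, v, b⟩) * Z μ' t' q μ b t p x := by
    intro o μ' v' t' q x μ v t p
    simp only [stepOp, Matrix.of_apply, Z, Finset.mul_sum]
    rw [Finset.sum_comm]
    simp only [mul_assoc]
  ext ⟨x₁, ⟨μ₁, v₁⟩, t₁, p₁⟩ ⟨x₂, ⟨μ₂, v₂⟩, t₂, p₂⟩
  have e1 : ((stepOp T D V i)ᴴ * stepOp T D V i) (x₁, ⟨μ₁, v₁⟩, t₁, p₁) (x₂, ⟨μ₂, v₂⟩, t₂, p₂) =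
      ∑ q, ∑ μ', ∑ t', ∑ b, ∑ b',
        if (Sum.inl ⟨μ₁, v₁, b⟩ : (Σ l : Fin (K.num i), Fin (K.dim i l) × Fin (D.mult i l μ')) ⊕
          Fin (D.rest i μ')) = Sum.inl ⟨μ₂, v₂, b'⟩ then
          star (Z μ' t' q μ₁ b t₁ p₁ x₁) * Z μ' t' q μ₂ b' t₂ p₂ x₂ else 0 := by
    rw [Matrix.mul_apply]
    refine (sum_prod_sigma_reorder _).trans ?_
    refine Finset.sum_congr rfl fun q _ => Finset.sum_congr rfl fun μ' _ =>
      Finset.sum_congr rfl fun t' _ => ?_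
    simp only [Matrix.conjTranspose_apply (stepOp T D V i), hW]
    exact sum_star_mul_isometry (by rw [conjTranspose_conjTranspose, (D.unitary i μ').2])
      _ _ _ _
  rw [e1]
  by_cases hμ : μ₁ = μ₂
  swap
  · simp [hμ]
  subst hμ
  by_cases hv : v₁ = v₂
  swap
  · simp [hv]
  subst hv
  obtain ⟨l₁, u₁⟩ := p₁
  obtain ⟨l₂, u₂⟩ := p₂
  have e2 : ∀ q : Σ l' : Fin (L.num (i + 1)), Fin (L.dim (i + 1) l'),
      ∑ μ', ∑ t', ∑ b : Fin (D.mult i μ₁ μ'),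
        star (Z μ' t' q μ₁ b t₁ ⟨l₁, u₁⟩ x₁) * Z μ' t' q μ₁ b t₂ ⟨l₂, u₂⟩ x₂ =
      ∑ a, ∑ a', if (t₁, (⟨l₁, a⟩ : Σ l : Fin (L.num i), Fin (T.mult i l q.1))) = (t₂, ⟨l₂, a'⟩)
        then star (T.mat i l₁ ⟨q.1, q.2, a⟩ (u₁, x₁)) * T.mat i l₂ ⟨q.1, q.2, a'⟩ (u₂, x₂)
        else 0 := by
    intro q
    rw [← sum_star_mul_isometry (hV q.1 μ₁), Fintype.sum_prod_type, Fintype.sum_sigma]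
    exact Finset.sum_congr rfl fun μ' _ => Finset.sum_comm
  simp only [Sum.inl.injEq, Sigma.mk.injEq, heq_eq_eq, Prod.mk.injEq, true_and,
    Finset.sum_ite_eq, Finset.mem_univ, if_true, e2]
  by_cases ht : t₁ = t₂
  swap
  · simp [ht]
  subst ht
  by_cases hl : l₁ = l₂
  swap
  · simp [hl]
  subst hl
  have e3 := congrFun (congrFun (T.unitary i l₁).1 (u₁, x₁)) (u₂, x₂)
  rw [Matrix.mul_apply, Fintype.sum_sigma] at e3
  simp only [Prod.mk.injEq, Sigma.mk.injEq, heq_eq_eq, true_and, Finset.sum_ite_eq, Finset.mem_univ, if_true]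
  rw [Fintype.sum_sigma]
  simp only [Fintype.sum_prod_type, Matrix.conjTranspose_apply] at e3
  rw [e3]
  simp only [Matrix.one_apply, Prod.mk.injEq, Sigma.mk.injEq, heq_eq_eq, true_and]
  exact if_congr and_comm rfl rfl

end StepIsometry

/-! ### The trivial representation at level zero. -/

section LevelZero

variable {G : Type*} [Group G] {I : ℕ → Type*} [∀ i, Fintype (I i)] [∀ i, DecidableEq (I i)]
  {ρ : ∀ i, G →* Matrix.unitaryGroup (I i) ℂ}

theorem tensorRep_zero (ρ : ∀ i, G →* Matrix.unitaryGroup (I i) ℂ) (g : G) :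
    tensorRep ρ 0 g = 1 := by
  ext x y
  rw [Subsingleton.elim y x, Matrix.one_apply_eq]
  simp [tensorRep]

/-- The representation is one-dimensional and has a nonzero intertwiner to the empty tensor product,
on which the group acts trivially. -/
theorem Irreps.repMat_level_zero (L : Irreps ρ) (l : Fin (L.num 0)) (g : G) :
    repMat (L.rep 0 l) g = 1 := by
  obtain ⟨a, ha⟩ := L.exists_unique_level_zero
  have hs : ∀ k k' : Fin (L.dim 0 l), k = k' := fun k k' =>
    eq_of_heq (Sigma.mk.inj ((ha ⟨l, k⟩).trans (ha ⟨l, k'⟩).symm)).2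
  obtain ⟨T, hT0, hT⟩ := L.occurs 0 l
  ext k k'
  obtain rfl := hs k k'
  have h1 : ∃ x, T x k ≠ 0 := by
    by_contra! h
    refine hT0 (Matrix.ext fun x k' => ?_)
    rw [← hs k k']
    exact h x
  obtain ⟨x, hx⟩ := h1
  have h2 := congrFun (congrFun (hT g) x) k
  rw [tensorRep_zero, Matrix.one_mul, Matrix.mul_apply, Finset.sum_eq_single k
    (fun k' _ h => absurd (hs k' k) h) (by simp)] at h2
  rw [Matrix.one_apply_eq]
  exact mul_left_cancel₀ hx (h2.trans (mul_one _).symm)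

end LevelZero

/-! ### The two operators compared in one step. -/

section Step

variable {G H : Type*} [Group G] [Group H] {I O : ℕ → Type*}
  [∀ i, Fintype (I i)] [∀ i, DecidableEq (I i)] [∀ i, Fintype (O i)] [∀ i, DecidableEq (O i)]
  {ρ : ∀ i, G →* Matrix.unitaryGroup (I i) ℂ} {σ : ∀ i, H →* Matrix.unitaryGroup (O i) ℂ}
  {L : Irreps ρ} {K : Irreps σ} (T : CGTransforms L) (D : DualCGTransforms K) {m : ℕ → ℕ}

/-- An intertwiner from `σ 0 ⊗ ⋯ ⊗ σ (i - 1)` to a representation in which no label of level `i`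
occurs vanishes. -/
theorem DualCGTransforms.eq_zero_of_intertwines_rest (i : ℕ) (μ' : Fin (K.num (i + 1)))
    {S : Matrix (Fin (D.rest i μ')) (∀ j : Fin i, O j) ℂ}
    (hS : Intertwines S (tensorRep σ i) (repMat (D.restRep i μ'))) : S = 0 := by
  obtain ⟨c, U, hU, hUi⟩ := K.exists_full_decomposition i
  have h : S * Uᴴ = 0 := by
    ext r ⟨l, v, b⟩
    by_contra hne
    have h1 := hS.mul ((hUi.slice l b).conjTranspose (isStarRep_tensorRep σ i)
      (isStarRep_repMat _))
    refine D.rest_disjoint i μ' l ⟨_, fun h0 => hne ?_, h1⟩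
    exact congrFun (congrFun h0 r) v
  rw [← Matrix.mul_one S, ← hU.1, ← Matrix.mul_assoc, h, Matrix.zero_mul]

/-- The component of the Clebsch–Gordan transform for given labels and multiplicity. -/
def cgSlice (i : ℕ) (l : Fin (L.num i)) (l' : Fin (L.num (i + 1))) (a : Fin (T.mult i l l')) :
    Matrix (Fin (L.dim (i + 1) l')) (Fin (L.dim i l) × I i) ℂ :=
  Matrix.of fun u p => T.mat i l ⟨l', u, a⟩ p

/-- The component of the dual Clebsch–Gordan transform for given labels and multiplicity. -/
def dualSlice (i : ℕ) (μ : Fin (K.num i)) (μ' : Fin (K.num (i + 1))) (b : Fin (D.mult i μ μ')) :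
    Matrix (Fin (K.dim i μ)) (Fin (K.dim (i + 1) μ') × O i) ℂ :=
  Matrix.of fun v p => D.mat i μ' (Sum.inl ⟨μ, v, b⟩) p

/-- The component of the dual Clebsch–Gordan transform outside of the labels. -/
def dualRest (i : ℕ) (μ' : Fin (K.num (i + 1))) :
    Matrix (Fin (D.rest i μ')) (Fin (K.dim (i + 1) μ') × O i) ℂ :=
  Matrix.of fun r p => D.mat i μ' (Sum.inr r) p

theorem sum_cgSlice (i : ℕ) (l : Fin (L.num i)) :
    ∑ l', ∑ a, (cgSlice T i l l' a)ᴴ * cgSlice T i l l' a = 1 := by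
  rw [← (T.unitary i l).1]
  exact sum_slice_gram (T.mat i l)

theorem sum_dualSlice (i : ℕ) (μ' : Fin (K.num (i + 1))) :
    ∑ μ, ∑ b, (dualSlice D i μ μ' b)ᴴ * dualSlice D i μ μ' b +
      (dualRest D i μ')ᴴ * dualRest D i μ' = 1 := by
  rw [← (D.unitary i μ').1]
  have h := sum_slice_gram (Matrix.of fun p x => D.mat i μ' (Sum.inl p) x)
  ext x y
  have h' := congrFun (congrFun h x) y
  rw [Matrix.mul_apply, Fintype.sum_sum_type, Matrix.add_apply]
  exact congrArg₂ (· + ·) h' rfl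

variable {k : ℕ}

/-- Exchange the last two factors of a triple product. -/
def prodRightComm (α β γ : Type*) : (α × β) × γ ≃ (α × γ) × β where
  toFun p := ((p.1.1, p.2), p.1.2)
  invFun p := ((p.1.1, p.2), p.1.2)
  left_inv _ := rfl
  right_inv _ := rfl

/-- The operator `R ⊗ 1` on the next input, for given labels and state of the additional memory. -/
def inputSlice (R : Matrix (Mem L K m k) ((∀ j : Fin k, I j) × (∀ j : Fin k, O j)) ℂ)
    (μ : Fin (K.num k)) (t : Fin (m k)) (l : Fin (L.num k)) :
    Matrix ((Fin (L.dim k l) × I k) × Fin (K.dim k μ))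
      (((∀ j : Fin k, I j) × (∀ j : Fin k, O j)) × I k) ℂ :=
  (memSlice R μ t l ⊗ₖ (1 : Matrix (I k) (I k) ℂ)).submatrix
    (prodRightComm _ _ _) (Equiv.refl _)

/-- The operator `R` with its last output bent, for given labels and state of the additional
memory. -/
def outputSlice
    (R : Matrix (Mem L K m (k + 1)) ((∀ j : Fin (k + 1), I j) × (∀ j : Fin (k + 1), O j)) ℂ)
    (μ' : Fin (K.num (k + 1))) (t' : Fin (m (k + 1))) (l' : Fin (L.num (k + 1))) :
    Matrix (Fin (L.dim (k + 1) l') × (Fin (K.dim (k + 1) μ') × O k))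
      (((∀ j : Fin k, I j) × (∀ j : Fin k, O j)) × I k) ℂ :=
  (bend ((memSlice R μ' t' l').submatrix (Equiv.refl _) (combEquiv I O k))).submatrix
    (Equiv.prodAssoc _ _ _).symm (Equiv.refl _)

theorem inputSlice_intertwines
    {R : Matrix (Mem L K m k) ((∀ j : Fin k, I j) × (∀ j : Fin k, O j)) ℂ} (hR : IsEquivariant R)
    (μ : Fin (K.num k)) (t : Fin (m k)) (l : Fin (L.num k)) :
    Intertwines (inputSlice R μ t l) (fun p => combRep ρ σ k p ⊗ₖ repMat (ρ k) p.1)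
      (fun p => (repMat (L.rep k l) p.1 ⊗ₖ repMat (ρ k) p.1) ⊗ₖ repMat (K.rep k μ) p.2) := by
  have h := ((hR μ t l).kronecker (Intertwines.one fun p : G × H => repMat (ρ k) p.1)).submatrix
    (prodRightComm _ _ _) (Equiv.refl _)
  intro p
  refine (h p).trans ?_
  congr 1
  ext ⟨⟨u, x⟩, v⟩ ⟨⟨u', x'⟩, v'⟩
  simp only [pairRep, Matrix.submatrix_apply, Matrix.kroneckerMap_apply,
    prodRightComm, Equiv.coe_fn_mk]
  ring

theorem outputSlice_intertwines
    {R : Matrix (Mem L K m (k + 1)) ((∀ j : Fin (k + 1), I j) × (∀ j : Fin (k + 1), O j)) ℂ}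
    (hR : IsEquivariant R)
    (μ' : Fin (K.num (k + 1))) (t' : Fin (m (k + 1))) (l' : Fin (L.num (k + 1))) :
    Intertwines (outputSlice R μ' t' l') (fun p => combRep ρ σ k p ⊗ₖ repMat (ρ k) p.1)
      (fun p => repMat (L.rep (k + 1) l') p.1 ⊗ₖ
        (repMat (K.rep (k + 1) μ') p.2 ⊗ₖ conjMat (repMat (σ k) p.2))) := by
  have h1 := (hR μ' t' l').submatrix (Equiv.refl _) (combEquiv I O k)
  simp only [combRep_succ] at h1
  have h2 := (h1.bend fun p => repMat_mul_conjTranspose (σ k) p.2).submatrix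
    (Equiv.prodAssoc _ _ _).symm (Equiv.refl _)
  intro p
  refine (h2 p).trans ?_
  congr 1
  ext ⟨u, v, y⟩ ⟨u', v', y'⟩
  simp [pairRep, Matrix.submatrix_apply, Matrix.kroneckerMap_apply, mul_assoc]

/-- As a representation of H the source is a multiple of σ_0 ⊗ ⋯ ⊗ σ_{k-1}, all of whose
irreducibles are labels of level k, and none of these occurs in the remainder. -/
theorem one_kronecker_dualRest_mul_outputSlice
    {R : Matrix (Mem L K m (k + 1)) ((∀ j : Fin (k + 1), I j) × (∀ j : Fin (k + 1), O j)) ℂ}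
    (hR : IsEquivariant R)
    (μ' : Fin (K.num (k + 1))) (t' : Fin (m (k + 1))) (l' : Fin (L.num (k + 1))) :
    ((1 : Matrix (Fin (L.dim (k + 1) l')) (Fin (L.dim (k + 1) l')) ℂ) ⊗ₖ dualRest D k μ') *
      outputSlice R μ' t' l' = 0 := by
  have h1 : Intertwines (dualRest D k μ')
      (fun h => repMat (K.rep (k + 1) μ') h ⊗ₖ conjMat (repMat (σ k) h))
      (repMat (D.restRep k μ')) := (D.intertwines k μ').slice_inr
  have h2 : Intertwines ((1 : Matrix (Fin (L.dim (k + 1) l')) (Fin (L.dim (k + 1) l')) ℂ) ⊗ₖ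
      dualRest D k μ')
      (fun p : G × H => repMat (L.rep (k + 1) l') p.1 ⊗ₖ
        (repMat (K.rep (k + 1) μ') p.2 ⊗ₖ conjMat (repMat (σ k) p.2)))
      (fun p => repMat (L.rep (k + 1) l') p.1 ⊗ₖ repMat (D.restRep k μ') p.2) :=
    (Intertwines.one fun p : G × H => repMat (L.rep (k + 1) l') p.1).kronecker
      fun p : G × H => h1 p.2
  -- The factors are reordered so that everything on which G acts stands first; the slice for H can
  -- then be taken.
  have h3 := (h2.mul (outputSlice_intertwines hR μ' t' l')).submatrix (Equiv.refl _)
    (prodRightComm (∀ j : Fin k, I j) (I k) (∀ j : Fin k, O j))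
  have h4 : Intertwines ((((1 : Matrix (Fin (L.dim (k + 1) l')) (Fin (L.dim (k + 1) l')) ℂ) ⊗ₖ
      dualRest D k μ') * outputSlice R μ' t' l').submatrix (Equiv.refl _)
        (prodRightComm (∀ j : Fin k, I j) (I k) (∀ j : Fin k, O j)))
      (fun p : G × H => repMat (kroneckerHom (tensorHom ρ k) (ρ k)) p.1 ⊗ₖ
        repMat (tensorHom σ k) p.2)
      (fun p => repMat (L.rep (k + 1) l') p.1 ⊗ₖ repMat (D.restRep k μ') p.2) := by
    intro p
    refine Eq.trans ?_ (h3 p)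
    congr 1
    ext ⟨⟨u, x⟩, o⟩ ⟨⟨u', x'⟩, o'⟩
    change (tensorRep ρ k p.1 u u' * repMat (ρ k) p.1 x x') * tensorRep σ k p.2 o o' =
      (tensorRep ρ k p.1 u u' * tensorRep σ k p.2 o o') * repMat (ρ k) p.1 x x'
    ring
  ext ⟨w, r⟩ ⟨⟨u, o⟩, x⟩
  have h5 := D.eq_zero_of_intertwines_rest k μ' (h4.snd_slice w (u, x))
  exact congrFun (congrFun h5 r) o

theorem sum_inputSlice (R : Matrix (Mem L K m k) ((∀ j : Fin k, I j) × (∀ j : Fin k, O j)) ℂ) :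
    ∑ μ, ∑ t, ∑ l, (inputSlice R μ t l)ᴴ * inputSlice R μ t l =
      (Rᴴ * R) ⊗ₖ (1 : Matrix (I k) (I k) ℂ) := by
  have h : ∀ μ t l, (inputSlice R μ t l)ᴴ * inputSlice R μ t l =
      ((memSlice R μ t l)ᴴ * memSlice R μ t l) ⊗ₖ (1 : Matrix (I k) (I k) ℂ) := by
    intro μ t l
    rw [inputSlice, Matrix.conjTranspose_submatrix, Matrix.submatrix_mul_equiv,
      Matrix.conjTranspose_kronecker, ← Matrix.mul_kronecker_mul, conjTranspose_one,
      Matrix.one_mul]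
    rfl
  simp only [h]
  rw [← sum_memSlice]
  ext p q
  simp only [Matrix.sum_apply, Matrix.kroneckerMap_apply, Finset.sum_mul]

/-- Once bent, the last output is an index on the target side, so the Gram matrix sums over it: this
is the partial trace. -/
theorem sum_outputSlice
    (R : Matrix (Mem L K m (k + 1)) ((∀ j : Fin (k + 1), I j) × (∀ j : Fin (k + 1), O j)) ℂ) :
    ∑ μ', ∑ t', ∑ l', (outputSlice R μ' t' l')ᴴ * outputSlice R μ' t' l' =
      ptrace ((Rᴴ * R).submatrix (combEquiv I O k) (combEquiv I O k)) := by
  have h : ∀ μ' t' l', (outputSlice R μ' t' l')ᴴ * outputSlice R μ' t' l' =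
      ptrace (((memSlice R μ' t' l')ᴴ * memSlice R μ' t' l').submatrix
        (combEquiv I O k) (combEquiv I O k)) := by
    intro μ' t' l'
    ext p q
    simp only [outputSlice, bend, ptrace, Matrix.mul_apply, Matrix.conjTranspose_apply,
      Matrix.submatrix_apply, Matrix.of_apply, Fintype.sum_prod_type]
    conv_rhs => rw [Finset.sum_comm]
    exact Finset.sum_congr rfl fun u _ => Finset.sum_comm
  simp only [h]
  rw [← sum_memSlice]
  ext p q
  simp only [Matrix.sum_apply, ptrace, Matrix.of_apply, Matrix.submatrix_apply]
  conv_rhs => rw [Finset.sum_comm]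
  refine Finset.sum_congr rfl fun μ' _ => ?_
  conv_rhs => rw [Finset.sum_comm]
  exact Finset.sum_congr rfl fun t' _ => Finset.sum_comm.symm

end Step

/-! ### Extending a purification by one step of the circuit. -/

section StepExistence

variable {G H : Type*} [Group G] [Group H] {I O : ℕ → Type*}
  [∀ i, Fintype (I i)] [∀ i, DecidableEq (I i)] [∀ i, Fintype (O i)] [∀ i, DecidableEq (O i)]
  {ρ : ∀ i, G →* Matrix.unitaryGroup (I i) ℂ} {σ : ∀ i, H →* Matrix.unitaryGroup (O i) ℂ}
  {L : Irreps ρ} {K : Irreps σ} (T : CGTransforms L) (D : DualCGTransforms K) {m : ℕ → ℕ} {k : ℕ}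

theorem sum_kronecker {ι A B C E : Type*} (s : Finset ι) (f : ι → Matrix A B ℂ)
    (M : Matrix C E ℂ) : (∑ i ∈ s, f i) ⊗ₖ M = ∑ i ∈ s, f i ⊗ₖ M := by
  ext p q
  simp only [Matrix.sum_apply, Matrix.kroneckerMap_apply, Finset.sum_mul]

theorem kronecker_sum {ι A B C E : Type*} (s : Finset ι) (f : ι → Matrix A B ℂ)
    (M : Matrix C E ℂ) : M ⊗ₖ (∑ i ∈ s, f i) = ∑ i ∈ s, M ⊗ₖ f i := by
  ext p q
  simp only [Matrix.sum_apply, Matrix.kroneckerMap_apply, Finset.mul_sum]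

theorem isStarRep_pairRep {k i : ℕ} (l : Fin (L.num k)) (μ : Fin (K.num i)) :
    IsStarRep (pairRep L K l μ) := by
  intro p
  simp only [pairRep, Matrix.conjTranspose_kronecker]
  rw [isStarRep_repMat, isStarRep_repMat]
  rfl

/-- The component of the Clebsch–Gordan transform of `R ⊗ 1` for given labels, as an intertwiner to
`V_{l'} ⊗ V_μ`. -/
def inputComponent (R : Matrix (Mem L K m k) ((∀ j : Fin k, I j) × (∀ j : Fin k, O j)) ℂ)
    (l' : Fin (L.num (k + 1))) (μ : Fin (K.num k))
    (n : Fin (m k) × (Σ l : Fin (L.num k), Fin (T.mult k l l'))) :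
    Matrix (Fin (L.dim (k + 1) l') × Fin (K.dim k μ))
      (((∀ j : Fin k, I j) × (∀ j : Fin k, O j)) × I k) ℂ :=
  (cgSlice T k n.2.1 l' n.2.2 ⊗ₖ (1 : Matrix (Fin (K.dim k μ)) (Fin (K.dim k μ)) ℂ)) *
    inputSlice R μ n.1 n.2.1

/-- The component of the dual Clebsch–Gordan transform of `R` for given labels, as an intertwiner to
`V_{l'} ⊗ V_μ`. -/
def outputComponent
    (R : Matrix (Mem L K m (k + 1)) ((∀ j : Fin (k + 1), I j) × (∀ j : Fin (k + 1), O j)) ℂ)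
    (l' : Fin (L.num (k + 1))) (μ : Fin (K.num k))
    (n : (Σ μ' : Fin (K.num (k + 1)), Fin (D.mult k μ μ')) × Fin (m (k + 1))) :
    Matrix (Fin (L.dim (k + 1) l') × Fin (K.dim k μ))
      (((∀ j : Fin k, I j) × (∀ j : Fin k, O j)) × I k) ℂ :=
  ((1 : Matrix (Fin (L.dim (k + 1) l')) (Fin (L.dim (k + 1) l')) ℂ) ⊗ₖ
    dualSlice D k μ n.1.1 n.1.2) * outputSlice R n.1.1 n.2 l'

theorem inputComponent_intertwines
    {R : Matrix (Mem L K m k) ((∀ j : Fin k, I j) × (∀ j : Fin k, O j)) ℂ} (hR : IsEquivariant R)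
    (l' : Fin (L.num (k + 1))) (μ : Fin (K.num k))
    (n : Fin (m k) × (Σ l : Fin (L.num k), Fin (T.mult k l l'))) :
    Intertwines (inputComponent T R l' μ n) (fun p => combRep ρ σ k p ⊗ₖ repMat (ρ k) p.1)
      (pairRep L K l' μ) := by
  have h1 : Intertwines (cgSlice T k n.2.1 l' n.2.2)
      (fun g => repMat (L.rep k n.2.1) g ⊗ₖ repMat (ρ k) g) (repMat (L.rep (k + 1) l')) :=
    (T.intertwines k n.2.1).slice l' n.2.2
  have h2 : Intertwines (cgSlice T k n.2.1 l' n.2.2)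
      (fun p : G × H => repMat (L.rep k n.2.1) p.1 ⊗ₖ repMat (ρ k) p.1)
      (fun p => repMat (L.rep (k + 1) l') p.1) := fun p => h1 p.1
  exact (h2.kronecker (Intertwines.one fun p : G × H => repMat (K.rep k μ) p.2)).mul
    (inputSlice_intertwines hR μ n.1 n.2.1)

theorem outputComponent_intertwines
    {R : Matrix (Mem L K m (k + 1)) ((∀ j : Fin (k + 1), I j) × (∀ j : Fin (k + 1), O j)) ℂ}
    (hR : IsEquivariant R) (l' : Fin (L.num (k + 1))) (μ : Fin (K.num k))
    (n : (Σ μ' : Fin (K.num (k + 1)), Fin (D.mult k μ μ')) × Fin (m (k + 1))) :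
    Intertwines (outputComponent D R l' μ n) (fun p => combRep ρ σ k p ⊗ₖ repMat (ρ k) p.1)
      (pairRep L K l' μ) := by
  have h1 : Intertwines (dualSlice D k μ n.1.1 n.1.2)
      (fun h => repMat (K.rep (k + 1) n.1.1) h ⊗ₖ conjMat (repMat (σ k) h))
      (repMat (K.rep k μ)) := (D.intertwines k n.1.1).slice_inl μ n.1.2
  have h2 : Intertwines (dualSlice D k μ n.1.1 n.1.2)
      (fun p : G × H => repMat (K.rep (k + 1) n.1.1) p.2 ⊗ₖ conjMat (repMat (σ k) p.2))
      (fun p => repMat (K.rep k μ) p.2) := fun p => h1 p.2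
  exact ((Intertwines.one fun p : G × H => repMat (L.rep (k + 1) l') p.1).kronecker h2).mul
    (outputSlice_intertwines hR n.1.1 n.2 l')

theorem sum_inputComponent
    (R : Matrix (Mem L K m k) ((∀ j : Fin k, I j) × (∀ j : Fin k, O j)) ℂ) :
    ∑ q : Fin (L.num (k + 1)) × Fin (K.num k), ∑ n,
      (inputComponent T R q.1 q.2 n)ᴴ * inputComponent T R q.1 q.2 n =
      (Rᴴ * R) ⊗ₖ (1 : Matrix (I k) (I k) ℂ) := by
  rw [← sum_inputSlice, Fintype.sum_prod_type, Finset.sum_comm]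
  refine Finset.sum_congr rfl fun μ _ => ?_
  simp only [Fintype.sum_prod_type, Fintype.sum_sigma]
  rw [Finset.sum_comm]
  refine Finset.sum_congr rfl fun t _ => ?_
  rw [Finset.sum_comm]
  refine Finset.sum_congr rfl fun l _ => ?_
  have h : ∀ l' a, (inputComponent T R l' μ (t, ⟨l, a⟩))ᴴ * inputComponent T R l' μ (t, ⟨l, a⟩) =
      (inputSlice R μ t l)ᴴ * ((((cgSlice T k l l' a)ᴴ * cgSlice T k l l' a) ⊗ₖ
        (1 : Matrix (Fin (K.dim k μ)) (Fin (K.dim k μ)) ℂ)) * inputSlice R μ t l) := by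
    intro l' a
    simp only [inputComponent]
    rw [conjTranspose_mul, Matrix.mul_assoc, ← Matrix.mul_assoc (_ ⊗ₖ _)ᴴ,
      Matrix.conjTranspose_kronecker, ← Matrix.mul_kronecker_mul, conjTranspose_one,
      Matrix.one_mul]
  simp only [h, ← Matrix.mul_sum, ← Matrix.sum_mul, ← sum_kronecker]
  rw [sum_cgSlice, Matrix.one_kronecker_one, Matrix.one_mul]

/-- The labelled part of the dual transform alone is not isometric, but it is on the range of the
bent operator, since the part in the remainder vanishes there. -/
theorem sum_outputComponent
    {R : Matrix (Mem L K m (k + 1)) ((∀ j : Fin (k + 1), I j) × (∀ j : Fin (k + 1), O j)) ℂ}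
    (hR : IsEquivariant R) :
    ∑ q : Fin (L.num (k + 1)) × Fin (K.num k), ∑ n,
      (outputComponent D R q.1 q.2 n)ᴴ * outputComponent D R q.1 q.2 n =
      ptrace ((Rᴴ * R).submatrix (combEquiv I O k) (combEquiv I O k)) := by
  rw [← sum_outputSlice]
  have h : ∀ l' μ μ' b t', (outputComponent D R l' μ (⟨μ', b⟩, t'))ᴴ *
      outputComponent D R l' μ (⟨μ', b⟩, t') =
      (outputSlice R μ' t' l')ᴴ * (((1 : Matrix (Fin (L.dim (k + 1) l')) (Fin (L.dim (k + 1) l')) ℂ)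
        ⊗ₖ ((dualSlice D k μ μ' b)ᴴ * dualSlice D k μ μ' b)) * outputSlice R μ' t' l') := by
    intro l' μ μ' b t'
    simp only [outputComponent]
    rw [conjTranspose_mul, Matrix.mul_assoc, ← Matrix.mul_assoc (_ ⊗ₖ _)ᴴ,
      Matrix.conjTranspose_kronecker, ← Matrix.mul_kronecker_mul, conjTranspose_one,
      Matrix.one_mul]
  have h' : ∀ l' μ' t', (outputSlice R μ' t' l')ᴴ *
      (((1 : Matrix (Fin (L.dim (k + 1) l')) (Fin (L.dim (k + 1) l')) ℂ)
        ⊗ₖ (∑ μ, ∑ b, (dualSlice D k μ μ' b)ᴴ * dualSlice D k μ μ' b)) * outputSlice R μ' t' l') =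
      (outputSlice R μ' t' l')ᴴ * outputSlice R μ' t' l' := by
    intro l' μ' t'
    have h1 : ((1 : Matrix (Fin (L.dim (k + 1) l')) (Fin (L.dim (k + 1) l')) ℂ) ⊗ₖ
        ((dualRest D k μ')ᴴ * dualRest D k μ')) * outputSlice R μ' t' l' = 0 := by
      rw [← Matrix.one_mul (1 : Matrix (Fin (L.dim (k + 1) l')) _ ℂ), Matrix.mul_kronecker_mul,
        Matrix.mul_assoc, one_kronecker_dualRest_mul_outputSlice D hR, Matrix.mul_zero]
    congr 1
    rw [← add_zero (_ * outputSlice R μ' t' l'), ← h1, ← Matrix.add_mul, ← Matrix.kronecker_add,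
      sum_dualSlice, Matrix.one_kronecker_one, Matrix.one_mul]
  simp only [← h', kronecker_sum, Matrix.sum_mul, Matrix.mul_sum, ← h]
  simp only [Fintype.sum_prod_type, Fintype.sum_sigma]
  symm
  refine (Finset.sum_congr rfl fun μ' _ => Finset.sum_comm).trans (Finset.sum_comm.trans ?_)
  refine Finset.sum_congr rfl fun l' _ => ?_
  conv_rhs => rw [Finset.sum_comm]
  refine Finset.sum_congr rfl fun μ' _ => Finset.sum_comm.trans ?_
  exact Finset.sum_congr rfl fun μ _ => Finset.sum_comm

theorem inputComponent_apply
    (R : Matrix (Mem L K m k) ((∀ j : Fin k, I j) × (∀ j : Fin k, O j)) ℂ)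
    (l' : Fin (L.num (k + 1))) (μ : Fin (K.num k)) (t : Fin (m k)) (l : Fin (L.num k))
    (a : Fin (T.mult k l l')) (u' : Fin (L.dim (k + 1) l')) (v : Fin (K.dim k μ))
    (e : (∀ j : Fin k, I j) × (∀ j : Fin k, O j)) (x : I k) :
    inputComponent T R l' μ (t, ⟨l, a⟩) (u', v) (e, x) =
      ∑ u, T.mat k l ⟨l', u', a⟩ (u, x) * R (⟨μ, v⟩, t, ⟨l, u⟩) e := by
  simp [inputComponent, inputSlice, memSlice, cgSlice, Matrix.mul_apply, Fintype.sum_prod_type,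
    Matrix.kroneckerMap_apply, Matrix.one_apply, prodRightComm]

/-- Apply the dual transform and then its adjoint: by unitarity nothing changes, and only the
labelled coordinates in between are nonzero. -/
theorem outputSlice_eq_sum
    {R : Matrix (Mem L K m (k + 1)) ((∀ j : Fin (k + 1), I j) × (∀ j : Fin (k + 1), O j)) ℂ}
    (hR : IsEquivariant R)
    (μ' : Fin (K.num (k + 1))) (t' : Fin (m (k + 1))) (l' : Fin (L.num (k + 1)))
    (u' : Fin (L.dim (k + 1) l')) (v' : Fin (K.dim (k + 1) μ')) (y : O k)
    (p : ((∀ j : Fin k, I j) × (∀ j : Fin k, O j)) × I k) :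
    outputSlice R μ' t' l' (u', v', y) p = ∑ μ, ∑ v, ∑ b,
      (D.mat k μ')ᴴ (v', y) (Sum.inl ⟨μ, v, b⟩) *
        outputComponent D R l' μ (⟨μ', b⟩, t') (u', v) p := by
  let w : Fin (K.dim (k + 1) μ') × O k → ℂ := fun q => outputSlice R μ' t' l' (u', q) p
  have h1 : ∀ r, (D.mat k μ' *ᵥ w) (Sum.inr r) = 0 := by
    intro r
    have h := congrFun (congrFun
      (one_kronecker_dualRest_mul_outputSlice D hR μ' t' l') (u', r)) p
    rw [Matrix.mul_apply, Fintype.sum_prod_type, Finset.sum_eq_single u'] at h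
    · simp only [Matrix.kroneckerMap_apply, Matrix.one_apply_eq, one_mul] at h
      exact h
    · intro u _ hu
      simp [Matrix.kroneckerMap_apply, hu.symm]
    · simp
  have h2 : ∀ μ v b, (D.mat k μ' *ᵥ w) (Sum.inl ⟨μ, v, b⟩) =
      outputComponent D R l' μ (⟨μ', b⟩, t') (u', v) p := by
    intro μ v b
    rw [outputComponent, Matrix.mul_apply, Fintype.sum_prod_type, Finset.sum_eq_single u']
    · simp only [Matrix.kroneckerMap_apply, Matrix.one_apply_eq, one_mul]
      rfl
    · intro u _ hu
      simp [Matrix.kroneckerMap_apply, hu.symm]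
    · simp
  have h3 : w = (D.mat k μ')ᴴ *ᵥ (D.mat k μ' *ᵥ w) := by
    rw [Matrix.mulVec_mulVec, (D.unitary k μ').1, Matrix.one_mulVec]
  have h4 := congrFun h3 (v', y)
  refine h4.trans ?_
  rw [Matrix.mulVec, dotProduct, Fintype.sum_sum_type, Fintype.sum_sigma]
  simp only [h1, mul_zero, Finset.sum_const_zero, add_zero, Fintype.sum_prod_type, h2]

theorem stepOp_apply (V : MultOps T D m) (i : ℕ) (o : O i) (μ' : Fin (K.num (i + 1)))
    (v' : Fin (K.dim (i + 1) μ')) (t' : Fin (m (i + 1))) (l' : Fin (L.num (i + 1)))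
    (u' : Fin (L.dim (i + 1) l')) (x : I i) (μ : Fin (K.num i)) (v : Fin (K.dim i μ))
    (t : Fin (m i)) (l : Fin (L.num i)) (u : Fin (L.dim i l)) :
    stepOp T D V i (o, ⟨μ', v'⟩, t', ⟨l', u'⟩) (x, ⟨μ, v⟩, t, ⟨l, u⟩) =
      ∑ a : Fin (T.mult i l l'), ∑ b : Fin (D.mult i μ μ'),
        (D.mat i μ')ᴴ (v', o) (Sum.inl ⟨μ, v, b⟩) * V i l' μ (⟨μ', b⟩, t') (t, ⟨l, a⟩) *
          T.mat i l ⟨l', u', a⟩ (u, x) := rfl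

/-- An equivariant purification of the first `k` steps of a comb is extended to one of the first
`k + 1` steps by a step of the circuit. -/
theorem exists_step
    {R : Matrix (Mem L K m k) ((∀ j : Fin k, I j) × (∀ j : Fin k, O j)) ℂ}
    {R' : Matrix (Mem L K m (k + 1)) ((∀ j : Fin (k + 1), I j) × (∀ j : Fin (k + 1), O j)) ℂ}
    (hR : IsEquivariant R) (hR' : IsEquivariant R')
    (gram : ptrace ((R'ᴴ * R').submatrix (combEquiv I O k) (combEquiv I O k)) =
      (Rᴴ * R) ⊗ₖ (1 : Matrix (I k) (I k) ℂ))
    (hcard : ∀ (l' : Fin (L.num (k + 1))) (μ : Fin (K.num k)),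
      Fintype.card (Fin (m k) × (Σ l : Fin (L.num k), Fin (T.mult k l l'))) ≤
      Fintype.card ((Σ μ' : Fin (K.num (k + 1)), Fin (D.mult k μ μ')) × Fin (m (k + 1)))) :
    ∃ Vk : ∀ (l' : Fin (L.num (k + 1))) (μ : Fin (K.num k)),
      Matrix ((Σ μ' : Fin (K.num (k + 1)), Fin (D.mult k μ μ')) × Fin (m (k + 1)))
        (Fin (m k) × (Σ l : Fin (L.num k), Fin (T.mult k l l'))) ℂ,
      (∀ l' μ, IsIsometry (Vk l' μ)) ∧
      ∀ V : MultOps T D m, V k = Vk → ∀ e x y c,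
        R' c (combEquiv I O k ((e, x), y)) = ∑ a, stepOp T D V k (y, c) (x, a) * R a e := by
  have : ∀ q : Fin (L.num (k + 1)) × Fin (K.num k),
      Nonempty (Fin (L.dim (k + 1) q.1) × Fin (K.dim k q.2)) := fun q => by
    have := L.nonempty_dim (k + 1) q.1
    have := K.nonempty_dim k q.2
    infer_instance
  -- The irreducible types are the pairs (λ', μ), with target V_λ' ⊗ V_μ; the multiplicity spaces
  -- are exactly the source and target registers of V^{λ'μ}.
  obtain ⟨V', hV', hV⟩ := exists_multiplicity_isometries
    (Y := fun q : Fin (L.num (k + 1)) × Fin (K.num k) =>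
      Fin (L.dim (k + 1) q.1) × Fin (K.dim k q.2))
    (τ := fun p => combRep ρ σ k p ⊗ₖ repMat (ρ k) p.1)
    (π := fun q => pairRep L K q.1 q.2)
    (P := fun q => inputComponent T R q.1 q.2) (Q := fun q => outputComponent D R' q.1 q.2)
    (fun p => by
      rw [Matrix.conjTranspose_kronecker, isStarRep_combRep, isStarRep_repMat]
      rfl)
    (fun q => isStarRep_pairRep q.1 q.2)
    (fun q S hS => Intertwines.exists_eq_smul_one_of_kronecker (L.irreducible _ _)
      (K.irreducible _ _) hS)
    (fun q r hqr S hS => Intertwines.eq_zero_of_kronecker hS (L.irreducible _ _)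
      (K.irreducible _ _) (L.irreducible _ _) (K.irreducible _ _) fun h =>
        hqr (Prod.ext (L.inequivalent _ _ _ h.1) (K.inequivalent _ _ _ h.2)))
    (fun q => inputComponent_intertwines T hR q.1 q.2)
    (fun q => outputComponent_intertwines D hR' q.1 q.2)
    (by rw [sum_inputComponent, sum_outputComponent D hR', gram])
    (fun q => hcard q.1 q.2)
  refine ⟨fun l' μ => V' (l', μ), fun l' μ => hV' (l', μ), ?_⟩
  rintro V hVk e x y ⟨⟨μ', v'⟩, t', ⟨l', u'⟩⟩
  -- R' is rebuilt from its dual components, and each of these is expanded through V in the CG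
  -- components of R. What remains is the sum that defines the step operator.
  refine (outputSlice_eq_sum D hR' μ' t' l' u' v' y (e, x)).trans ?_
  rw [Fintype.sum_prod_type, Fintype.sum_sigma]
  refine Finset.sum_congr rfl fun μ _ => Finset.sum_congr rfl fun v _ => ?_
  have h1 : ∀ b, outputComponent D R' l' μ (⟨μ', b⟩, t') (u', v) (e, x) =
      ∑ t, ∑ l, ∑ a, ∑ u, V k l' μ (⟨μ', b⟩, t') (t, ⟨l, a⟩) *
        (T.mat k l ⟨l', u', a⟩ (u, x) * R (⟨μ, v⟩, t, ⟨l, u⟩) e) := by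
    intro b
    have h := congrFun (congrFun (hV (l', μ) (⟨μ', b⟩, t')) (u', v)) (e, x)
    rw [Matrix.sum_apply] at h
    simp only [Matrix.smul_apply, smul_eq_mul, Fintype.sum_prod_type, Fintype.sum_sigma,
      inputComponent_apply, Finset.mul_sum] at h
    rw [hVk]
    exact h
  simp only [h1, Fintype.sum_prod_type, Fintype.sum_sigma, stepOp_apply,
    Finset.mul_sum, Finset.sum_mul]
  rw [Finset.sum_comm]
  refine Finset.sum_congr rfl fun t _ => ?_
  rw [Finset.sum_comm]
  refine Finset.sum_congr rfl fun l _ => ?_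
  rw [Finset.sum_comm]
  conv_rhs => rw [Finset.sum_comm]
  refine Finset.sum_congr rfl fun a _ => ?_
  rw [Finset.sum_comm]
  refine Finset.sum_congr rfl fun u _ => Finset.sum_congr rfl fun b _ => ?_
  ring

end StepExistence

/-! ### Assembling the circuit. -/

section Realization

variable {G H : Type*} [Group G] [Group H] {I O : ℕ → Type*}
  [∀ i, Fintype (I i)] [∀ i, DecidableEq (I i)] [∀ i, Fintype (O i)] [∀ i, DecidableEq (O i)]
  {ρ : ∀ i, G →* Matrix.unitaryGroup (I i) ℂ} {σ : ∀ i, H →* Matrix.unitaryGroup (O i) ℂ}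
  {L : Irreps ρ} {K : Irreps σ}

theorem isEquivariant_level_zero {m : ℕ → ℕ} :
    IsEquivariant (Matrix.of fun (_ : Mem L K m 0)
      (_ : (∀ j : Fin 0, I j) × (∀ j : Fin 0, O j)) => (1 : ℂ)) := by
  intro μ t l p
  simp only [combRep, pairRep]
  rw [tensorRep_zero, tensorRep_zero, L.repMat_level_zero, K.repMat_level_zero,
    Matrix.one_kronecker_one, Matrix.one_kronecker_one, Matrix.mul_one, Matrix.one_mul]

/-- Dimensions of the additional memories: at least `N i`, and large enough for the memory and the
multiplicity spaces of the previous level. -/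
def memoryDim (T : CGTransforms L) (N : ℕ → ℕ) : ℕ → ℕ
  | 0 => 1
  | i + 1 => N (i + 1) + ∑ l' : Fin (L.num (i + 1)),
      Fintype.card (Fin (memoryDim T N i) × (Σ l : Fin (L.num i), Fin (T.mult i l l')))

theorem isRealizable_of_isQuantumComb [∀ i, Nonempty (I i)] [∀ i, Nonempty (O i)]
    (T : CGTransforms L) (D : DualCGTransforms K) {n : ℕ}
    {C : Matrix ((∀ j : Fin n, I j) × (∀ j : Fin n, O j))
      ((∀ j : Fin n, I j) × (∀ j : Fin n, O j)) ℂ} (hC : IsQuantumComb n C)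
    (hcomm : ∀ (g : G) (h : H), Commute C
      (conjMat (tensorRep ρ n g) ⊗ₖ conjMat (tensorRep σ n h))) : IsRealizable T D n C := by
  classical
  obtain ⟨M, hCM, hM0, hMpos, hMcomm, hMtr⟩ := hC.exists_equivariant_sequence hcomm
  choose N hN using fun k => exists_equivariant_purification L K k
  set m : ℕ → ℕ := memoryDim T N
  have hm0 : m 0 = 1 := rfl
  have hmN : ∀ k, N (k + 1) ≤ m (k + 1) := fun k => Nat.le_add_right _ _
  have hmcard : ∀ (k : ℕ) (l' : Fin (L.num (k + 1))) (μ : Fin (K.num k)),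
      Fintype.card (Fin (m k) × (Σ l : Fin (L.num k), Fin (T.mult k l l'))) ≤
      Fintype.card ((Σ μ' : Fin (K.num (k + 1)), Fin (D.mult k μ μ')) × Fin (m (k + 1))) := by
    intro k l' μ
    -- Without a positive multiplicity the target of V would be zero however large the memory; with
    -- one, its dimension is at least m (k + 1).
    obtain ⟨μ', hμ'⟩ := D.exists_mult_pos k μ
    have h1 : 0 < Fintype.card (Σ μ' : Fin (K.num (k + 1)), Fin (D.mult k μ μ')) :=
      Fintype.card_pos_iff.2 ⟨⟨μ', ⟨0, hμ'⟩⟩⟩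
    have h3 : Fintype.card (Fin (m k) × (Σ l : Fin (L.num k), Fin (T.mult k l l'))) ≤
        ∑ j : Fin (L.num (k + 1)),
          Fintype.card (Fin (m k) × (Σ l : Fin (L.num k), Fin (T.mult k l j))) :=
      Finset.single_le_sum (s := Finset.univ)
        (f := fun j : Fin (L.num (k + 1)) =>
          (Fintype.card (Fin (m k) × (Σ l : Fin (L.num k), Fin (T.mult k l j))) : ℕ))
        (fun _ _ => Nat.zero_le _) (Finset.mem_univ l')
    have h2 : Fintype.card (Fin (m k) × (Σ l : Fin (L.num k), Fin (T.mult k l l'))) ≤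
        m (k + 1) := h3.trans (Nat.le_add_left _ _)
    rw [Fintype.card_prod (Σ μ' : Fin (K.num (k + 1)), Fin (D.mult k μ μ')), Fintype.card_fin]
    exact h2.trans (Nat.le_mul_of_pos_left _ h1)
  obtain ⟨a, ha⟩ := L.exists_unique_level_zero
  obtain ⟨b, hb⟩ := K.exists_unique_level_zero
  let a₀ : Mem L K m 0 := (b, (0 : Fin 1), a)
  have ha₀ : ∀ c : Mem L K m 0, c = a₀ := fun c =>
    Prod.ext (hb _) (Prod.ext (Subsingleton.elim (α := Fin 1) _ _) (ha _))
  have hR : ∀ k, ∃ R : Matrix (Mem L K m k) ((∀ j : Fin k, I j) × (∀ j : Fin k, O j)) ℂ,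
      k ≤ n → Rᴴ * R = M k ∧ IsEquivariant R ∧
        ∀ h : k = 0, ∀ c e, R c e = 1 := by
    rintro (_ | k)
    · refine ⟨Matrix.of fun _ _ => 1, fun _ => ⟨?_, isEquivariant_level_zero,
        fun _ _ _ => rfl⟩⟩
      rw [hM0]
      ext p q
      rw [Subsingleton.elim q p, Matrix.one_apply_eq, Matrix.mul_apply,
        Finset.sum_eq_single a₀ (fun c _ hc => absurd (ha₀ c) hc) (by simp)]
      simp
    · by_cases hk : k + 1 ≤ n
      · obtain ⟨R, h1, h2⟩ := hN (k + 1) m (hmN k) (M (k + 1)) (hMpos _ hk) (hMcomm _ hk)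
        exact ⟨R, fun _ => ⟨h1, h2, fun h => absurd h (Nat.succ_ne_zero k)⟩⟩
      · exact ⟨0, fun h => absurd h hk⟩
  choose R hR using hR
  have hV : ∀ k, ∃ Vk : ∀ (l' : Fin (L.num (k + 1))) (μ : Fin (K.num k)),
      Matrix ((Σ μ' : Fin (K.num (k + 1)), Fin (D.mult k μ μ')) × Fin (m (k + 1)))
        (Fin (m k) × (Σ l : Fin (L.num k), Fin (T.mult k l l'))) ℂ,
      k < n → (∀ l' μ, IsIsometry (Vk l' μ)) ∧
      ∀ V : MultOps T D m, V k = Vk → ∀ e x y c,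
        R (k + 1) c (combEquiv I O k ((e, x), y)) =
          ∑ a, stepOp T D V k (y, c) (x, a) * R k a e := by
    intro k
    by_cases hk : k < n
    · obtain ⟨h1, h2, -⟩ := hR k hk.le
      obtain ⟨h1', h2', -⟩ := hR (k + 1) hk
      obtain ⟨Vk, h⟩ := exists_step T D h2 h2' (by rw [h1, h1', hMtr k hk]) (hmcard k)
      exact ⟨Vk, fun _ => h⟩
    · exact ⟨fun _ _ => 0, fun h => absurd h hk⟩
  choose V hV using hV
  refine ⟨m, V, a₀, hm0, ha₀, fun i hi => (hV i hi).1,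
    fun i hi => isIsometry_stepOp T D V i (hV i hi).1, ?_⟩
  rw [combChoi_conjMap (A := Mem L K m) (stepOp T D V) a₀ R (fun c e => ?_) n
    fun k hk => (hV k hk).2 V rfl, (hR n le_rfl).1, hCM]
  rw [if_pos (ha₀ c).symm, (hR 0 (Nat.zero_le n)).2.2 rfl]

end Realization

end SymComb

theorem theorem1 {G H : Type*}
    [Group G] [TopologicalSpace G] [IsTopologicalGroup G] [CompactSpace G]
    [Group H] [TopologicalSpace H] [IsTopologicalGroup H] [CompactSpace H]
    {I O : ℕ → Type*}
    [∀ i, Fintype (I i)] [∀ i, DecidableEq (I i)] [∀ i, Nonempty (I i)]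
    [∀ i, Fintype (O i)] [∀ i, DecidableEq (O i)] [∀ i, Nonempty (O i)]
    (ρ : ∀ i, G →* Matrix.unitaryGroup (I i) ℂ) (hρ : ∀ i, Continuous (ρ i))
    (σ : ∀ i, H →* Matrix.unitaryGroup (O i) ℂ) (hσ : ∀ i, Continuous (σ i)) :
    (∃ L : SymComb.Irreps ρ, Nonempty (SymComb.CGTransforms L)) ∧
    (∃ K : SymComb.Irreps σ, Nonempty (SymComb.DualCGTransforms K)) ∧
    ∀ (L : SymComb.Irreps ρ) (T : SymComb.CGTransforms L)
      (K : SymComb.Irreps σ) (D : SymComb.DualCGTransforms K)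
      (n : ℕ)
      (C : Matrix ((∀ j : Fin n, I j) × (∀ j : Fin n, O j))
        ((∀ j : Fin n, I j) × (∀ j : Fin n, O j)) ℂ),
      SymComb.IsQuantumComb n C →
      (∀ (g : G) (h : H), Commute C
        (SymComb.conjMat (SymComb.tensorRep ρ n g) ⊗ₖ SymComb.conjMat (SymComb.tensorRep σ n h))) →
      SymComb.IsRealizable T D n C := by
  obtain ⟨L⟩ := SymComb.nonempty_irreps ρ
  obtain ⟨K⟩ := SymComb.nonempty_irreps σ
  exact ⟨⟨L, SymComb.nonempty_cgTransforms L⟩, ⟨K, SymComb.nonempty_dualCGTransforms K⟩,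
    fun L T K D n C hC hcomm => SymComb.isRealizable_of_isQuantumComb T D hC hcomm⟩
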